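/- **Setting.** Let $f:(0,\infty)\to[0,\infty)$ be continuous with $f(1)=0$, strictly increasing on $[1,\infty)$ and strictly decreasing on $(0,1]$; put $f(0):=\lim_{x\to0^+}f(x)\in(0,\infty]$. For $s>0$ let $$F_f(s)=\min\{f(x)+f(y):\ x,y>0,\ xy=s\}.$$ Let $\mathcal M,\mathcal N$ denote connected, compact, oriented, smooth two-dimensional Riemannian manifolds, possibly with Lipschitz boundary (that is, compact connected Lipschitz domains in oriented smooth Riemannian surfaces without boundary, or closed surfaces), with metrics $\mathfrak g,\mathfrak h$ and areas $V_{\mathcal M},V_{\mathcal N}$; $V_A$ denotes the Riemannian area of a set $A$. Let $\operatorname{Lip}_+^{\rm inj}(\mathcal M,\mathcal N)$ be the set of Lipschitz maps $\phi:\mathcal M\to\mathcal N$ whose Jacobian is non-negative almost everywhere and which are injective almost everywhere, i.e. $|\phi^{-1}(q)|\le 1$ for almost every $q\in\mathcal N$. With $\sigma_1(d\phi),\sigma_2(d\phi)$ the singular values of $d\phi_p:T_p\mathcal M\to T_{\phi(p)}\mathcal N$, set $$E_f(\phi)=\frac1{V_{\mathcal M}}\int_{\mathcal M}\big(f(\sigma_1(d\phi))+f(\sigma_2(d\phi))\big)\,\mathrm{Vol}_{\mathfrak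 g}\in[0,\infty].$$ A Lipschitz map $\phi$ is a *homothety* if there is a constant $\lambda>0$ with $\phi^*\mathfrak h=\lambda^2\mathfrak g$ (almost everywhere, where $d\phi$ is defined). $\mathcal M,\mathcal N$ are *homothetic* if there is an orientation-preserving smooth diffeomorphism $\mathcal M\to\mathcal N$ which is a homothety. **Theorem.** Suppose that $f$ is twice continuously differentiable in a neighbourhood of $1$ and not flat at $1$, i.e. for some $k\ge1$ the derivative $f^{(k)}(1)$ exists and is non-zero. Then there is $\alpha\in(0,1)$, depending only on $f$, such that the following hold for all $\mathcal M,\mathcal N$ as above. 1. If $\alpha\le V_{\mathcal N}/V_{\mathcal M}\le1$, then every $\phi\in\operatorname{Lip}_+^{\rm inj}(\mathcal M,\mathcal N)$ satisfies $$E_f(\phi)\ \ge\ F_f\!\left(\frac{V_{\mathcal N}}{V_{\mathcal M}}\right),$$ with equality if and only if $\phi$ is a surjective homothety. In particular, if moreover $\mathcal M$ and $\mathcal N$ are homothetic, then the minimizers of $E_f$ over $\operatorname{Lip}_+^{\rm inj}(\mathcal M,\mathcal N)$ are exactly the surjective homotheties in this set. 2. If $V_{\mathcal N}\le V_{\mathcal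 M}$, then every $\phi\in\operatorname{Lip}_+^{\rm inj}(\mathcal M,\mathcal N)$ with $V_{\phi(\mathcal M)}/V_{\mathcal M}\ge\alpha$ satisfies $$E_f(\phi)\ \ge\ F_f\!\left(\frac{V_{\phi(\mathcal M)}}{V_{\mathcal M}}\right),$$ with equality if and only if $\phi$ is a homothety. -/

import Mathlib

open Set Filter MeasureTheory Bundle Manifold
open scoped ENNReal NNReal Topology ContDiff

noncomputable section

/-! ### Cost functions -/

/-- A cost function `f : (0,∞) → [0,∞)`: continuous, `f 1 = 0`, strictly increasing on `[1,∞)` and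
strictly decreasing on `(0,1]`. The values of `f` outside `(0,∞)` are never used. -/
structure IsCostFunction (f : ℝ → ℝ) : Prop where
  continuousOn : ContinuousOn f (Ioi 0)
  nonneg : ∀ x, 0 < x → 0 ≤ f x
  map_one : f 1 = 0
  strictMonoOn : StrictMonoOn f (Ici 1)
  strictAntiOn : StrictAntiOn f (Ioc 0 1)

/-- `f` is `k` times differentiable at the point `x`: for `k ≥ 2` this means that `f` is
differentiable near `x` and `f'` is `k - 1` times differentiable at `x`. -/
def TimesDifferentiableAt : ℕ → (ℝ → ℝ) → ℝ → Prop
  | 0, _, _ => True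
  | 1, f, x => DifferentiableAt ℝ f x
  | k + 2, f, x => (∀ᶠ y in 𝓝 x, DifferentiableAt ℝ f y) ∧ TimesDifferentiableAt (k + 1) (deriv f) x

/-- `f` is differentiable and not flat at `x`: some derivative of `f` of order `k ≥ 1` exists at `x`
and does not vanish there. -/
def NotFlatAt (f : ℝ → ℝ) (x : ℝ) : Prop :=
  ∃ k : ℕ, 1 ≤ k ∧ TimesDifferentiableAt k f x ∧ iteratedDeriv k f x ≠ 0

/-- The cost of a singular value `x ≥ 0`. At `x = 0` it is the limit of `f` at `0` from the right
(possibly `∞`), which, as `f` decreases on `(0,1]`, is the supremum of `f` there. -/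
def extendedCost (f : ℝ → ℝ) (x : ℝ) : ℝ≥0∞ :=
  if 0 < x then ENNReal.ofReal (f x) else ⨆ y ∈ Ioc (0 : ℝ) 1, ENNReal.ofReal (f y)

/-- The auxiliary function `F_f(s) = min { f(x) + f(y) : x y = s, x, y > 0 }`, for `s > 0`.
(For a cost function `f` the minimum is attained.) -/
def auxF (f : ℝ → ℝ) (s : ℝ) : ℝ :=
  sInf {t : ℝ | ∃ x y : ℝ, 0 < x ∧ 0 < y ∧ x * y = s ∧ t = f x + f y}

/-! ### Oriented Riemannian surfaces -/

/-- The model plane. -/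
abbrev Plane : Type := EuclideanSpace ℝ (Fin 2)

/-- The `i`-th vector of the standard basis of the plane. -/
def planeVec (i : Fin 2) : Plane := EuclideanSpace.basisFun (Fin 2) ℝ i

section Surface

variable (X : Type*) [TopologicalSpace X] [ChartedSpace Plane X]

instance factFinrankTangentSpace (x : X) :
    Fact (Module.finrank ℝ (TangentSpace (𝓡 2) x) = 2) :=
  ⟨(finrank_euclideanSpace_fin : Module.finrank ℝ Plane = 2)⟩

instance finiteDimensionalTangentSpace (x : X) :
    FiniteDimensional ℝ (TangentSpace (𝓡 2) x) :=
  inferInstanceAs (FiniteDimensional ℝ Plane)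

variable {X}

/-- The coordinate vector `∂ᵢ` of the chart `e` at the point of `X` with coordinates `y`. -/
def coordVec (e : OpenPartialHomeomorph X Plane) (i : Fin 2) (y : Plane) :
    TangentSpace (𝓡 2) (e.symm y) :=
  mfderiv (𝓡 2) (𝓡 2) e.symm y (planeVec i : Plane)

variable (X)

/-- An orientation of the surface `X`: an orientation of every tangent space which is locally given
by the coordinate frame `(∂₁, ∂₂)` of a smooth chart. -/
structure SurfaceOrientation where
  /-- the orientation of the tangent space at a point -/
  at_point : ∀ x : X, Orientation ℝ (TangentSpace (𝓡 2) x) (Fin 2)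
  locally_coord : ∀ p : X, ∃ e ∈ IsManifold.maximalAtlas (𝓡 2) ∞ X, p ∈ e.source ∧
    ∀ y ∈ e.target, ∃ b : Module.Basis (Fin 2) ℝ (TangentSpace (𝓡 2) (e.symm y)),
      (∀ i, b i = coordVec e i y) ∧ b.orientation = at_point (e.symm y)

variable {X}

/-- `M` is a connected compact subsurface of the surface `X` with (possibly empty) Lipschitz
boundary: near each of its boundary points it is, in a suitable smooth chart, the region on and above
the graph of a Lipschitz function. For compact `X` the case `M = X` gives the closed surfaces. -/
structure IsCompactLipschitzSurface (M : Set X) : Prop where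
  isCompact : IsCompact M
  isConnected : IsConnected M
  lipschitz_boundary : ∀ p ∈ frontier M, ∃ e ∈ IsManifold.maximalAtlas (𝓡 2) ∞ X, p ∈ e.source ∧
    ∃ (γ : ℝ → ℝ) (K : ℝ≥0), LipschitzWith K γ ∧ ∀ x ∈ e.source, x ∈ M ↔ γ (e x 0) ≤ e x 1

variable [RiemannianBundle (fun x : X => TangentSpace (𝓡 2) x)]

/-- The Riemannian area density `√ det (gᵢⱼ)` of the chart `e` at the coordinates `y`. -/
def areaDensity (e : OpenPartialHomeomorph X Plane) (y : Plane) : ℝ :=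
  Real.sqrt (Matrix.det (Matrix.of fun i j : Fin 2 => inner ℝ (coordVec e i y) (coordVec e j y)))

variable [MeasurableSpace X]

/-- The coordinate expression of the Riemannian area on the domain of the chart `e`:
`A ↦ ∫_{e (A ∩ e.source)} √ det (gᵢⱼ) dy`. -/
def chartArea (e : OpenPartialHomeomorph X Plane) : Measure X :=
  ((volume.restrict e.target).withDensity fun y => ENNReal.ofReal (areaDensity e y)).map e.symm

variable (X)

/-- The Riemannian area measure of `X`, i.e. the measure which on each chart domain is the
coordinate area `√ det (gᵢⱼ) dy`. Since coordinate areas agree on overlaps of charts, it is the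
least measure dominating all of them, and this is how they are glued here. -/
def riemannianArea : Measure X :=
  ⨆ e ∈ atlas Plane X, chartArea e

variable {X}

/-- The Riemannian area `V_A` of a set `A`. -/
def area (A : Set X) : ℝ := (riemannianArea X).real A

end Surface

/-! ### Maps between surfaces -/

section Maps

variable {V W : Type*} [NormedAddCommGroup V] [InnerProductSpace ℝ V]
  [Fact (Module.finrank ℝ V = 2)] [NormedAddCommGroup W] [InnerProductSpace ℝ W]
  [Fact (Module.finrank ℝ W = 2)]

/-- The Jacobian (signed determinant) of a linear map between oriented Euclidean planes: the oriented
area of the image of a positively oriented orthonormal basis. -/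
def orientedJacobian (o : Orientation ℝ V (Fin 2)) (o' : Orientation ℝ W (Fin 2))
    (A : V →ₗ[ℝ] W) : ℝ :=
  o'.volumeForm fun i => A (o.finOrthonormalBasis two_pos Fact.out i)

variable {X Y : Type*}
  [EMetricSpace X] [MeasurableSpace X] [ChartedSpace Plane X]
  [RiemannianBundle (fun x : X => TangentSpace (𝓡 2) x)]
  [EMetricSpace Y] [MeasurableSpace Y] [ChartedSpace Plane Y]
  [RiemannianBundle (fun y : Y => TangentSpace (𝓡 2) y)]

/-- The differential `dφ_p : T_p X → T_{φ p} Y` of a map `φ` on `M`. -/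
def differential (φ : X → Y) (M : Set X) (p : X) :
    TangentSpace (𝓡 2) p →ₗ[ℝ] TangentSpace (𝓡 2) (φ p) :=
  (mfderivWithin (𝓡 2) (𝓡 2) φ M p).toLinearMap

/-- The Jacobian `Jφ` of a map `φ` on `M`. -/
def jacobian (oX : SurfaceOrientation X) (oY : SurfaceOrientation Y) (φ : X → Y) (M : Set X)
    (p : X) : ℝ :=
  orientedJacobian (oX.at_point p) (oY.at_point (φ p)) (differential φ M p)

/-- The space `Lip₊^inj(M, N)` of Lipschitz maps `M → N` (with respect to the Riemannian distances)
which have almost everywhere non-negative Jacobian and are injective almost everywhere, i.e. almost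
every point of `N` has at most one preimage. Maps are represented by functions `X → Y` whose values
outside `M` are irrelevant. -/
structure IsLipPlusInj (oX : SurfaceOrientation X) (oY : SurfaceOrientation Y)
    (M : Set X) (N : Set Y) (φ : X → Y) : Prop where
  mapsTo : MapsTo φ M N
  lipschitz : ∃ K : ℝ≥0, LipschitzOnWith K φ M
  jacobian_nonneg : ∀ᵐ p ∂(riemannianArea X).restrict M, 0 ≤ jacobian oX oY φ M p
  ae_injective : ∀ᵐ q ∂(riemannianArea Y).restrict N, (M ∩ φ ⁻¹' {q}).Subsingleton

/-- The energy `E_f(φ)`: the average over `M` of `f(σ₁(dφ)) + f(σ₂(dφ))`, with values in `[0,∞]`. -/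
def energy (f : ℝ → ℝ) (M : Set X) (φ : X → Y) : ℝ≥0∞ :=
  (∫⁻ p in M, (extendedCost f ((differential φ M p).singularValues 0) +
      extendedCost f ((differential φ M p).singularValues 1)) ∂(riemannianArea X)) /
    riemannianArea X M

/-- The condition `φ^* h = c² g` at the point `p` of `M`. -/
def ScalesMetricAt (c : ℝ) (M : Set X) (φ : X → Y) (p : X) : Prop :=
  ∀ v w : TangentSpace (𝓡 2) p,
    inner ℝ (differential φ M p v) (differential φ M p w) = c ^ 2 * inner ℝ v w

/-- A Lipschitz map `φ` on `M` is a homothety if `φ^* h = c² g` for a constant `c > 0`. The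
differential of a Lipschitz map is defined almost everywhere only, and so is this equality. -/
def IsHomothety (M : Set X) (φ : X → Y) : Prop :=
  ∃ c : ℝ, 0 < c ∧ ∀ᵐ p ∂(riemannianArea X).restrict M, ScalesMetricAt c M φ p

/-- `M` and `N` are homothetic: there is an orientation-preserving (smooth) diffeomorphism `M → N`
which is a homothety. -/
def AreHomothetic (oX : SurfaceOrientation X) (oY : SurfaceOrientation Y)
    (M : Set X) (N : Set Y) : Prop :=
  ∃ (ψ : X → Y) (χ : Y → X), MapsTo ψ M N ∧ MapsTo χ N M ∧ InvOn χ ψ M N ∧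
    ContMDiffOn (𝓡 2) (𝓡 2) ∞ ψ M ∧ ContMDiffOn (𝓡 2) (𝓡 2) ∞ χ N ∧
    (∀ p ∈ M, 0 < jacobian oX oY ψ M p) ∧
    ∃ c : ℝ, 0 < c ∧ ∀ p ∈ M, ScalesMetricAt c M ψ p

end Maps

end

/-! The proof is a calibration. Write σ₁, σ₂ for the singular values of dφ and r² for the area
ratio. Suppose that some c ≥ 0 satisfies f(x) + f(y) + c x y ≥ 2 f(r) + c r² for all x, y ≥ 0, with
equality only at x = y = r. Taking x y = r² shows F_f(r²) = 2 f(r). Since φ is injective almost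
everywhere, the area formula says that σ₁σ₂ integrates over M to the area of φ(M), which is at most
r² V_M. Integrating the inequality therefore bounds the energy below by 2 f(r). If the energy equals
2 f(r), the pointwise inequality is an equality almost everywhere, so σ₁ = σ₂ = r and φ is a
homothety; when r² V_M = V_N its image is a closed subset of N of full area, hence all of N.
Conversely, a homothety of factor λ has image area λ² V_M, so λ is the r belonging to its image and
its energy is 2 f(r).

The support inequality, `IsCostFunction.exists_strict_support`, is where α comes from. Criticality
at (r, r) forces c = -f'(r)/r, which is non-negative for r ≤ 1. Expanding f at r, the cross term c
(x - r)(y - r) completes a square as soon as the remainder of f exceeds (c/2)(x - r)² for x ≠ r.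
This holds near 1 because f'' dominates |f'| there: if k is the order of the first non-zero
derivative, then (x - 1) f''(x) / f'(x) tends to k - 1 ≥ 1. Away from 1, f is bounded below by a
positive constant, whereas 2 f(r) + c r² tends to 0 as r → 1.

The geometric input is the area formula on surfaces, `LipschitzOnWith.lintegral_absJacobian`. Charts
are locally bi-Lipschitz for the Riemannian distance, so Rademacher's theorem, Lusin's property (N)
and the planar change of variables carry over. To identify the minimizers one also needs a
competitor attaining the bound: a homothetic diffeomorphism is Lipschitz on M by
`ContMDiffOn.exists_lipschitzOnWith`, where the Lipschitz boundary enters. -/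

noncomputable section

/-! ### Calculus of the cost function at its non-flat minimum. -/

theorem tendsto_div_pow_of_iteratedDeriv_eq_zero (n : ℕ) {g : ℝ → ℝ} {a : ℝ}
    (hg : TimesDifferentiableAt (n + 1) g a) (h0 : ∀ j ≤ n, iteratedDeriv j g a = 0) :
    Tendsto (fun x => g x / (x - a) ^ (n + 1)) (𝓝[≠] a)
      (𝓝 (iteratedDeriv (n + 1) g a / (n + 1).factorial)) := by
  induction n generalizing g with
  | zero =>
    have hd : DifferentiableAt ℝ g a := hg
    have h := hasDerivAt_iff_tendsto_slope.1 hd.hasDerivAt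
    have hga : g a = 0 := by simpa using h0 0 le_rfl
    simp only [zero_add, iteratedDeriv_one, Nat.factorial_one, Nat.cast_one, div_one, pow_one]
    refine h.congr fun x => ?_
    simp [slope_def_field, hga]
  | succ n ih =>
    obtain ⟨hd, hg'⟩ : (∀ᶠ y in 𝓝 a, DifferentiableAt ℝ g y) ∧
      TimesDifferentiableAt (n + 1) (deriv g) a := hg
    have hga : g a = 0 := by simpa using h0 0 (by simp)
    have h1 := ih hg' fun j hj => by
      rw [← iteratedDeriv_succ']
      exact h0 (j + 1) (by omega)
    rw [← iteratedDeriv_succ'] at h1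
    have hne : ∀ᶠ x in 𝓝[≠] a, x ≠ a := eventually_mem_nhdsWithin
    have hc : ContinuousAt g a := hd.self_of_nhds.continuousAt
    -- L'Hôpital's rule passes from `g` to `deriv g`; the factor n + 2 turns (n + 1)! into (n + 2)!.
    refine HasDerivAt.lhopital_zero_nhdsNE (f' := deriv g)
      (g' := fun x => (n + 2 : ℕ) * (x - a) ^ (n + 1)) ?_ ?_ ?_ ?_ ?_ ?_
    · exact (hd.filter_mono nhdsWithin_le_nhds).mono fun x hx => hx.hasDerivAt
    · refine Eventually.of_forall fun x => ?_
      simpa using ((hasDerivAt_id' x).sub_const a).fun_pow (n + 2)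
    · filter_upwards [hne] with x hx
      have : x - a ≠ 0 := sub_ne_zero.2 hx
      positivity
    · simpa [hga] using hc.tendsto.mono_left nhdsWithin_le_nhds
    · have : ContinuousAt (fun x : ℝ => (x - a) ^ (n + 1 + 1)) a := by fun_prop
      simpa using this.tendsto.mono_left nhdsWithin_le_nhds
    · have h2 := h1.div_const ((n + 2 : ℕ) : ℝ)
      have e : iteratedDeriv (n + 1 + 1) g a / ((n + 1 + 1).factorial : ℝ)
          = iteratedDeriv (n + 1 + 1) g a / ((n + 1).factorial : ℝ) / ((n + 2 : ℕ) : ℝ) := by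
        rw [Nat.factorial_succ (n + 1)]
        push_cast
        rw [div_div, mul_comm]
        ring_nf
      rw [e]
      refine h2.congr fun x => ?_
      rw [div_div, mul_comm]

theorem ContDiffAt.deriv_right' {g : ℝ → ℝ} {a : ℝ} {m n : WithTop ℕ∞} (h : ContDiffAt ℝ n g a)
    (hmn : m + 1 ≤ n) : ContDiffAt ℝ m (deriv g) a := by
  have := (h.fderiv_right hmn).clm_apply (contDiffAt_const (c := (1 : ℝ)))
  simpa using this

theorem TimesDifferentiableAt.mono {k j : ℕ} {g : ℝ → ℝ} {a : ℝ}
    (h : TimesDifferentiableAt k g a) (hj : j ≤ k) : TimesDifferentiableAt j g a := by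
  induction k generalizing j g with
  | zero =>
    obtain rfl : j = 0 := by omega
    trivial
  | succ k ih =>
    match k, j with
    | _, 0 => trivial
    | 0, 1 => exact h
    | 0, j + 2 => omega
    | k + 1, 1 => exact h.1.self_of_nhds
    | k + 1, j + 2 => exact ⟨h.1, ih h.2 (by omega)⟩

theorem IsCostFunction.pos {f : ℝ → ℝ} (hf : IsCostFunction f) {x : ℝ} (hx : 0 < x)
    (hx1 : x ≠ 1) : 0 < f x := by
  rw [← hf.map_one]
  rcases lt_or_gt_of_ne hx1 with h | h
  · exact hf.strictAntiOn ⟨hx, h.le⟩ ⟨one_pos, le_rfl⟩ h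
  · exact hf.strictMonoOn (mem_Ici.2 le_rfl) (mem_Ici.2 h.le) h

theorem IsCostFunction.deriv_one {f : ℝ → ℝ} (hf : IsCostFunction f) : deriv f 1 = 0 := by
  refine IsLocalMin.deriv_eq_zero ?_
  filter_upwards [Ioi_mem_nhds one_pos] with x hx
  rw [hf.map_one]
  exact hf.nonneg x hx

/-- Near the non-flat minimum `1`, the logarithmic derivative of `f'` exceeds `1 / (2 (x - 1))`. -/
theorem IsCostFunction.eventually_deriv {f : ℝ → ℝ} (hf : IsCostFunction f)
    (hC : ContDiffAt ℝ 2 f 1) (hn : NotFlatAt f 1) :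
    ∀ᶠ x in 𝓝[<] 1, deriv f x < 0 ∧ -deriv f x / 2 < (1 - x) * deriv (deriv f) x := by
  classical
  have hex : ∃ k : ℕ, 1 ≤ k ∧ TimesDifferentiableAt k f 1 ∧ iteratedDeriv k f 1 ≠ 0 := hn
  -- Let k be the least order of a non-zero derivative; k ≥ 2 because f'(1) = 0. The leading terms
  -- of f' and f'' at 1 give (x - 1) f''(x) / f'(x) → k - 1.
  obtain ⟨hk1, hkd, hk0⟩ := Nat.find_spec hex
  set k := Nat.find hex with hk
  have hmin : ∀ j < k, iteratedDeriv j f 1 = 0 := by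
    intro j hj
    rcases Nat.eq_zero_or_pos j with rfl | hj1
    · simpa using hf.map_one
    by_contra h
    exact Nat.find_min hex hj ⟨hj1, hkd.mono hj.le, h⟩
  clear_value k
  match k with
  | 0 => omega
  | 1 => exact absurd hf.deriv_one (by simpa using hk0)
  | n + 2 =>
    have hd : TimesDifferentiableAt (n + 1) (deriv f) 1 := hkd.2
    have h1 := tendsto_div_pow_of_iteratedDeriv_eq_zero n hd fun j hj => by
      rw [← iteratedDeriv_succ']
      exact hmin _ (by omega)
    rw [← iteratedDeriv_succ'] at h1
    set A := iteratedDeriv (n + 1 + 1) f 1 with hA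
    have h2 : Tendsto (fun x => deriv (deriv f) x / (x - 1) ^ n) (𝓝[≠] 1)
        (𝓝 (A / n.factorial)) := by
      -- For k = 2 the quotient is f'' itself, and its limit is the continuity of f'' at 1. For k ≥
      -- 3 the expansion applies to f''.
      rcases n with _ | n
      · simp only [pow_zero, div_one, Nat.factorial_zero, Nat.cast_one]
        have hc : ContDiffAt ℝ 0 (deriv (deriv f)) 1 := by
          exact (hC.deriv_right' (m := 1) (by norm_num)).deriv_right' (by norm_num)
        have := hc.continuousAt.tendsto.mono_left (nhdsWithin_le_nhds (s := {1}ᶜ))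
        convert this using 2
        simp [hA, iteratedDeriv_succ, iteratedDeriv_zero]
      · have := tendsto_div_pow_of_iteratedDeriv_eq_zero n (g := deriv (deriv f)) hkd.2.2
          fun j hj => by
            rw [← iteratedDeriv_succ', ← iteratedDeriv_succ']
            exact hmin _ (by omega)
        rw [← iteratedDeriv_succ', ← iteratedDeriv_succ'] at this
        exact this
    have hA0 : A ≠ 0 := hk0
    have hlim : Tendsto (fun x => deriv (deriv f) x / (x - 1) ^ n / (deriv f x / (x - 1) ^ (n + 1)))
        (𝓝[≠] 1) (𝓝 ((n : ℝ) + 1)) := by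
      have := h2.div h1 (by positivity)
      have e : A / n.factorial / (A / (n + 1).factorial) = (n : ℝ) + 1 := by
        rw [Nat.factorial_succ]
        push_cast
        field_simp
      rwa [e] at this
    have hhalf : (1 / 2 : ℝ) < n + 1 := by
      have : (0 : ℝ) ≤ n := Nat.cast_nonneg n
      linarith
    have e1 := (hlim.eventually (lt_mem_nhds hhalf)).filter_mono
      (nhdsWithin_mono (1 : ℝ) fun x (hx : x < 1) => hx.ne)
    have hIoo : Ioo (0 : ℝ) 1 ∈ 𝓝[<] (1 : ℝ) := Ioo_mem_nhdsLT one_pos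
    filter_upwards [e1, hIoo] with x hx hx1
    have hneg : deriv f x ≤ 0 := by
      have : derivWithin f (Ioc 0 1) x ≤ 0 := hf.strictAntiOn.antitoneOn.derivWithin_nonpos
      rwa [derivWithin_of_mem_nhds (mem_of_superset (Ioo_mem_nhds hx1.1 hx1.2) Ioo_subset_Ioc_self)]
        at this
    have hx0 : x - 1 ≠ 0 := by linarith [hx1.2]
    -- If f'(x) were 0, the quotient in `hx` would be 0 by the convention for division by zero,
    -- against the bound 1/2.
    have hne : deriv f x ≠ 0 := by
      intro h
      rw [h] at hx
      norm_num at hx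
    have hlt := lt_of_le_of_ne hneg hne
    refine ⟨hlt, ?_⟩
    have e2 : deriv (deriv f) x / (x - 1) ^ n / (deriv f x / (x - 1) ^ (n + 1))
        = (1 - x) * deriv (deriv f) x / (-deriv f x) := by
      field_simp
      ring
    rw [e2, lt_div_iff₀ (by linarith)] at hx
    linarith

/-- The second order comparison behind the strict supporting property of `f` close to `1`: the
remainder of the linear expansion of `f` at `r < 1` dominates `-f'(r) / (2 r) * (x - r) ^ 2`. -/
theorem IsCostFunction.linear_remainder_pos {f : ℝ → ℝ} (hf : IsCostFunction f) {δ r x : ℝ}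
    (hδ0 : 0 < δ) (hδ : δ ≤ 1 / 8)
    (hd : ∀ y ∈ Icc (1 - δ) (1 + δ), DifferentiableAt ℝ f y)
    (hdd : ∀ y ∈ Icc (1 - δ) (1 + δ), DifferentiableAt ℝ (deriv f) y)
    (hl : ∀ y ∈ Ico (1 - δ) 1,
      deriv f y < 0 ∧ -deriv f y / 2 < (1 - y) * deriv (deriv f) y)
    (hr : r ∈ Ioo (1 - δ) 1) (hx : x ∈ Icc (1 - δ) (1 + δ)) (hxr : x ≠ r) :
    0 < f x - f r - deriv f r * (x - r) + deriv f r / r / 2 * (x - r) ^ 2 := by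
  obtain ⟨hr1, hr2⟩ := hr
  have hr0 : 3 / 4 < r := by linarith
  set p := -deriv f r with hp
  have hp0 : 0 < p := by linarith [(hl r ⟨hr1.le, hr2⟩).1]
  have hpr : p / r * r = p := by field_simp
  have hpr2 : p / r ≤ 4 / 3 * p := by
    rw [div_le_iff₀ (by linarith)]
    nlinarith
  have hpr0 : 0 < p / r := by positivity
  have hpos : ∀ y ∈ Ico (1 - δ) 1, 0 < deriv (deriv f) y := by
    intro y hy
    have := hl y hy
    have h1 : 0 < (1 - y) * deriv (deriv f) y := by linarith
    exact pos_of_mul_pos_right h1 (by linarith [hy.2])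
  have hmono : StrictMonoOn (deriv f) (Icc (1 - δ) 1) := by
    refine strictMonoOn_of_deriv_pos (convex_Icc _ _) (fun y hy =>
      (hdd y ⟨hy.1, by linarith [hy.2]⟩).continuousAt.continuousWithinAt) fun y hy => ?_
    rw [interior_Icc] at hy
    exact hpos y ⟨hy.1.le, hy.2⟩
  have hmvt : ∀ a b, 1 - δ ≤ a → a < b → b ≤ 1 → ∃ ξ ∈ Ioo a b,
      deriv (deriv f) ξ * (b - a) = deriv f b - deriv f a := by
    intro a b ha hab hb
    obtain ⟨ξ, hξ, h⟩ := exists_deriv_eq_slope (deriv f) hab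
      (fun y hy => (hdd y ⟨by linarith [hy.1], by linarith [hy.2]⟩).continuousAt.continuousWithinAt)
      (fun y hy => (hdd y ⟨by linarith [hy.1], by linarith [hy.2]⟩).differentiableWithinAt)
    refine ⟨ξ, hξ, ?_⟩
    rw [h]
    have : b - a ≠ 0 := by linarith
    field_simp
  -- This function vanishes at r, so it suffices that it decreases before r and increases after r.
  -- By the mean value theorem for f', this amounts to comparing f'' with p / r.
  set h : ℝ → ℝ := fun y => f y - f r + p * (y - r) - p / r / 2 * (y - r) ^ 2 with hh
  have hder : ∀ y ∈ Icc (1 - δ) (1 + δ), HasDerivAt h (deriv f y + p - p / r * (y - r)) y := by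
    intro y hy
    have := (((hd y hy).hasDerivAt.sub_const (f r)).add
      (((hasDerivAt_id' y).sub_const r).const_mul p)).sub
      ((((hasDerivAt_id' y).sub_const r).fun_pow 2).const_mul (p / r / 2))
    refine HasDerivAt.congr_deriv (f' := _) (this : HasDerivAt h _ y) ?_
    norm_num
    ring
  -- To the left of r, -f'(ξ) > p and 1 - ξ ≤ 1/8, so `hl` gives f''(ξ) > 4 p, more than p / r ≤ 4 p
  -- / 3.
  have hleft : ∀ y ∈ Ioo (1 - δ) r, deriv f y + p - p / r * (y - r) < 0 := by
    intro y hy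
    obtain ⟨ξ, hξ, he⟩ := hmvt y r hy.1.le hy.2 hr2.le
    have hξm : ξ ∈ Ico (1 - δ) 1 := ⟨by linarith [hξ.1, hy.1], by linarith [hξ.2]⟩
    have h1 : deriv f ξ < deriv f r := hmono ⟨hξm.1, hξm.2.le⟩ ⟨hr1.le, hr2.le⟩ hξ.2
    have h2 := (hl ξ hξm).2
    have h3 := hpos ξ hξm
    have h4 : 4 * p < deriv (deriv f) ξ := by
      have : (1 - ξ) * deriv (deriv f) ξ ≤ 1 / 8 * deriv (deriv f) ξ := by
        apply mul_le_mul_of_nonneg_right _ h3.le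
        linarith [hξm.1]
      linarith
    have h5 : 0 < r - y := by linarith [hy.2]
    nlinarith
  have hright : ∀ y ∈ Ioo r (1 + δ), 0 < deriv f y + p - p / r * (y - r) := by
    intro y hy
    rcases lt_or_ge y 1 with hy1 | hy1
    · obtain ⟨ξ, hξ, he⟩ := hmvt r y hr1.le hy.1 hy1.le
      have hξm : ξ ∈ Ico (1 - δ) 1 := ⟨by linarith [hξ.1, hy.1], by linarith [hξ.2]⟩
      have h2 := (hl ξ hξm).2
      have h3 := hpos ξ hξm
      have h5 : 0 < y - r := by linarith [hy.1]
      -- Either |f'(ξ)| is still at least p / 2, and then f''(ξ) is large enough, or f' has already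
      -- risen by p / 2, more than the term p / r * (y - r) can take away.
      rcases le_or_gt (p / 2) (-deriv f ξ) with hc | hc
      · have : (1 - ξ) * deriv (deriv f) ξ ≤ 1 / 8 * deriv (deriv f) ξ := by
          apply mul_le_mul_of_nonneg_right _ h3.le
          linarith [hξm.1]
        have : 4 / 3 * p < deriv (deriv f) ξ := by linarith
        nlinarith
      · have h1 : deriv f ξ < deriv f y :=
          hmono ⟨hξm.1, hξm.2.le⟩ ⟨by linarith [hy.1], hy1.le⟩ hξ.2
        have : p / r * (y - r) ≤ 4 / 3 * p * (1 / 8) := by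
          apply mul_le_mul hpr2 (by linarith) h5.le (by linarith)
        linarith
    · have h1 : 0 ≤ deriv f y := by
        have hy0 : y ∈ Ici (1 : ℝ) := hy1
        rcases hy1.eq_or_lt with rfl | hy1
        · exact hf.deriv_one.ge
        have : 0 ≤ derivWithin f (Ici 1) y := hf.strictMonoOn.monotoneOn.derivWithin_nonneg
        rwa [derivWithin_of_mem_nhds (Ici_mem_nhds hy1)] at this
      have : p / r * (y - r) ≤ 4 / 3 * p * (1 / 4) := by
        apply mul_le_mul hpr2 (by linarith [hy.2]) (by linarith) (by linarith)
      linarith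
  have hcont : ContinuousOn h (Icc (1 - δ) (1 + δ)) :=
    fun y hy => (hder y hy).continuousAt.continuousWithinAt
  have hanti : StrictAntiOn h (Icc (1 - δ) r) := by
    refine strictAntiOn_of_deriv_neg (convex_Icc _ _)
      (hcont.mono (Icc_subset_Icc le_rfl (by linarith))) fun y hy => ?_
    rw [interior_Icc] at hy
    rw [(hder y ⟨hy.1.le, by linarith [hy.2]⟩).deriv]
    exact hleft y hy
  have hmon : StrictMonoOn h (Icc r (1 + δ)) := by
    refine strictMonoOn_of_deriv_pos (convex_Icc _ _)
      (hcont.mono (Icc_subset_Icc (by linarith) le_rfl)) fun y hy => ?_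
    rw [interior_Icc] at hy
    rw [(hder y ⟨by linarith [hy.1], hy.2.le⟩).deriv]
    exact hright y hy
  have hr' : h r = 0 := by simp [hh]
  have : 0 < h x := by
    rw [← hr']
    rcases lt_or_gt_of_ne hxr with hlt | hgt
    · exact hanti ⟨hx.1, hlt.le⟩ ⟨hr1.le, le_rfl⟩ hlt
    · exact hmon ⟨le_rfl, by linarith⟩ ⟨hgt.le, hx.2⟩ hgt
  have e : deriv f r = -p := by rw [hp, neg_neg]
  rw [e]
  rw [hh] at this
  convert this using 1
  ring

/-! ### The strict support inequality for f(x) + f(y). -/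

theorem extendedCost_of_pos (f : ℝ → ℝ) {x : ℝ} (hx : 0 < x) :
    extendedCost f x = ENNReal.ofReal (f x) := if_pos hx

theorem IsCostFunction.ofReal_min_le_extendedCost {f : ℝ → ℝ} (hf : IsCostFunction f) {δ x : ℝ}
    (hδ0 : 0 < δ) (hδ1 : δ < 1) (hx : x ∉ Icc (1 - δ) (1 + δ)) :
    ENNReal.ofReal (min (f (1 - δ)) (f (1 + δ))) ≤ extendedCost f x := by
  rcases le_or_gt x 0 with hx0 | hx0
  · rw [extendedCost, if_neg hx0.not_gt]
    refine le_trans (ENNReal.ofReal_le_ofReal (min_le_left _ _)) ?_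
    exact le_iSup₂_of_le (1 - δ) ⟨by linarith, by linarith⟩ le_rfl
  · rw [extendedCost_of_pos f hx0]
    apply ENNReal.ofReal_le_ofReal
    rw [mem_Icc, not_and_or, not_le, not_le] at hx
    rcases hx with h | h
    · exact (min_le_left _ _).trans
        (hf.strictAntiOn ⟨hx0, by linarith⟩ ⟨by linarith, by linarith⟩ h).le
    · exact (min_le_right _ _).trans
        (hf.strictMonoOn (mem_Ici.2 (by linarith)) (mem_Ici.2 (by linarith)) h).le

/-- For `r ≤ 1` close to `1`, the map `(x, y) ↦ f x + f y` lies strictly above the function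
`2 f(r) - c (x y - r ^ 2)`, for some slope `c ≥ 0`, outside of `(r, r)`. -/
theorem IsCostFunction.exists_strict_support {f : ℝ → ℝ} (hf : IsCostFunction f)
    (hC : ContDiffAt ℝ 2 f 1) (hn : NotFlatAt f 1) :
    ∃ r₀ ∈ Ioo (0 : ℝ) 1, ∀ r ∈ Icc r₀ 1, ∃ c : ℝ, 0 ≤ c ∧ ∀ x y : ℝ, 0 ≤ x → 0 ≤ y →
      ¬ (x = r ∧ y = r) → ENNReal.ofReal (2 * f r + c * r ^ 2) <
        extendedCost f x + extendedCost f y + ENNReal.ofReal (c * (x * y)) := by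
  have hC1 : ContDiffAt ℝ 1 (deriv f) 1 := hC.deriv_right' (by norm_num)
  have h1 : ∀ᶠ y in 𝓝 (1 : ℝ), DifferentiableAt ℝ f y ∧ DifferentiableAt ℝ (deriv f) y := by
    filter_upwards [hC.eventually (by simp), hC1.eventually (by simp)] with y hy hy'
    exact ⟨hy.differentiableAt (by norm_num), hy'.differentiableAt (by norm_num)⟩
  have h2 := eventually_nhdsWithin_iff.1 (hf.eventually_deriv hC hn)
  obtain ⟨δ', hδ'0, hδ'⟩ := Metric.eventually_nhds_iff.1 (h1.and h2)
  obtain ⟨δ, hδ0, hδ8, hδlt⟩ : ∃ δ : ℝ, 0 < δ ∧ δ ≤ 1 / 8 ∧ δ < δ' :=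
    ⟨min (1 / 8) (δ' / 2), by positivity, min_le_left _ _,
      (min_le_right _ _).trans_lt (by linarith)⟩
  have hI : ∀ y ∈ Icc (1 - δ) (1 + δ), dist y 1 < δ' := by
    intro y hy
    rw [Real.dist_eq, abs_lt]
    constructor <;> linarith [hy.1, hy.2]
  set η := min (f (1 - δ)) (f (1 + δ)) with hη
  have hη0 : 0 < η := lt_min (hf.pos (by linarith) (by linarith)) (hf.pos (by linarith) (by linarith))
  -- As f(1) = f'(1) = 0, the level 2 f(r) + c r² = 2 f(r) - r f'(r) drops below the lower bound η
  -- of f outside [1 - δ, 1 + δ].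
  have hcont : Tendsto (fun r : ℝ => 2 * f r - deriv f r * r) (𝓝 1) (𝓝 0) := by
    have : ContinuousAt (fun r : ℝ => 2 * f r - deriv f r * r) 1 :=
      (continuousAt_const.mul hC.continuousAt).sub (hC1.continuousAt.mul continuousAt_id)
    have h := this.tendsto
    simpa [hf.map_one, hf.deriv_one] using h
  obtain ⟨ρ, hρ0, hρ⟩ := Metric.eventually_nhds_iff.1 (hcont.eventually (gt_mem_nhds hη0))
  obtain ⟨τ, hτ0, hτδ, hτρ⟩ : ∃ τ : ℝ, 0 < τ ∧ τ < δ ∧ τ < ρ :=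
    ⟨min δ ρ / 2, by positivity, by linarith [min_le_left δ ρ, lt_min hδ0 hρ0],
      by linarith [min_le_right δ ρ, lt_min hδ0 hρ0]⟩
  refine ⟨1 - τ, ⟨by linarith, by linarith⟩, fun r hr => ?_⟩
  rcases hr.2.eq_or_lt with rfl | hr1
  · refine ⟨0, le_rfl, fun x y hx hy hxy => ?_⟩
    have key : ∀ z : ℝ, z ≠ 1 → 0 < extendedCost f z := by
      intro z hz
      rcases le_or_gt z 0 with hz0 | hz0
      · rw [extendedCost, if_neg hz0.not_gt]
        refine lt_of_lt_of_le (ENNReal.ofReal_pos.2 (hf.pos (x := 1 / 2) ?_ ?_))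
          (le_iSup₂_of_le (1 / 2) ⟨by norm_num, by norm_num⟩ le_rfl) <;> norm_num
      · rw [extendedCost_of_pos f hz0]
        exact ENNReal.ofReal_pos.2 (hf.pos hz0 hz)
    simp only [hf.map_one, zero_mul, mul_zero, add_zero, ENNReal.ofReal_zero]
    rcases not_and_or.1 hxy with h | h
    · exact (key x h).trans_le le_self_add
    · exact (key y h).trans_le le_add_self
  have hrm : r ∈ Ioo (1 - δ) 1 := ⟨by linarith [hr.1], hr1⟩
  have hl : ∀ y ∈ Ico (1 - δ) 1,
      deriv f y < 0 ∧ -deriv f y / 2 < (1 - y) * deriv (deriv f) y :=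
    fun y hy => (hδ' (hI y ⟨hy.1, by linarith [hy.2]⟩)).2 hy.2
  have hr0 : 0 < r := by linarith [hrm.1]
  have hneg := (hl r ⟨hrm.1.le, hr1⟩).1
  -- The only slope for which (r, r) is a critical point of f(x) + f(y) + c x y.
  set c := -deriv f r / r with hc
  have hc0 : 0 < c := div_pos (by linarith) hr0
  have hcr : c * r = -deriv f r := by rw [hc]; field_simp
  have hsmall : 2 * f r + c * r ^ 2 < η := by
    have : 2 * f r - deriv f r * r < η := by
      apply hρ
      rw [Real.dist_eq, abs_lt]
      constructor <;> linarith [hr.1]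
    have e : c * r ^ 2 = -deriv f r * r := by rw [← hcr]; ring
    linarith
  have hout : ∀ z, z ∉ Icc (1 - δ) (1 + δ) →
      ENNReal.ofReal (2 * f r + c * r ^ 2) < extendedCost f z := fun z hz =>
    ((ENNReal.ofReal_lt_ofReal_iff hη0).2 hsmall).trans_le
      (hf.ofReal_min_le_extendedCost hδ0 (by linarith) hz)
  refine ⟨c, hc0.le, fun x y hx hy hxy => ?_⟩
  by_cases hxI : x ∈ Icc (1 - δ) (1 + δ)
  swap
  · exact (hout x hxI).trans_le (le_self_add.trans le_self_add)
  by_cases hyI : y ∈ Icc (1 - δ) (1 + δ)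
  swap
  · exact (hout y hyI).trans_le (le_add_self.trans le_self_add)
  have hx0 : 0 < x := by linarith [hxI.1]
  have hy0 : 0 < y := by linarith [hyI.1]
  rw [extendedCost_of_pos f hx0, extendedCost_of_pos f hy0,
    ← ENNReal.ofReal_add (hf.nonneg x hx0) (hf.nonneg y hy0),
    ← ENNReal.ofReal_add (add_nonneg (hf.nonneg x hx0) (hf.nonneg y hy0)) (by positivity)]
  have hrem : ∀ z ∈ Icc (1 - δ) (1 + δ), z ≠ r →
      0 < f z - f r + c * r * (z - r) - c / 2 * (z - r) ^ 2 := by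
    intro z hz hzr
    have := hf.linear_remainder_pos hδ0 hδ8 (fun y hy => (hδ' (hI y hy)).1.1)
      (fun y hy => (hδ' (hI y hy)).1.2) hl hrm hz hzr
    have e : deriv f r / r / 2 = -(c / 2) := by rw [hc]; ring
    rw [e] at this
    rw [hcr]
    linarith
  have hrem0 : ∀ z ∈ Icc (1 - δ) (1 + δ),
      0 ≤ f z - f r + c * r * (z - r) - c / 2 * (z - r) ^ 2 := by
    intro z hz
    by_cases hzr : z = r
    · simp [hzr]
    · exact (hrem z hz hzr).le
  -- With c r = -f'(r) the linear terms cancel. The remainders exceed c/2 (x - r)² and c/2 (y - r)²,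
  -- and the cross term c (x - r)(y - r) completes them to this square.
  have hsq : 0 ≤ c / 2 * ((x - r) + (y - r)) ^ 2 := by positivity
  have hfin : 2 * f r + c * r ^ 2 < f x + f y + c * (x * y) := by
    rcases not_and_or.1 hxy with h | h
    · nlinarith [hrem x hxI h, hrem0 y hyI]
    · nlinarith [hrem y hyI h, hrem0 x hxI]
  refine (ENNReal.ofReal_lt_ofReal_iff ?_).2 hfin
  have := hf.nonneg r hr0
  nlinarith [sq_nonneg r]

/-! ### Singular values and Gram matrices in non-orthonormal frames. -/

section SingularValues

open Module

variable {V W : Type*} [NormedAddCommGroup V] [InnerProductSpace ℝ V] [FiniteDimensional ℝ V]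
  [NormedAddCommGroup W] [InnerProductSpace ℝ W] [FiniteDimensional ℝ W]

/-- Expand L*L bⱼ in the basis in ⟨L bᵢ, L bⱼ⟩ = ⟨bᵢ, L*L bⱼ⟩. Determinant and trace of L*L can then
be read from coordinate frames, which are not orthonormal. -/
theorem gram_map (L : V →ₗ[ℝ] W) (b : Basis (Fin 2) ℝ V) :
    Matrix.gram ℝ (fun i => L (b i)) =
      Matrix.gram ℝ b * LinearMap.toMatrix b b (LinearMap.adjoint L ∘ₗ L) := by
  ext i j
  have h : ∑ k, LinearMap.toMatrix b b (LinearMap.adjoint L ∘ₗ L) k j • b k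
      = (LinearMap.adjoint L ∘ₗ L) (b j) := by
    simp_rw [LinearMap.toMatrix_apply]
    exact b.sum_repr _
  have h2 : inner ℝ (L (b i)) (L (b j)) = inner ℝ (b i) ((LinearMap.adjoint L ∘ₗ L) (b j)) := by
    rw [LinearMap.comp_apply, LinearMap.adjoint_inner_right]
  rw [Matrix.mul_apply]
  simp only [Matrix.gram_apply]
  rw [h2, ← h, inner_sum]
  simp_rw [inner_smul_right]
  exact Finset.sum_congr rfl fun k _ => mul_comm _ _

omit [FiniteDimensional ℝ V] in
theorem gram_basis_det_pos (b : Basis (Fin 2) ℝ V) : 0 < (Matrix.gram ℝ b).det :=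
  (Matrix.posDef_gram_of_linearIndependent (𝕜 := ℝ) b.linearIndependent).det_pos

theorem gram_sum_smul {W : Type*} [NormedAddCommGroup W] [InnerProductSpace ℝ W] (w : Fin 2 → W)
    (A : Matrix (Fin 2) (Fin 2) ℝ) :
    Matrix.gram ℝ (fun j => ∑ k, A k j • w k) = A.transpose * Matrix.gram ℝ w * A := by
  ext i j
  simp only [Matrix.gram_apply, Matrix.mul_apply, Matrix.transpose_apply, Fin.sum_univ_two,
    inner_add_left, inner_add_right, inner_smul_left, inner_smul_right, conj_trivial]
  ring

theorem det_adjoint_comp_self (hV : finrank ℝ V = 2) (L : V →ₗ[ℝ] W) :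
    LinearMap.det (LinearMap.adjoint L ∘ₗ L) =
      (L.singularValues 0 * L.singularValues 1) ^ 2 := by
  have h := L.isSymmetric_adjoint_comp_self.det_eq_prod_eigenvalues hV
  rw [mul_pow, L.sq_singularValues_of_lt hV (by norm_num), L.sq_singularValues_of_lt hV (by norm_num)]
  simpa using h

theorem trace_adjoint_comp_self (hV : finrank ℝ V = 2) (L : V →ₗ[ℝ] W) :
    LinearMap.trace ℝ V (LinearMap.adjoint L ∘ₗ L) =
      L.singularValues 0 ^ 2 + L.singularValues 1 ^ 2 := by
  have h := L.isSymmetric_adjoint_comp_self.trace_eq_sum_eigenvalues hV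
  rw [L.sq_singularValues_of_lt hV (by norm_num), L.sq_singularValues_of_lt hV (by norm_num)]
  simpa using h

/-- Take determinants in `gram_map`, where det L*L = (σ₀σ₁)². -/
theorem singularValues_mul_sqrt_det_gram (L : V →ₗ[ℝ] W) (b : Basis (Fin 2) ℝ V) :
    L.singularValues 0 * L.singularValues 1 * √(Matrix.gram ℝ b).det =
      √(Matrix.gram ℝ fun i => L (b i)).det := by
  have hV : finrank ℝ V = 2 := by simp [finrank_eq_card_basis b]
  have h0 := mul_nonneg (L.singularValues_nonneg 0) (L.singularValues_nonneg 1)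
  rw [gram_map, Matrix.det_mul, LinearMap.det_toMatrix, det_adjoint_comp_self hV,
    Real.sqrt_mul (gram_basis_det_pos b).le, Real.sqrt_sq h0, mul_comm]

/-- The trace counterpart. Together with the product it determines both singular values, which is
how their measurability is proved. -/
theorem singularValues_sq_add_sq (L : V →ₗ[ℝ] W) (b : Basis (Fin 2) ℝ V) :
    L.singularValues 0 ^ 2 + L.singularValues 1 ^ 2 =
      ((Matrix.gram ℝ b)⁻¹ * Matrix.gram ℝ fun i => L (b i)).trace := by
  have hV : finrank ℝ V = 2 := by simp [finrank_eq_card_basis b]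
  rw [gram_map, ← Matrix.mul_assoc,
    Matrix.nonsing_inv_mul _ (gram_basis_det_pos b).ne'.isUnit, Matrix.one_mul,
    ← LinearMap.trace_eq_matrix_trace, trace_adjoint_comp_self hV]

/-- Since σ₀ ≥ σ₁ ≥ 0, the two roots are σ₀ + σ₁ and σ₀ - σ₁. -/
theorem singularValues_zero_eq (L : V →ₗ[ℝ] W) :
    L.singularValues 0 =
      (√(L.singularValues 0 ^ 2 + L.singularValues 1 ^ 2
          + 2 * (L.singularValues 0 * L.singularValues 1)) +
        √(L.singularValues 0 ^ 2 + L.singularValues 1 ^ 2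
          - 2 * (L.singularValues 0 * L.singularValues 1))) / 2 := by
  have h0 := L.singularValues_nonneg 0
  have h1 := L.singularValues_nonneg 1
  have h01 : L.singularValues 1 ≤ L.singularValues 0 := L.singularValues_antitone zero_le_one
  have e1 : L.singularValues 0 ^ 2 + L.singularValues 1 ^ 2
      + 2 * (L.singularValues 0 * L.singularValues 1)
      = (L.singularValues 0 + L.singularValues 1) ^ 2 := by ring
  have e2 : L.singularValues 0 ^ 2 + L.singularValues 1 ^ 2
      - 2 * (L.singularValues 0 * L.singularValues 1)
      = (L.singularValues 0 - L.singularValues 1) ^ 2 := by ring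
  rw [e1, e2, Real.sqrt_sq (by linarith), Real.sqrt_sq (by linarith)]
  ring

theorem singularValues_one_eq (L : V →ₗ[ℝ] W) :
    L.singularValues 1 =
      (√(L.singularValues 0 ^ 2 + L.singularValues 1 ^ 2
          + 2 * (L.singularValues 0 * L.singularValues 1)) -
        √(L.singularValues 0 ^ 2 + L.singularValues 1 ^ 2
          - 2 * (L.singularValues 0 * L.singularValues 1))) / 2 := by
  have h0 := L.singularValues_nonneg 0
  have h1 := L.singularValues_nonneg 1
  have h01 : L.singularValues 1 ≤ L.singularValues 0 := L.singularValues_antitone zero_le_one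
  have e1 : L.singularValues 0 ^ 2 + L.singularValues 1 ^ 2
      + 2 * (L.singularValues 0 * L.singularValues 1)
      = (L.singularValues 0 + L.singularValues 1) ^ 2 := by ring
  have e2 : L.singularValues 0 ^ 2 + L.singularValues 1 ^ 2
      - 2 * (L.singularValues 0 * L.singularValues 1)
      = (L.singularValues 0 - L.singularValues 1) ^ 2 := by ring
  rw [e1, e2, Real.sqrt_sq (by linarith), Real.sqrt_sq (by linarith)]
  ring

/-- Both sides say that L*L = c² id. -/
theorem forall_inner_eq_iff_singularValues (hV : finrank ℝ V = 2) (L : V →ₗ[ℝ] W) {c : ℝ}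
    (hc : 0 ≤ c) :
    (∀ v w, inner ℝ (L v) (L w) = c ^ 2 * inner ℝ v w) ↔
      L.singularValues 0 = c ∧ L.singularValues 1 = c := by
  have hS := L.isSymmetric_adjoint_comp_self
  constructor
  · intro h
    have hL : LinearMap.adjoint L ∘ₗ L = c ^ 2 • LinearMap.id := by
      refine LinearMap.ext fun v => ext_inner_left ℝ fun w => ?_
      rw [LinearMap.comp_apply, LinearMap.adjoint_inner_right, h]
      simp [inner_smul_right]
    have key : ∀ i : ℕ, i < 2 → L.singularValues i = c := by
      intro i hi
      have he := hS.apply_eigenvectorBasis hV ⟨i, hi⟩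
      have hne : hS.eigenvectorBasis hV ⟨i, hi⟩ ≠ 0 := by
        intro h0
        have := (hS.eigenvectorBasis hV).orthonormal.1 ⟨i, hi⟩
        simp [h0] at this
      rw [← L.sq_singularValues_of_lt hV hi] at he
      have he' := LinearMap.congr_fun hL (hS.eigenvectorBasis hV ⟨i, hi⟩)
      have := smul_left_injective ℝ hne (a₁ := c ^ 2) (a₂ := L.singularValues i ^ 2)
        (by simpa using he'.symm.trans he)
      exact ((sq_eq_sq₀ hc (L.singularValues_nonneg i)).1 this).symm
    exact ⟨key 0 (by norm_num), key 1 (by norm_num)⟩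
  · rintro ⟨h0, h1⟩ v w
    have hL : LinearMap.adjoint L ∘ₗ L = c ^ 2 • LinearMap.id := by
      refine (hS.eigenvectorBasis hV).toBasis.ext fun i => ?_
      rw [OrthonormalBasis.coe_toBasis, hS.apply_eigenvectorBasis hV,
        ← L.sq_singularValues_fin hV]
      fin_cases i <;> simp [h0, h1]
    rw [← LinearMap.adjoint_inner_right, ← LinearMap.comp_apply, hL]
    simp [inner_smul_right]

end SingularValues

/-! ### Coordinate frames and the metric in a chart. -/

section Charts

variable {X : Type*} [TopologicalSpace X] [ChartedSpace Plane X]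

/-- The differential of the chart `e` at `p`, with values in the model plane. -/
def chartDeriv (e : OpenPartialHomeomorph X Plane) (p : X) : TangentSpace (𝓡 2) p →L[ℝ] Plane :=
  mfderiv (𝓡 2) (𝓡 2) e p

/-- The differential of the inverse of the chart `e`, defined on the model plane. -/
def chartSymmDeriv (e : OpenPartialHomeomorph X Plane) (y : Plane) :
    Plane →L[ℝ] TangentSpace (𝓡 2) (e.symm y) :=
  mfderiv (𝓡 2) (𝓡 2) e.symm y

theorem mdifferentiable_of_mem_maximalAtlas {e : OpenPartialHomeomorph X Plane}
    (he : e ∈ IsManifold.maximalAtlas (𝓡 2) ∞ X) : e.MDifferentiable (𝓡 2) (𝓡 2) :=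
  ⟨(contMDiffOn_of_mem_maximalAtlas he).mdifferentiableOn (by norm_num),
    (contMDiffOn_symm_of_mem_maximalAtlas he).mdifferentiableOn (by norm_num)⟩

theorem chartSymmDeriv_chartDeriv {e : OpenPartialHomeomorph X Plane}
    (he : e ∈ IsManifold.maximalAtlas (𝓡 2) ∞ X) {y : Plane} (hy : y ∈ e.target)
    (v : TangentSpace (𝓡 2) (e.symm y)) :
    chartSymmDeriv e y (chartDeriv e (e.symm y) v) = v := by
  have hd := mdifferentiable_of_mem_maximalAtlas he
  have h := hd.symm_comp_deriv (e.map_target hy)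
  have := DFunLike.congr_fun h v
  rw [e.right_inv hy] at this
  exact this

theorem chartDeriv_chartSymmDeriv {e : OpenPartialHomeomorph X Plane}
    (he : e ∈ IsManifold.maximalAtlas (𝓡 2) ∞ X) {y : Plane} (hy : y ∈ e.target) (v : Plane) :
    chartDeriv e (e.symm y) (chartSymmDeriv e y v) = v := by
  have hd := mdifferentiable_of_mem_maximalAtlas he
  exact DFunLike.congr_fun (hd.comp_symm_deriv hy) v

/-- The coordinate frame of a chart, as a basis of the tangent space. -/
def coordBasis {e : OpenPartialHomeomorph X Plane}
    (he : e ∈ IsManifold.maximalAtlas (𝓡 2) ∞ X) {y : Plane} (hy : y ∈ e.target) :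
    Module.Basis (Fin 2) ℝ (TangentSpace (𝓡 2) (e.symm y)) :=
  (EuclideanSpace.basisFun (Fin 2) ℝ).toBasis.map
    (LinearEquiv.ofLinearMap (chartSymmDeriv e y).toLinearMap (chartDeriv e (e.symm y)).toLinearMap
      (LinearMap.ext (chartSymmDeriv_chartDeriv he hy))
      (LinearMap.ext (chartDeriv_chartSymmDeriv he hy)))

@[simp]
theorem coordBasis_apply {e : OpenPartialHomeomorph X Plane}
    (he : e ∈ IsManifold.maximalAtlas (𝓡 2) ∞ X) {y : Plane} (hy : y ∈ e.target) (i : Fin 2) :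
    coordBasis he hy i = coordVec e i y := by
  simp only [coordBasis, Module.Basis.map_apply, OrthonormalBasis.coe_toBasis]
  rfl

theorem sum_smul_coordVec {e : OpenPartialHomeomorph X Plane}
    (he : e ∈ IsManifold.maximalAtlas (𝓡 2) ∞ X) {y : Plane} (hy : y ∈ e.target)
    (v : TangentSpace (𝓡 2) (e.symm y)) :
    ∑ k, chartDeriv e (e.symm y) v k • coordVec e k y = v := by
  conv_rhs => rw [← chartSymmDeriv_chartDeriv he hy v]
  set u : Plane := chartDeriv e (e.symm y) v with hu
  have h : ∑ k, u k • planeVec k = u := by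
    simpa [planeVec] using (EuclideanSpace.basisFun (Fin 2) ℝ).sum_repr u
  conv_rhs => rw [← h]
  simp_rw [map_sum, map_smul]
  rfl

variable [RiemannianBundle (fun x : X => TangentSpace (𝓡 2) x)]

/-- The matrix `(gᵢⱼ)` of the metric in the chart `e`. -/
def metricMatrix (e : OpenPartialHomeomorph X Plane) (y : Plane) : Matrix (Fin 2) (Fin 2) ℝ :=
  Matrix.gram ℝ fun i => coordVec e i y

theorem areaDensity_eq (e : OpenPartialHomeomorph X Plane) (y : Plane) :
    areaDensity e y = √(metricMatrix e y).det := rfl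

theorem metricMatrix_eq_gram_coordBasis {e : OpenPartialHomeomorph X Plane}
    (he : e ∈ IsManifold.maximalAtlas (𝓡 2) ∞ X) {y : Plane} (hy : y ∈ e.target) :
    metricMatrix e y = Matrix.gram ℝ (coordBasis he hy) := by
  ext i j
  simp [metricMatrix]

theorem areaDensity_pos {e : OpenPartialHomeomorph X Plane}
    (he : e ∈ IsManifold.maximalAtlas (𝓡 2) ∞ X) {y : Plane} (hy : y ∈ e.target) :
    0 < areaDensity e y := by
  rw [areaDensity_eq, metricMatrix_eq_gram_coordBasis he hy]
  exact Real.sqrt_pos.2 (gram_basis_det_pos _)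

/-- The base point is a variable `q` because in the application it is an image point φ(p), equal to
`e'.symm` of its coordinates only propositionally; substituting it avoids transport between tangent
spaces. -/
theorem gram_eq_transpose_mul_metricMatrix {e : OpenPartialHomeomorph X Plane}
    (he : e ∈ IsManifold.maximalAtlas (𝓡 2) ∞ X) {y : Plane} (hy : y ∈ e.target) {q : X}
    (hq : e.symm y = q) (w : Fin 2 → TangentSpace (𝓡 2) q) (B : Matrix (Fin 2) (Fin 2) ℝ)
    (hB : ∀ k j, B k j = chartDeriv e q (w j) k) :
    Matrix.gram ℝ w = B.transpose * metricMatrix e y * B := by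
  subst hq
  rw [metricMatrix, ← gram_sum_smul]
  congr 1
  funext j
  simp_rw [hB]
  exact (sum_smul_coordVec he hy (w j)).symm

variable [IsManifold (𝓡 2) ∞ X]
  [IsContMDiffRiemannianBundle (𝓡 2) ∞ Plane (fun x : X => TangentSpace (𝓡 2) x)]

/-- The coordinate fields are smooth, being the tangent map of `e.symm` applied to constant
sections, and the metric is smooth. -/
theorem continuousOn_metricMatrix_apply {e : OpenPartialHomeomorph X Plane}
    (he : e ∈ IsManifold.maximalAtlas (𝓡 2) ∞ X) (i j : Fin 2) :
    ContinuousOn (fun y => metricMatrix e y i j) e.target := by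
  have hs : ∀ k : Fin 2, ContMDiffOn (𝓡 2) ((𝓡 2).prod (𝓡 2)) ∞
      (fun y : Plane => (⟨e.symm y, coordVec e k y⟩ : TotalSpace Plane
        (fun x : X => TangentSpace (𝓡 2) x))) e.target := by
    intro k
    have h1 : ContMDiffOn (𝓡 2).tangent (𝓡 2).tangent ∞ (tangentMapWithin (𝓡 2) (𝓡 2) e.symm e.target)
        (π Plane (TangentSpace (𝓡 2)) ⁻¹' e.target) :=
      (contMDiffOn_symm_of_mem_maximalAtlas he).contMDiffOn_tangentMapWithin (by norm_num)
        e.open_target.uniqueMDiffOn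
    have h2 : ContMDiffOn (𝓡 2) (𝓡 2).tangent ∞
      (fun y : Plane => (⟨y, planeVec k⟩ : TangentBundle (𝓡 2) Plane)) e.target := by
      intro y _
      exact contMDiffWithinAt_vectorSpace_iff_contDiffWithinAt.2 contDiffWithinAt_const
    refine (h1.comp h2 fun y hy => hy).congr fun y hy => ?_
    simp only [Function.comp, tangentMapWithin]
    rw [mfderivWithin_of_isOpen e.open_target hy]
    rfl
  have := (hs i).inner_bundle (hs j)
  exact this.continuousOn

theorem continuousOn_areaDensity {e : OpenPartialHomeomorph X Plane}
    (he : e ∈ IsManifold.maximalAtlas (𝓡 2) ∞ X) : ContinuousOn (areaDensity e) e.target := by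
  have : ContinuousOn (fun y => √(metricMatrix e y).det) e.target := by
    simp_rw [Matrix.det_fin_two]
    have h := continuousOn_metricMatrix_apply he
    exact (((h 0 0).mul (h 1 1)).sub ((h 0 1).mul (h 1 0))).sqrt
  exact this

end Charts

/-! ### Coordinate expression of a differential. -/

section LocalMaps

/-- The matrix of a linear endomorphism of the model plane. -/
def planeMatrix (B : Plane →L[ℝ] Plane) : Matrix (Fin 2) (Fin 2) ℝ :=
  Matrix.of fun k j => B (planeVec j) k

theorem det_planeMatrix (B : Plane →L[ℝ] Plane) : (planeMatrix B).det = B.det := by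
  have h : planeMatrix B = LinearMap.toMatrix (EuclideanSpace.basisFun (Fin 2) ℝ).toBasis
      (EuclideanSpace.basisFun (Fin 2) ℝ).toBasis (B : Plane →ₗ[ℝ] Plane) := by
    ext k j
    simp [planeMatrix, LinearMap.toMatrix_apply, planeVec]
  rw [h, LinearMap.det_toMatrix]

theorem continuous_planeMatrix : Continuous planeMatrix := by
  refine continuous_matrix fun k j => ?_
  simp only [planeMatrix, Matrix.of_apply]
  fun_prop

variable {X Y : Type*} [TopologicalSpace X] [ChartedSpace Plane X] [TopologicalSpace Y]
  [ChartedSpace Plane Y]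

/-- The coordinate expression of a family of linear maps between tangent spaces. -/
def localDeriv (e : OpenPartialHomeomorph X Plane) (e' : OpenPartialHomeomorph Y Plane) (φ : X → Y)
    (A : ∀ p, TangentSpace (𝓡 2) p →L[ℝ] TangentSpace (𝓡 2) (φ p)) (y : Plane) : Plane →L[ℝ] Plane :=
  (chartDeriv e' (φ (e.symm y))).comp ((A (e.symm y)).comp (chartSymmDeriv e y))

theorem hasFDerivWithinAt_localDeriv {e : OpenPartialHomeomorph X Plane}
    (he : e ∈ IsManifold.maximalAtlas (𝓡 2) ∞ X) {e' : OpenPartialHomeomorph Y Plane}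
    (he' : e' ∈ IsManifold.maximalAtlas (𝓡 2) ∞ Y) {φ : X → Y}
    {A : ∀ p, TangentSpace (𝓡 2) p →L[ℝ] TangentSpace (𝓡 2) (φ p)} {M : Set X} {y : Plane}
    (hy : y ∈ e.target) (hφy : φ (e.symm y) ∈ e'.source)
    (hA : HasMFDerivWithinAt (𝓡 2) (𝓡 2) φ M (e.symm y) (A (e.symm y))) :
    HasFDerivWithinAt (e' ∘ φ ∘ e.symm) (localDeriv e e' φ A y) (e.target ∩ e.symm ⁻¹' M) y := by
  have h1 : HasMFDerivWithinAt (𝓡 2) (𝓡 2) e.symm (e.target ∩ e.symm ⁻¹' M) y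
      (chartSymmDeriv e y) :=
    ((mdifferentiable_of_mem_maximalAtlas he).mdifferentiableAt_symm hy).hasMFDerivAt.hasMFDerivWithinAt
  have h2 : HasMFDerivAt (𝓡 2) (𝓡 2) e' (φ (e.symm y)) (chartDeriv e' (φ (e.symm y))) :=
    ((mdifferentiable_of_mem_maximalAtlas he').mdifferentiableAt hφy).hasMFDerivAt
  have h3 := h2.comp_hasMFDerivWithinAt y (hA.comp y h1 fun z hz => hz.2)
  exact hasMFDerivWithinAt_iff_hasFDerivWithinAt.1 h3

variable [RiemannianBundle (fun y : Y => TangentSpace (𝓡 2) y)]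

theorem gram_map_coordVec (e : OpenPartialHomeomorph X Plane) {e' : OpenPartialHomeomorph Y Plane}
    (he' : e' ∈ IsManifold.maximalAtlas (𝓡 2) ∞ Y) (φ : X → Y)
    (A : ∀ p, TangentSpace (𝓡 2) p →L[ℝ] TangentSpace (𝓡 2) (φ p)) {y : Plane}
    (hφy : φ (e.symm y) ∈ e'.source) :
    Matrix.gram ℝ (fun j => A (e.symm y) (coordVec e j y)) =
      (planeMatrix (localDeriv e e' φ A y)).transpose * metricMatrix e' (e' (φ (e.symm y))) *
        planeMatrix (localDeriv e e' φ A y) :=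
  gram_eq_transpose_mul_metricMatrix he' (e'.map_source hφy) (e'.left_inv hφy) _ _ fun _ _ => rfl

variable [RiemannianBundle (fun x : X => TangentSpace (𝓡 2) x)]

/-- From det (Bᵀ G B) = (det B)² det G. This identity turns the planar change of variables into one
for Riemannian areas. `A` is any family of linear maps, so that it covers the identity of a surface
as well as the differential of a Lipschitz map. -/
theorem singularValues_mul_areaDensity {e : OpenPartialHomeomorph X Plane}
    (he : e ∈ IsManifold.maximalAtlas (𝓡 2) ∞ X) {e' : OpenPartialHomeomorph Y Plane}
    (he' : e' ∈ IsManifold.maximalAtlas (𝓡 2) ∞ Y) (φ : X → Y)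
    (A : ∀ p, TangentSpace (𝓡 2) p →L[ℝ] TangentSpace (𝓡 2) (φ p)) {y : Plane}
    (hy : y ∈ e.target) (hφy : φ (e.symm y) ∈ e'.source) :
    (A (e.symm y)).toLinearMap.singularValues 0 * (A (e.symm y)).toLinearMap.singularValues 1 *
      areaDensity e y = |(localDeriv e e' φ A y).det| * areaDensity e' (e' (φ (e.symm y))) := by
  have h := singularValues_mul_sqrt_det_gram (A (e.symm y)).toLinearMap (coordBasis he hy)
  rw [areaDensity_eq, metricMatrix_eq_gram_coordBasis he hy, h]
  simp only [coordBasis_apply]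
  have h2 := gram_map_coordVec e he' φ A hφy
  refine (congrArg (fun m => √(Matrix.det m)) h2).trans ?_
  have e : ∀ B G : Matrix (Fin 2) (Fin 2) ℝ,
      √(B.transpose * G * B).det = |B.det| * √G.det := by
    intro B G
    rw [Matrix.det_mul, Matrix.det_mul, Matrix.det_transpose,
      show B.det * G.det * B.det = B.det ^ 2 * G.det by ring, Real.sqrt_mul (sq_nonneg _),
      Real.sqrt_sq_eq_abs]
  simp only [e, det_planeMatrix, areaDensity_eq]

theorem singularValues_sq_add_sq_eq_trace {e : OpenPartialHomeomorph X Plane}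
    (he : e ∈ IsManifold.maximalAtlas (𝓡 2) ∞ X) {e' : OpenPartialHomeomorph Y Plane}
    (he' : e' ∈ IsManifold.maximalAtlas (𝓡 2) ∞ Y) (φ : X → Y)
    (A : ∀ p, TangentSpace (𝓡 2) p →L[ℝ] TangentSpace (𝓡 2) (φ p)) {y : Plane}
    (hy : y ∈ e.target) (hφy : φ (e.symm y) ∈ e'.source) :
    (A (e.symm y)).toLinearMap.singularValues 0 ^ 2 +
      (A (e.symm y)).toLinearMap.singularValues 1 ^ 2 =
      ((metricMatrix e y)⁻¹ * ((planeMatrix (localDeriv e e' φ A y)).transpose *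
        metricMatrix e' (e' (φ (e.symm y))) * planeMatrix (localDeriv e e' φ A y))).trace := by
  have h := singularValues_sq_add_sq (A (e.symm y)).toLinearMap (coordBasis he hy)
  rw [h, metricMatrix_eq_gram_coordBasis he hy, ← gram_map_coordVec e he' φ A hφy]
  simp only [coordBasis_apply]
  rfl

end LocalMaps

/-- If a map which is differentiable on a measurable set `s` maps `s` to a null set, its derivative
is almost everywhere singular on `s`. -/
theorem ae_det_eq_zero_of_image_null {E : Type*} [NormedAddCommGroup E] [NormedSpace ℝ E]
    [FiniteDimensional ℝ E] [Nontrivial E] [MeasurableSpace E] [BorelSpace E] (μ : Measure E)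
    [μ.IsAddHaarMeasure] {f : E → E} {f' : E → E →L[ℝ] E} {s : Set E} (hs : MeasurableSet s)
    (hf' : ∀ x ∈ s, HasFDerivWithinAt f (f' x) s x) (h0 : μ (f '' s) = 0) :
    ∀ᵐ x ∂μ.restrict s, (f' x).det = 0 := by
  classical
  have hdet : AEMeasurable (fun x => (f' x).det) (μ.restrict s) :=
    ContinuousLinearMap.continuous_det.measurable.comp_aemeasurable
      (aemeasurable_fderivWithin μ hs hf')
  set s₀ : Set E := {x | (f' x).det ≠ 0} ∩ s with hs₀
  have hs₀m : NullMeasurableSet s₀ μ := by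
    rw [hs₀, ← nullMeasurableSet_restrict hs.nullMeasurableSet]
    exact (hdet.nullMeasurable (measurableSet_singleton (0 : ℝ))).compl
  -- Half the threshold ‖A⁻¹‖⁻¹ below which a map approximated by the invertible `A` is injective.
  let r : (E →L[ℝ] E) → ℝ≥0 := fun A =>
    if h : A.det ≠ 0 then ‖((A.toContinuousLinearEquivOfDetNeZero h).symm : E →L[ℝ] E)‖₊⁻¹ / 2 else 1
  have hN : ∀ A : E ≃L[ℝ] E, 0 < ‖(A.symm : E →L[ℝ] E)‖₊ := fun A => A.nnnorm_symm_pos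
  have hr : ∀ A, r A ≠ 0 := by
    intro A
    by_cases h : A.det ≠ 0
    · simp only [r, dif_pos h]
      have := hN (A.toContinuousLinearEquivOfDetNeZero h)
      positivity
    · simp only [r, dif_neg h]
      exact one_ne_zero
  have hder : ∀ x ∈ s₀, HasFDerivWithinAt f (f' x) s₀ x := fun x hx =>
    (hf' x hx.2).mono inter_subset_right
  -- On each of countably many pieces f is close to some `A n`, a value of f' on s₀ and hence
  -- invertible, so f is injective there. Then |det f'| integrates to the measure of the image,
  -- which is 0, although it is non-zero on s₀: each piece is null.
  obtain ⟨t, A, -, htm, hst, happ, hA⟩ :=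
    exists_partition_approximatesLinearOn_of_hasFDerivWithinAt f s₀ f' hder r hr
  have hnull : μ s₀ = 0 := by
    rcases s₀.eq_empty_or_nonempty with h | hne
    · rw [h, measure_empty]
    have hpiece : ∀ n, μ (s₀ ∩ t n) = 0 := by
      intro n
      obtain ⟨y, hy, hAy⟩ := hA hne n
      have hAdet : (A n).det ≠ 0 := by
        rw [hAy]
        exact hy.1
      have hinj : InjOn f (s₀ ∩ t n) := by
        refine ApproximatesLinearOn.injOn (f' := (A n).toContinuousLinearEquivOfDetNeZero hAdet)
          (c := r (A n)) (by simpa using happ n) (Or.inr ?_)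
        simp only [r, dif_pos hAdet]
        exact NNReal.half_lt_self (inv_pos.2 (hN _)).ne'
      have hm : NullMeasurableSet (s₀ ∩ t n) μ := hs₀m.inter (htm n).nullMeasurableSet
      have hint := lintegral_abs_det_fderiv_eq_addHaar_image₀ μ hm
        (fun x hx => (hder x hx.1).mono inter_subset_left) hinj
      have hz : μ (f '' (s₀ ∩ t n)) = 0 :=
        measure_mono_null (image_mono (inter_subset_left.trans inter_subset_right)) h0
      rw [hz, lintegral_eq_zero_iff'] at hint
      · have hF : ∀ᵐ x ∂μ.restrict (s₀ ∩ t n), False := by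
          filter_upwards [hint, ae_restrict_mem₀ hm] with x hx hxm
          have h1 := hxm.1.1
          simp only [Pi.zero_apply, ENNReal.ofReal_eq_zero, abs_nonpos_iff] at hx
          exact h1 hx
        rwa [ae_iff, Measure.restrict_apply₀' hm, show {a : E | ¬False} = univ by simp, univ_inter]
          at hF
      · have h1 := hdet.mono_measure (Measure.restrict_mono
          ((inter_subset_left (t := t n)).trans (inter_subset_right : s₀ ⊆ s)) le_rfl)
        exact (continuous_abs.measurable.comp_aemeasurable h1).ennreal_ofReal
    refine measure_mono_null (t := ⋃ n, s₀ ∩ t n) (fun x hx => ?_) (measure_iUnion_null hpiece)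
    obtain ⟨n, hn⟩ := mem_iUnion.1 (hst hx)
    exact mem_iUnion.2 ⟨n, hx, hn⟩
  rw [ae_iff, Measure.restrict_apply' hs]
  exact hnull

/-! ### Transfer of integrals and null sets between a chart domain and the plane. -/

section ChartArea

variable {X : Type*} [TopologicalSpace X] [ChartedSpace Plane X] [MeasurableSpace X] [BorelSpace X]

theorem measurableSet_source_inter_preimage {Z W : Type*} [TopologicalSpace Z] [MeasurableSpace Z]
    [BorelSpace Z] [TopologicalSpace W] [MeasurableSpace W] [BorelSpace W]
    (e : OpenPartialHomeomorph Z W) {P : Set W} (hP : MeasurableSet P) :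
    MeasurableSet (e.source ∩ e ⁻¹' P) := by
  have h : Continuous (e.source.domRestrict e) := e.continuousOn.domRestrict
  have h2 := e.open_source.measurableSet.subtype_image (h.measurable hP)
  convert h2 using 1
  ext y
  simp [Set.domRestrict, and_comm]

omit [ChartedSpace Plane X] in
theorem measurableSet_target_inter_preimage_symm (e : OpenPartialHomeomorph X Plane) {P : Set X}
    (hP : MeasurableSet P) : MeasurableSet (e.target ∩ e.symm ⁻¹' P) :=
  measurableSet_source_inter_preimage e.symm hP

omit [ChartedSpace Plane X] in
theorem aemeasurable_chart_symm (e : OpenPartialHomeomorph X Plane) :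
    AEMeasurable e.symm (volume.restrict e.target) :=
  e.symm.continuousOn.aemeasurable e.open_target.measurableSet

variable [RiemannianBundle (fun x : X => TangentSpace (𝓡 2) x)]

/-- The area measure of a chart, as a measure on the model plane. -/
def planeArea (e : OpenPartialHomeomorph X Plane) : Measure Plane :=
  (volume.restrict e.target).withDensity fun y => ENNReal.ofReal (areaDensity e y)

theorem aemeasurable_chart_symm_planeArea (e : OpenPartialHomeomorph X Plane) :
    AEMeasurable e.symm (planeArea e) :=
  (aemeasurable_chart_symm e).mono_ac (withDensity_absolutelyContinuous _ _)

/-- `planeArea e` gives no mass to the complement of `e.target`, so the values of `e.symm` there do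
not matter. -/
theorem restrict_chartArea (e : OpenPartialHomeomorph X Plane) {P : Set X} (hP : MeasurableSet P) :
    (chartArea e).restrict P = ((planeArea e).restrict (e.target ∩ e.symm ⁻¹' P)).map e.symm := by
  have hS := measurableSet_target_inter_preimage_symm e hP
  ext t ht
  have hm : AEMeasurable e.symm ((planeArea e).restrict (e.target ∩ e.symm ⁻¹' P)) :=
    (aemeasurable_chart_symm_planeArea e).mono_measure Measure.restrict_le_self
  have hn : NullMeasurableSet (e.symm ⁻¹' t) ((planeArea e).restrict (e.target ∩ e.symm ⁻¹' P)) :=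
    hm.nullMeasurable ht
  rw [Measure.restrict_apply ht, Measure.map_apply_of_aemeasurable hm ht,
    Measure.restrict_apply₀ hn]
  change ((planeArea e).map e.symm) (t ∩ P) = _
  rw [Measure.map_apply_of_aemeasurable (aemeasurable_chart_symm_planeArea e) (ht.inter hP)]
  have h : (planeArea e) e.targetᶜ = 0 := by
    apply withDensity_absolutelyContinuous
    rw [Measure.restrict_apply e.open_target.measurableSet.compl, compl_inter_self, measure_empty]
  have h2 : e.symm ⁻¹' t ∩ (e.target ∩ e.symm ⁻¹' P) = e.symm ⁻¹' (t ∩ P) ∩ e.target := by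
    ext y; simp; tauto
  rw [h2]
  exact (measure_inter_conull h).symm

omit [MeasurableSpace X] [BorelSpace X] in
theorem planeArea_apply (e : OpenPartialHomeomorph X Plane) {S : Set Plane} (hS : MeasurableSet S)
    (hSe : S ⊆ e.target) :
    planeArea e S = ∫⁻ y in S, ENNReal.ofReal (areaDensity e y) := by
  rw [planeArea, withDensity_apply _ hS, Measure.restrict_restrict hS, inter_eq_left.2 hSe]

theorem chartArea_apply (e : OpenPartialHomeomorph X Plane) {P : Set X} (hP : MeasurableSet P) :
    chartArea e P = ∫⁻ y in e.target ∩ e.symm ⁻¹' P, ENNReal.ofReal (areaDensity e y) := by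
  have h := congrArg (fun m : Measure X => m univ) (restrict_chartArea e hP)
  simp only [Measure.restrict_apply_univ] at h
  rw [h, Measure.map_apply_of_aemeasurable ((aemeasurable_chart_symm_planeArea e).mono_measure
    Measure.restrict_le_self) MeasurableSet.univ, preimage_univ, Measure.restrict_apply_univ,
    planeArea_apply e (measurableSet_target_inter_preimage_symm e hP) inter_subset_left]

omit [MeasurableSpace X] [BorelSpace X] in
theorem restrict_planeArea (e : OpenPartialHomeomorph X Plane) {S : Set Plane}
    (hS : MeasurableSet S) (hSe : S ⊆ e.target) :
    (planeArea e).restrict S =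
      (volume.restrict S).withDensity fun y => ENNReal.ofReal (areaDensity e y) := by
  rw [planeArea, restrict_withDensity hS, Measure.restrict_restrict hS, inter_eq_left.2 hSe]

variable [IsManifold (𝓡 2) ∞ X]
  [IsContMDiffRiemannianBundle (𝓡 2) ∞ Plane (fun x : X => TangentSpace (𝓡 2) x)]

omit [MeasurableSpace X] [BorelSpace X] in
theorem aemeasurable_areaDensity {e : OpenPartialHomeomorph X Plane}
    (he : e ∈ IsManifold.maximalAtlas (𝓡 2) ∞ X) :
    AEMeasurable (fun y => ENNReal.ofReal (areaDensity e y)) (volume.restrict e.target) :=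
  ((continuousOn_areaDensity he).aemeasurable e.open_target.measurableSet).ennreal_ofReal

omit [MeasurableSpace X] [BorelSpace X] in
-- The area density is positive on the target, so the null sets are those of Lebesgue measure.
theorem ae_restrict_planeArea {e : OpenPartialHomeomorph X Plane}
    (he : e ∈ IsManifold.maximalAtlas (𝓡 2) ∞ X) {S : Set Plane} (hS : MeasurableSet S)
    (hSe : S ⊆ e.target) : ae ((planeArea e).restrict S) = ae (volume.restrict S) := by
  rw [restrict_planeArea e hS hSe]
  refine le_antisymm (withDensity_absolutelyContinuous _ _).ae_le
    (withDensity_absolutelyContinuous' ?_ ?_).ae_le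
  · exact (aemeasurable_areaDensity he).mono_measure (Measure.restrict_mono hSe le_rfl)
  · filter_upwards [ae_restrict_mem hS] with y hy
    exact (ENNReal.ofReal_pos.2 (areaDensity_pos he (hSe hy))).ne'

omit [IsManifold (𝓡 2) ∞ X]
  [IsContMDiffRiemannianBundle (𝓡 2) ∞ Plane (fun x : X => TangentSpace (𝓡 2) x)] in
theorem aemeasurable_chart_restrict_chartArea (e : OpenPartialHomeomorph X Plane) {P : Set X}
    (hPe : P ⊆ e.source) : AEMeasurable e ((chartArea e).restrict P) :=
  (e.continuousOn.aemeasurable e.open_source.measurableSet).mono_measure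
    (Measure.restrict_mono hPe le_rfl)

omit [IsManifold (𝓡 2) ∞ X]
  [IsContMDiffRiemannianBundle (𝓡 2) ∞ Plane (fun x : X => TangentSpace (𝓡 2) x)] in
theorem map_chart_restrict_chartArea (e : OpenPartialHomeomorph X Plane) {P : Set X}
    (hP : MeasurableSet P) (hPe : P ⊆ e.source) :
    ((chartArea e).restrict P).map e = (planeArea e).restrict (e.target ∩ e.symm ⁻¹' P) := by
  have h := aemeasurable_chart_restrict_chartArea e hPe
  rw [restrict_chartArea e hP] at h ⊢
  rw [AEMeasurable.map_map_of_aemeasurable h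
    ((aemeasurable_chart_symm_planeArea e).mono_measure Measure.restrict_le_self)]
  conv_rhs => rw [← Measure.map_id (μ := (planeArea e).restrict (e.target ∩ e.symm ⁻¹' P))]
  refine Measure.map_congr ?_
  filter_upwards [ae_restrict_mem (measurableSet_target_inter_preimage_symm e hP)] with y hy
  exact e.right_inv hy.1

theorem ae_restrict_chartArea_iff {e : OpenPartialHomeomorph X Plane}
    (he : e ∈ IsManifold.maximalAtlas (𝓡 2) ∞ X) {P : Set X} (hP : MeasurableSet P)
    (hPe : P ⊆ e.source) {Q : X → Prop} :
    (∀ᵐ p ∂(chartArea e).restrict P, Q p) ↔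
      ∀ᵐ y ∂volume.restrict (e.target ∩ e.symm ⁻¹' P), Q (e.symm y) := by
  rw [← ae_restrict_planeArea he (measurableSet_target_inter_preimage_symm e hP) inter_subset_left]
  constructor
  · intro h
    rw [restrict_chartArea e hP] at h
    exact ae_of_ae_map
      ((aemeasurable_chart_symm_planeArea e).mono_measure Measure.restrict_le_self) h
  · intro h
    rw [← map_chart_restrict_chartArea e hP hPe] at h
    filter_upwards [ae_of_ae_map (aemeasurable_chart_restrict_chartArea e hPe) h,
      ae_restrict_mem hP] with p hp hpP
    rwa [e.left_inv (hPe hpP)] at hp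

theorem aemeasurable_restrict_chartArea {e : OpenPartialHomeomorph X Plane}
    (he : e ∈ IsManifold.maximalAtlas (𝓡 2) ∞ X) {P : Set X}
    (hP : MeasurableSet P) (hPe : P ⊆ e.source) {β : Type*} [MeasurableSpace β] {g : X → β}
    (hg : AEMeasurable (g ∘ e.symm) (volume.restrict (e.target ∩ e.symm ⁻¹' P))) :
    AEMeasurable g ((chartArea e).restrict P) := by
  have hac : (planeArea e).restrict (e.target ∩ e.symm ⁻¹' P) ≪
      volume.restrict (e.target ∩ e.symm ⁻¹' P) := Measure.ae_le_iff_absolutelyContinuous.1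
    (ae_restrict_planeArea he (measurableSet_target_inter_preimage_symm e hP) inter_subset_left).le
  have h := hg.mono_ac hac
  rw [← map_chart_restrict_chartArea e hP hPe] at h
  refine (h.comp_aemeasurable (aemeasurable_chart_restrict_chartArea e hPe)).congr ?_
  filter_upwards [ae_restrict_mem hP] with p hp
  simp [e.left_inv (hPe hp)]

theorem setLIntegral_chartArea {e : OpenPartialHomeomorph X Plane}
    (he : e ∈ IsManifold.maximalAtlas (𝓡 2) ∞ X) {P : Set X} (hP : MeasurableSet P)
    (hPe : P ⊆ e.source) {g : X → ℝ≥0∞}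
    (hg : AEMeasurable (g ∘ e.symm) (volume.restrict (e.target ∩ e.symm ⁻¹' P))) :
    ∫⁻ p in P, g p ∂chartArea e =
      ∫⁻ y in e.target ∩ e.symm ⁻¹' P, ENNReal.ofReal (areaDensity e y) * g (e.symm y) := by
  have h := aemeasurable_restrict_chartArea he hP hPe hg
  have hS := measurableSet_target_inter_preimage_symm e hP
  rw [restrict_chartArea e hP] at h ⊢
  rw [lintegral_map' h ((aemeasurable_chart_symm_planeArea e).mono_measure
    Measure.restrict_le_self), restrict_planeArea e hS inter_subset_left]
  exact lintegral_withDensity_eq_lintegral_mul₀ ((aemeasurable_areaDensity he).mono_measure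
    (Measure.restrict_mono inter_subset_left le_rfl)) hg

end ChartArea

theorem aemeasurable_mul_apply {Ω : Type*} [MeasurableSpace Ω] {μ : Measure Ω}
    {A B : Ω → Matrix (Fin 2) (Fin 2) ℝ} (hA : ∀ i j, AEMeasurable (fun y => A y i j) μ)
    (hB : ∀ i j, AEMeasurable (fun y => B y i j) μ) (i j : Fin 2) :
    AEMeasurable (fun y => (A y * B y) i j) μ := by
  simp_rw [Matrix.mul_apply, Fin.sum_univ_two]
  exact ((hA i 0).mul (hB 0 j)).add ((hA i 1).mul (hB 1 j))

/-! ### The area formula between two chart domains. -/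

section LocalAreaFormula

variable {X Y : Type*} [TopologicalSpace X] [ChartedSpace Plane X] [MeasurableSpace X]
  [BorelSpace X] [RiemannianBundle (fun x : X => TangentSpace (𝓡 2) x)]
  [IsManifold (𝓡 2) ∞ X]
  [IsContMDiffRiemannianBundle (𝓡 2) ∞ Plane (fun x : X => TangentSpace (𝓡 2) x)]
  [TopologicalSpace Y] [ChartedSpace Plane Y] [MeasurableSpace Y]
  [BorelSpace Y] [RiemannianBundle (fun y : Y => TangentSpace (𝓡 2) y)]
  [IsManifold (𝓡 2) ∞ Y]
  [IsContMDiffRiemannianBundle (𝓡 2) ∞ Plane (fun y : Y => TangentSpace (𝓡 2) y)]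
  {e : OpenPartialHomeomorph X Plane} {e' : OpenPartialHomeomorph Y Plane} {φ : X → Y}
  {A : ∀ p, TangentSpace (𝓡 2) p →L[ℝ] TangentSpace (𝓡 2) (φ p)} {P : Set X}

/-- The product of the singular values of a linear map between tangent planes. -/
def absJacobian {φ : X → Y} (A : ∀ p, TangentSpace (𝓡 2) p →L[ℝ] TangentSpace (𝓡 2) (φ p))
    (p : X) : ℝ :=
  (A p).toLinearMap.singularValues 0 * (A p).toLinearMap.singularValues 1

omit [MeasurableSpace X] [BorelSpace X] [RiemannianBundle (fun x : X => TangentSpace (𝓡 2) x)]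
  [IsManifold (𝓡 2) ∞ X]
  [IsContMDiffRiemannianBundle (𝓡 2) ∞ Plane (fun x : X => TangentSpace (𝓡 2) x)]
  [MeasurableSpace Y] [BorelSpace Y] [RiemannianBundle (fun y : Y => TangentSpace (𝓡 2) y)]
  [IsManifold (𝓡 2) ∞ Y]
  [IsContMDiffRiemannianBundle (𝓡 2) ∞ Plane (fun y : Y => TangentSpace (𝓡 2) y)] in
theorem hasFDerivWithinAt_of_mem_preimage (he : e ∈ IsManifold.maximalAtlas (𝓡 2) ∞ X)
    (he' : e' ∈ IsManifold.maximalAtlas (𝓡 2) ∞ Y) (hPe' : MapsTo φ P e'.source)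
    (hA : ∀ p ∈ P, HasMFDerivWithinAt (𝓡 2) (𝓡 2) φ P p (A p)) :
    ∀ y ∈ e.target ∩ e.symm ⁻¹' P, HasFDerivWithinAt (e' ∘ φ ∘ e.symm) (localDeriv e e' φ A y)
      (e.target ∩ e.symm ⁻¹' P) y := fun _ hy =>
  hasFDerivWithinAt_localDeriv he he' hy.1 (hPe' hy.2) (hA _ hy.2)

omit [RiemannianBundle (fun x : X => TangentSpace (𝓡 2) x)] [IsManifold (𝓡 2) ∞ X]
  [IsContMDiffRiemannianBundle (𝓡 2) ∞ Plane (fun x : X => TangentSpace (𝓡 2) x)]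
  [MeasurableSpace Y] [BorelSpace Y] [RiemannianBundle (fun y : Y => TangentSpace (𝓡 2) y)]
  [IsManifold (𝓡 2) ∞ Y]
  [IsContMDiffRiemannianBundle (𝓡 2) ∞ Plane (fun y : Y => TangentSpace (𝓡 2) y)] in
theorem aemeasurable_planeMatrix_localDeriv (he : e ∈ IsManifold.maximalAtlas (𝓡 2) ∞ X)
    (he' : e' ∈ IsManifold.maximalAtlas (𝓡 2) ∞ Y) (hP : MeasurableSet P)
    (hPe' : MapsTo φ P e'.source)
    (hA : ∀ p ∈ P, HasMFDerivWithinAt (𝓡 2) (𝓡 2) φ P p (A p)) (i j : Fin 2) :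
    AEMeasurable (fun y => planeMatrix (localDeriv e e' φ A y) i j)
      (volume.restrict (e.target ∩ e.symm ⁻¹' P)) := by
  have h := aemeasurable_fderivWithin volume (measurableSet_target_inter_preimage_symm e hP)
    (hasFDerivWithinAt_of_mem_preimage he he' hPe' hA)
  have hc : Continuous fun B : Plane →L[ℝ] Plane => planeMatrix B i j :=
    continuous_planeMatrix.matrix_elem i j
  exact hc.measurable.comp_aemeasurable h

omit [RiemannianBundle (fun x : X => TangentSpace (𝓡 2) x)] [IsManifold (𝓡 2) ∞ X]
  [IsContMDiffRiemannianBundle (𝓡 2) ∞ Plane (fun x : X => TangentSpace (𝓡 2) x)]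
  [MeasurableSpace Y] [BorelSpace Y] [RiemannianBundle (fun y : Y => TangentSpace (𝓡 2) y)]
  [IsManifold (𝓡 2) ∞ Y]
  [IsContMDiffRiemannianBundle (𝓡 2) ∞ Plane (fun y : Y => TangentSpace (𝓡 2) y)] in
theorem aemeasurable_comp_localMap (he : e ∈ IsManifold.maximalAtlas (𝓡 2) ∞ X)
    (he' : e' ∈ IsManifold.maximalAtlas (𝓡 2) ∞ Y) (hP : MeasurableSet P)
    (hPe' : MapsTo φ P e'.source)
    (hA : ∀ p ∈ P, HasMFDerivWithinAt (𝓡 2) (𝓡 2) φ P p (A p)) {g : Plane → ℝ}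
    (hg : ContinuousOn g e'.target) :
    AEMeasurable (fun y => g (e' (φ (e.symm y)))) (volume.restrict (e.target ∩ e.symm ⁻¹' P)) := by
  have h := hasFDerivWithinAt_of_mem_preimage he he' hPe' hA
  have hc : ContinuousOn (e' ∘ φ ∘ e.symm) (e.target ∩ e.symm ⁻¹' P) :=
    fun y hy => (h y hy).continuousWithinAt
  exact (hg.comp hc fun y hy => e'.map_source (hPe' hy.2)).aemeasurable
    (measurableSet_target_inter_preimage_symm e hP)

omit [MeasurableSpace Y] [BorelSpace Y] in
-- Divide `singularValues_mul_areaDensity` by the positive density of the source chart.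
theorem aemeasurable_absJacobian_comp (he : e ∈ IsManifold.maximalAtlas (𝓡 2) ∞ X)
    (he' : e' ∈ IsManifold.maximalAtlas (𝓡 2) ∞ Y) (hP : MeasurableSet P)
    (hPe' : MapsTo φ P e'.source)
    (hA : ∀ p ∈ P, HasMFDerivWithinAt (𝓡 2) (𝓡 2) φ P p (A p)) :
    AEMeasurable (fun y => absJacobian A (e.symm y))
      (volume.restrict (e.target ∩ e.symm ⁻¹' P)) := by
  have hS := measurableSet_target_inter_preimage_symm e hP
  have hB := aemeasurable_planeMatrix_localDeriv he he' hP hPe' hA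
  have hd : AEMeasurable (fun y => (planeMatrix (localDeriv e e' φ A y)).det)
      (volume.restrict (e.target ∩ e.symm ⁻¹' P)) := by
    simp_rw [Matrix.det_fin_two]
    exact ((hB 0 0).mul (hB 1 1)).sub ((hB 0 1).mul (hB 1 0))
  have h1 := aemeasurable_comp_localMap he he' hP hPe' hA (continuousOn_areaDensity he')
  have h2 : AEMeasurable (areaDensity e) (volume.restrict (e.target ∩ e.symm ⁻¹' P)) :=
    ((continuousOn_areaDensity he).mono inter_subset_left).aemeasurable hS
  refine (((continuous_abs.measurable.comp_aemeasurable hd).mul h1).div h2).congr ?_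
  filter_upwards [ae_restrict_mem hS] with y hy
  have h3 := singularValues_mul_areaDensity he he' φ A hy.1 (hPe' hy.2)
  have h4 := (areaDensity_pos he hy.1).ne'
  simp only [Pi.div_apply, Pi.mul_apply, Function.comp, det_planeMatrix]
  rw [← h3, mul_div_assoc, div_self h4, mul_one]
  rfl

omit [MeasurableSpace Y] [BorelSpace Y] in
-- The sum of squares is a trace of measurable matrices and the product is the Jacobian;
-- `singularValues_zero_eq` and `singularValues_one_eq` recover the individual values.
theorem aemeasurable_singularValues (he : e ∈ IsManifold.maximalAtlas (𝓡 2) ∞ X)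
    (he' : e' ∈ IsManifold.maximalAtlas (𝓡 2) ∞ Y) (hP : MeasurableSet P)
    (hPe : P ⊆ e.source) (hPe' : MapsTo φ P e'.source)
    (hA : ∀ p ∈ P, HasMFDerivWithinAt (𝓡 2) (𝓡 2) φ P p (A p)) :
    AEMeasurable (fun p => (A p).toLinearMap.singularValues 0) ((chartArea e).restrict P) ∧
    AEMeasurable (fun p => (A p).toLinearMap.singularValues 1) ((chartArea e).restrict P) := by
  have hS := measurableSet_target_inter_preimage_symm e hP
  have hB := aemeasurable_planeMatrix_localDeriv he he' hP hPe' hA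
  have hH := fun i j => aemeasurable_comp_localMap he he' hP hPe' hA
    (continuousOn_metricMatrix_apply he' i j)
  have hG : ∀ i j, AEMeasurable (fun y => metricMatrix e y i j)
      (volume.restrict (e.target ∩ e.symm ⁻¹' P)) := fun i j =>
    ((continuousOn_metricMatrix_apply he i j).mono inter_subset_left).aemeasurable hS
  have hJ := aemeasurable_absJacobian_comp he he' hP hPe' hA
  have hT : AEMeasurable (fun y => (A (e.symm y)).toLinearMap.singularValues 0 ^ 2 +
      (A (e.symm y)).toLinearMap.singularValues 1 ^ 2)
      (volume.restrict (e.target ∩ e.symm ⁻¹' P)) := by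
    have h1 : AEMeasurable (fun y => ((metricMatrix e y)⁻¹ *
        ((planeMatrix (localDeriv e e' φ A y)).transpose *
        metricMatrix e' (e' (φ (e.symm y))) * planeMatrix (localDeriv e e' φ A y))).trace)
        (volume.restrict (e.target ∩ e.symm ⁻¹' P)) := by
      have hinv : ∀ i j, AEMeasurable (fun y => (metricMatrix e y)⁻¹ i j)
          (volume.restrict (e.target ∩ e.symm ⁻¹' P)) := by
        have hdet : AEMeasurable (fun y => (metricMatrix e y).det⁻¹)
            (volume.restrict (e.target ∩ e.symm ⁻¹' P)) := by
          simp_rw [Matrix.det_fin_two]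
          exact (((hG 0 0).mul (hG 1 1)).sub ((hG 0 1).mul (hG 1 0))).inv
        intro i j
        simp only [Matrix.inv_def, Matrix.adjugate_fin_two, Matrix.smul_apply,
          Ring.inverse_eq_inv', smul_eq_mul]
        refine hdet.mul ?_
        fin_cases i <;> fin_cases j
        exacts [hG 1 1, (hG 0 1).neg, (hG 1 0).neg, hG 0 0]
      have hBHB := aemeasurable_mul_apply (aemeasurable_mul_apply
        (A := fun y => (planeMatrix (localDeriv e e' φ A y)).transpose) (fun i j => hB j i) hH) hB
      have := aemeasurable_mul_apply hinv hBHB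
      simp_rw [Matrix.trace_fin_two]
      exact (this 0 0).add (this 1 1)
    refine h1.congr ?_
    filter_upwards [ae_restrict_mem hS] with y hy
    exact (singularValues_sq_add_sq_eq_trace he he' φ A hy.1 (hPe' hy.2)).symm
  have hp := (hT.add (hJ.const_mul 2)).sqrt
  have hm := (hT.sub (hJ.const_mul 2)).sqrt
  constructor
  · refine aemeasurable_restrict_chartArea he hP hPe (((hp.add hm).div_const 2).congr ?_)
    exact Eventually.of_forall fun y =>
      (singularValues_zero_eq (A (e.symm y)).toLinearMap).symm
  · refine aemeasurable_restrict_chartArea he hP hPe (((hp.sub hm).div_const 2).congr ?_)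
    exact Eventually.of_forall fun y =>
      (singularValues_one_eq (A (e.symm y)).toLinearMap).symm

omit [ChartedSpace Plane X] [ChartedSpace Plane Y] [MeasurableSpace X] [BorelSpace X]
  [MeasurableSpace Y] [BorelSpace Y] in
theorem image_eq_source_inter_preimage_image (hPe : P ⊆ e.source) (hPe' : MapsTo φ P e'.source) :
    φ '' P = e'.source ∩ e' ⁻¹' ((e' ∘ φ ∘ e.symm) '' (e.target ∩ e.symm ⁻¹' P)) := by
  ext q
  constructor
  · rintro ⟨p, hp, rfl⟩
    refine ⟨hPe' hp, e p, ⟨e.map_source (hPe hp), ?_⟩, ?_⟩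
    · simpa [e.left_inv (hPe hp)] using hp
    · simp [e.left_inv (hPe hp)]
  · rintro ⟨hq, y, hy, hyq⟩
    exact ⟨e.symm y, hy.2, e'.injOn (hPe' hy.2) hq hyq⟩

omit [ChartedSpace Plane X] [ChartedSpace Plane Y] [MeasurableSpace X] [BorelSpace X]
  [MeasurableSpace Y] [BorelSpace Y] in
theorem target_inter_preimage_image (hPe : P ⊆ e.source) (hPe' : MapsTo φ P e'.source) :
    e'.target ∩ e'.symm ⁻¹' (φ '' P) = (e' ∘ φ ∘ e.symm) '' (e.target ∩ e.symm ⁻¹' P) := by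
  rw [image_eq_source_inter_preimage_image hPe hPe']
  ext z
  constructor
  · rintro ⟨hz, -, hz2⟩
    rwa [mem_preimage, e'.right_inv hz] at hz2
  · rintro ⟨y, hy, rfl⟩
    have h1 := hPe' hy.2
    refine ⟨e'.map_source h1, ?_, ?_⟩
    · simpa [e'.left_inv h1] using h1
    · exact ⟨y, hy, (e'.right_inv (e'.map_source h1)).symm⟩

omit [ChartedSpace Plane X] [ChartedSpace Plane Y] [MeasurableSpace X] [BorelSpace X]
  [MeasurableSpace Y] [BorelSpace Y] in
theorem injOn_localMap (hPe' : MapsTo φ P e'.source) (hφ : InjOn φ P) :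
    InjOn (e' ∘ φ ∘ e.symm) (e.target ∩ e.symm ⁻¹' P) := by
  intro y hy z hz h
  have h1 := e'.injOn (hPe' hy.2) (hPe' hz.2) h
  exact e.symm.injOn hy.1 hz.1 (hφ hy.2 hz.2 h1)

omit [RiemannianBundle (fun x : X => TangentSpace (𝓡 2) x)] [IsManifold (𝓡 2) ∞ X]
  [IsContMDiffRiemannianBundle (𝓡 2) ∞ Plane (fun x : X => TangentSpace (𝓡 2) x)]
  [RiemannianBundle (fun y : Y => TangentSpace (𝓡 2) y)] [IsManifold (𝓡 2) ∞ Y]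
  [IsContMDiffRiemannianBundle (𝓡 2) ∞ Plane (fun y : Y => TangentSpace (𝓡 2) y)] in
theorem measurableSet_image_of_injOn (he : e ∈ IsManifold.maximalAtlas (𝓡 2) ∞ X)
    (he' : e' ∈ IsManifold.maximalAtlas (𝓡 2) ∞ Y) (hP : MeasurableSet P)
    (hPe : P ⊆ e.source) (hPe' : MapsTo φ P e'.source)
    (hA : ∀ p ∈ P, HasMFDerivWithinAt (𝓡 2) (𝓡 2) φ P p (A p)) (hφ : InjOn φ P) :
    MeasurableSet (φ '' P) := by
  have h := measurable_image_of_fderivWithin (measurableSet_target_inter_preimage_symm e hP)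
    (hasFDerivWithinAt_of_mem_preimage he he' hPe' hA) (injOn_localMap hPe' hφ)
  rw [image_eq_source_inter_preimage_image hPe hPe']
  exact measurableSet_source_inter_preimage e' h

/-- The area formula for a differentiable injective map between two chart domains. -/
theorem setLIntegral_absJacobian_chartArea (he : e ∈ IsManifold.maximalAtlas (𝓡 2) ∞ X)
    (he' : e' ∈ IsManifold.maximalAtlas (𝓡 2) ∞ Y) (hP : MeasurableSet P)
    (hPe : P ⊆ e.source) (hPe' : MapsTo φ P e'.source)
    (hA : ∀ p ∈ P, HasMFDerivWithinAt (𝓡 2) (𝓡 2) φ P p (A p)) (hφ : InjOn φ P) :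
    ∫⁻ p in P, ENNReal.ofReal (absJacobian A p) ∂chartArea e = chartArea e' (φ '' P) := by
  have hS := measurableSet_target_inter_preimage_symm e hP
  rw [chartArea_apply e' (measurableSet_image_of_injOn he he' hP hPe hPe' hA hφ),
    target_inter_preimage_image hPe hPe',
    lintegral_image_eq_lintegral_abs_det_fderiv_mul volume hS
      (hasFDerivWithinAt_of_mem_preimage he he' hPe' hA) (injOn_localMap hPe' hφ),
    setLIntegral_chartArea (g := fun p => ENNReal.ofReal (absJacobian A p)) he hP hPe
      (aemeasurable_absJacobian_comp he he' hP hPe' hA).ennreal_ofReal]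
  refine setLIntegral_congr_fun hS fun y hy => ?_
  rw [← ENNReal.ofReal_mul (areaDensity_pos he hy.1).le, ← ENNReal.ofReal_mul (abs_nonneg _)]
  have h := singularValues_mul_areaDensity he he' φ A hy.1 (hPe' hy.2)
  rw [mul_comm]
  exact congrArg ENNReal.ofReal h

omit [MeasurableSpace Y] [BorelSpace Y] [IsManifold (𝓡 2) ∞ Y]
  [IsContMDiffRiemannianBundle (𝓡 2) ∞ Plane (fun y : Y => TangentSpace (𝓡 2) y)] in
-- `ae_det_eq_zero_of_image_null` in coordinates. No injectivity is needed, so this handles the part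
-- of M that is mapped to points with several preimages.
theorem ae_absJacobian_eq_zero_of_chartArea_image (he : e ∈ IsManifold.maximalAtlas (𝓡 2) ∞ X)
    (he' : e' ∈ IsManifold.maximalAtlas (𝓡 2) ∞ Y) (hP : MeasurableSet P)
    (hPe : P ⊆ e.source) (hPe' : MapsTo φ P e'.source)
    (hA : ∀ p ∈ P, HasMFDerivWithinAt (𝓡 2) (𝓡 2) φ P p (A p))
    (h0 : volume ((e' ∘ φ ∘ e.symm) '' (e.target ∩ e.symm ⁻¹' P)) = 0) :
    ∀ᵐ p ∂(chartArea e).restrict P, absJacobian A p = 0 := by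
  have hS := measurableSet_target_inter_preimage_symm e hP
  rw [ae_restrict_chartArea_iff he hP hPe]
  filter_upwards [ae_det_eq_zero_of_image_null volume hS
    (hasFDerivWithinAt_of_mem_preimage he he' hPe' hA) h0, ae_restrict_mem hS] with y hy hyS
  have h := singularValues_mul_areaDensity he he' φ A hyS.1 (hPe' hyS.2)
  rw [hy, abs_zero, zero_mul] at h
  exact (mul_eq_zero.1 h).resolve_right (areaDensity_pos he hyS.1).ne'

end LocalAreaFormula

/-! ### The Riemannian area measure glued from the charts. -/

section RiemannianArea

variable {X : Type*} [TopologicalSpace X] [ChartedSpace Plane X] [MeasurableSpace X]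
  [BorelSpace X] [RiemannianBundle (fun x : X => TangentSpace (𝓡 2) x)]
  [IsManifold (𝓡 2) ∞ X]
  [IsContMDiffRiemannianBundle (𝓡 2) ∞ Plane (fun x : X => TangentSpace (𝓡 2) x)]

/-- Coordinate areas agree on overlaps of charts. -/
theorem chartArea_eq_chartArea {e e' : OpenPartialHomeomorph X Plane}
    (he : e ∈ IsManifold.maximalAtlas (𝓡 2) ∞ X) (he' : e' ∈ IsManifold.maximalAtlas (𝓡 2) ∞ X)
    {P : Set X} (hP : MeasurableSet P) (hPe : P ⊆ e.source) (hPe' : P ⊆ e'.source) :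
    chartArea e P = chartArea e' P := by
  -- The identity, read in the two charts, has Jacobian 1.
  have h := setLIntegral_absJacobian_chartArea (φ := id)
    (A := fun p => ContinuousLinearMap.id ℝ (TangentSpace (𝓡 2) p)) he he' hP hPe hPe'
    (fun p _ => hasMFDerivWithinAt_id P p) (injOn_id P)
  have h1 : ∀ p : X, absJacobian (φ := id)
      (fun p : X => ContinuousLinearMap.id ℝ (TangentSpace (𝓡 2) p)) p = 1 := by
    intro p
    have h2 := (forall_inner_eq_iff_singularValues (V := TangentSpace (𝓡 2) p)
      (W := TangentSpace (𝓡 2) p) Fact.out LinearMap.id zero_le_one).1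
      (fun v w => by simp)
    have h3 : absJacobian (φ := id)
      (fun p : X => ContinuousLinearMap.id ℝ (TangentSpace (𝓡 2) p)) p = 1 * 1 :=
      congrArg₂ (· * ·) h2.1 h2.2
    rw [h3, one_mul]
  simp only [h1, ENNReal.ofReal_one, lintegral_one, Measure.restrict_apply_univ, image_id] at h
  exact h

omit [IsManifold (𝓡 2) ∞ X]
  [IsContMDiffRiemannianBundle (𝓡 2) ∞ Plane (fun x : X => TangentSpace (𝓡 2) x)] in
theorem chartArea_compl_source (e : OpenPartialHomeomorph X Plane) :
    chartArea e e.sourceᶜ = 0 := by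
  rw [chartArea_apply e e.open_source.measurableSet.compl]
  have : e.target ∩ e.symm ⁻¹' e.sourceᶜ = ∅ := by
    ext y
    simp only [mem_inter_iff, mem_preimage, mem_compl_iff, mem_empty_iff_false, iff_false, not_and,
      not_not]
    exact fun hy => e.map_target hy
  rw [this]
  simp

variable [SecondCountableTopology X]

/-- A supremum of measures is hard to evaluate from above. The bound comes from a single measure
that dominates every chart area and agrees with `chartArea e` on the domain of `e`. -/
theorem riemannianArea_apply_of_subset {e : OpenPartialHomeomorph X Plane}
    (he : e ∈ atlas Plane X) {P : Set X} (hP : MeasurableSet P) (hPe : P ⊆ e.source) :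
    riemannianArea X P = chartArea e P := by
  have hmem : ∀ e' ∈ atlas Plane X, e' ∈ IsManifold.maximalAtlas (𝓡 2) ∞ X := fun e' h =>
    IsManifold.subset_maximalAtlas h
  refine le_antisymm ?_ (Measure.le_iff.1 (le_iSup₂_of_le (f := fun e' (_ : e' ∈ atlas Plane X) =>
    chartArea e') e he le_rfl) P hP)
  -- Glue the chart areas along a countable disjoint cover to get an upper bound of all of them.
  obtain ⟨s, hs, hcov⟩ := TopologicalSpace.countable_cover_nhds
    (f := fun x : X => (chartAt Plane x).source) fun x => chart_source_mem_nhds Plane x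
  rcases s.eq_empty_or_nonempty with rfl | hne
  · have : P = ∅ := by
      apply eq_empty_of_subset_empty
      rw [← Set.biUnion_empty (fun x : X => (chartAt Plane x).source), hcov]
      exact subset_univ P
    simp [this]
  obtain ⟨u, hu⟩ := hs.exists_eq_range hne
  have hcov' : ⋃ n, (chartAt Plane (u n)).source = univ := by
    rw [← hcov, hu, biUnion_range]
  set D : ℕ → Set X := disjointed fun n => (chartAt Plane (u n)).source with hD
  have hDm : ∀ n, MeasurableSet (D n) :=
    fun n => MeasurableSet.disjointed (fun n => (chartAt Plane (u n)).open_source.measurableSet) n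
  have hDs : ∀ n, D n ⊆ (chartAt Plane (u n)).source := fun n => disjointed_subset _ n
  have hDd : Pairwise (Function.onFun Disjoint D) := disjoint_disjointed _
  have hDc : ⋃ n, D n = univ := by rw [hD, iUnion_disjointed, hcov']
  set ν : Measure X := Measure.sum fun n => (chartArea (chartAt Plane (u n))).restrict (D n) with hν
  have hdec : ∀ e' ∈ atlas Plane X, ∀ Q, MeasurableSet Q → chartArea e' Q =
      ∑' n, chartArea (chartAt Plane (u n)) (Q ∩ e'.source ∩ D n) := by
    intro e' he' Q hQ
    have hQm : MeasurableSet (Q ∩ e'.source) := hQ.inter e'.open_source.measurableSet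
    have h1 : chartArea e' Q = chartArea e' (Q ∩ e'.source) :=
      (measure_inter_conull (chartArea_compl_source e')).symm
    have h2 : Q ∩ e'.source = ⋃ n, Q ∩ e'.source ∩ D n := by
      rw [← inter_iUnion, hDc, inter_univ]
    rw [h1]
    conv_lhs => rw [h2]
    rw [measure_iUnion (fun i j hij => (hDd hij).mono inter_subset_right inter_subset_right)
      fun n => hQm.inter (hDm n)]
    refine tsum_congr fun n => ?_
    exact chartArea_eq_chartArea (hmem _ he') (hmem _ (chart_mem_atlas Plane _)) (hQm.inter (hDm n))
      (inter_subset_left.trans inter_subset_right) (inter_subset_right.trans (hDs n))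
  have hle : riemannianArea X ≤ ν := by
    refine iSup₂_le fun e' he' => Measure.le_iff.2 fun Q hQ => ?_
    rw [hdec e' he' Q hQ, hν, Measure.sum_apply _ hQ]
    refine ENNReal.tsum_le_tsum fun n => ?_
    rw [Measure.restrict_apply hQ]
    exact measure_mono fun x hx => ⟨hx.1.1, hx.2⟩
  refine (Measure.le_iff.1 hle P hP).trans ?_
  rw [hdec e he P hP, hν, Measure.sum_apply _ hP, inter_eq_left.2 hPe]
  exact ENNReal.tsum_le_tsum fun n => by rw [Measure.restrict_apply hP]

theorem restrict_riemannianArea {e : OpenPartialHomeomorph X Plane}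
    (he : e ∈ atlas Plane X) {P : Set X} (hP : MeasurableSet P) (hPe : P ⊆ e.source) :
    (riemannianArea X).restrict P = (chartArea e).restrict P := by
  ext t ht
  rw [Measure.restrict_apply ht, Measure.restrict_apply ht,
    riemannianArea_apply_of_subset he (ht.inter hP) (inter_subset_right.trans hPe)]

instance isOpenPosMeasure_riemannianArea : (riemannianArea X).IsOpenPosMeasure := by
  refine ⟨fun U hU ⟨x, hx⟩ h0 => ?_⟩
  set e := chartAt Plane x
  have he : e ∈ atlas Plane X := chart_mem_atlas Plane x
  have hV : IsOpen (U ∩ e.source) := hU.inter e.open_source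
  have h1 : riemannianArea X (U ∩ e.source) = 0 := measure_mono_null inter_subset_left h0
  rw [riemannianArea_apply_of_subset he hV.measurableSet inter_subset_right] at h1
  have h2 : ∀ᵐ p ∂(chartArea e).restrict (U ∩ e.source), False := by
    rw [Measure.restrict_eq_zero.2 h1]
    simp
  rw [ae_restrict_chartArea_iff (IsManifold.subset_maximalAtlas he) hV.measurableSet
    inter_subset_right] at h2
  have hS : IsOpen (e.target ∩ e.symm ⁻¹' (U ∩ e.source)) := e.isOpen_inter_preimage_symm hV
  have hmem : e x ∈ e.target ∩ e.symm ⁻¹' (U ∩ e.source) := by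
    have hxe : x ∈ e.source := mem_chart_source Plane x
    refine ⟨e.map_source hxe, ?_⟩
    rw [mem_preimage, e.left_inv hxe]
    exact ⟨hx, hxe⟩
  have h3 : volume (e.target ∩ e.symm ⁻¹' (U ∩ e.source)) = 0 := by
    rw [ae_iff, Measure.restrict_apply' hS.measurableSet] at h2
    simpa using h2
  exact (hS.measure_pos volume ⟨_, hmem⟩).ne' h3

instance isLocallyFiniteMeasure_riemannianArea :
    IsLocallyFiniteMeasure (riemannianArea X) := by
  refine ⟨fun x => ?_⟩
  set e := chartAt Plane x
  have he : e ∈ atlas Plane X := chart_mem_atlas Plane x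
  have hem : e ∈ IsManifold.maximalAtlas (𝓡 2) ∞ X := IsManifold.subset_maximalAtlas he
  have hxe : x ∈ e.source := mem_chart_source Plane x
  have hc : ContinuousAt (areaDensity e) (e x) :=
    (continuousOn_areaDensity hem).continuousAt (e.open_target.mem_nhds (e.map_source hxe))
  have h1 : ∀ᶠ y in 𝓝 (e x), areaDensity e y < areaDensity e (e x) + 1 :=
    hc.eventually (gt_mem_nhds (lt_add_one _))
  obtain ⟨r, hr0, hr⟩ := Metric.eventually_nhds_iff_ball.1 h1
  set V := e.source ∩ e ⁻¹' Metric.ball (e x) r with hV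
  have hVo : IsOpen V := e.isOpen_inter_preimage Metric.isOpen_ball
  refine ⟨V, hVo.mem_nhds ⟨hxe, Metric.mem_ball_self hr0⟩, ?_⟩
  rw [riemannianArea_apply_of_subset he hVo.measurableSet inter_subset_left,
    chartArea_apply e hVo.measurableSet]
  have hsub : e.target ∩ e.symm ⁻¹' V ⊆ Metric.ball (e x) r := by
    rintro y ⟨hy, -, hy2⟩
    rwa [mem_preimage, e.right_inv hy] at hy2
  calc ∫⁻ y in e.target ∩ e.symm ⁻¹' V, ENNReal.ofReal (areaDensity e y)
      ≤ ∫⁻ _ in e.target ∩ e.symm ⁻¹' V, ENNReal.ofReal (areaDensity e (e x) + 1) := by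
        refine setLIntegral_mono' (measurableSet_target_inter_preimage_symm e hVo.measurableSet)
          fun y hy => ENNReal.ofReal_le_ofReal (hr y (hsub hy)).le
    _ = ENNReal.ofReal (areaDensity e (e x) + 1) * volume (e.target ∩ e.symm ⁻¹' V) := by
        rw [setLIntegral_const]
    _ < ⊤ := ENNReal.mul_lt_top ENNReal.ofReal_lt_top
        ((measure_mono hsub).trans_lt Metric.isBounded_ball.measure_lt_top)

end RiemannianArea

/-! ### Charts are locally bi-Lipschitz for the Riemannian distance. -/

section ChartDistances

variable {E : Type*} [NormedAddCommGroup E] [NormedSpace ℝ E]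
  {H : Type*} [TopologicalSpace H] (I : ModelWithCorners ℝ E H)
  {M : Type*} [TopologicalSpace M] [ChartedSpace H M]
  [RiemannianBundle (fun (x : M) ↦ TangentSpace I x)]
  [IsManifold I 1 M] [IsContinuousRiemannianBundle E (fun (x : M) ↦ TangentSpace I x)]

theorem eventually_enorm_mfderivWithin_symm_extChartAt_apply_le (x : M) :
    ∃ C : ℝ≥0, ∀ᶠ y in 𝓝[range I] (extChartAt I x x), ∀ v : E,
      ‖mfderivWithin 𝓘(ℝ, E) I (extChartAt I x).symm (range I) y v‖ₑ ≤ C * ‖v‖ₑ := by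
  obtain ⟨C, -, hC⟩ := eventually_enorm_mfderivWithin_symm_extChartAt_lt I x
  refine ⟨C, hC.mono fun y hy v => ?_⟩
  let _ := normedAddCommGroupTangentSpaceVectorSpace (E := E) y
  let _ := normedSpaceTangentSpaceVectorSpace (E := E) y
  exact (ContinuousLinearMap.le_opENorm _ _).trans (mul_le_mul_left hy.le _)

/-- The image is named `w : E` so that its norm is that of the model space rather than one on a
tangent space to it. -/
theorem eventually_enorm_mfderiv_extChartAt_apply_le (x : M) :
    ∃ C : ℝ≥0, ∀ᶠ y in 𝓝 x, ∀ (v : TangentSpace I y) (w : E),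
      w = mfderiv I 𝓘(ℝ, E) (extChartAt I x) y v → ‖w‖ₑ ≤ C * ‖v‖ₑ := by
  obtain ⟨C, -, hC⟩ := eventually_enorm_mfderiv_extChartAt_lt I x
  refine ⟨C, hC.mono fun y hy v w hw => ?_⟩
  let _ := normedAddCommGroupTangentSpaceVectorSpace (E := E) (extChartAt I x y)
  let _ := normedSpaceTangentSpaceVectorSpace (E := E) (extChartAt I x y)
  rw [hw]
  exact (ContinuousLinearMap.le_opENorm _ _).trans (mul_le_mul_left hy.le _)

/-- The inverse of the extended chart is locally Lipschitz for the Riemannian distance. -/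
theorem exists_riemannianEDist_extChartAt_symm_le (x : M) :
    ∃ C : ℝ≥0, ∃ r > 0, ∀ y ∈ Metric.ball (extChartAt I x x) r ∩ range I,
      ∀ z ∈ Metric.ball (extChartAt I x x) r ∩ range I,
      riemannianEDist I ((extChartAt I x).symm y) ((extChartAt I x).symm z) ≤ C * edist y z := by
  obtain ⟨C, hC⟩ := eventually_enorm_mfderivWithin_symm_extChartAt_apply_le I x
  refine ⟨C, ?_⟩
  obtain ⟨r, r_pos, hr⟩ := Metric.mem_nhdsWithin_iff.1
    (inter_mem (extChartAt_target_mem_nhdsWithin x) hC)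
  refine ⟨r, r_pos, fun y hy z hz => ?_⟩
  -- The image of a straight segment is an admissible path; the segment stays in the ball and in
  -- `range I`, as both are convex.
  let η := ContinuousAffineMap.lineMap (R := ℝ) y z
  set γ := (extChartAt I x).symm ∘ η
  have hη : ∀ t ∈ Icc (0 : ℝ) 1, η t ∈ Metric.ball (extChartAt I x x) r ∩ range I := by
    have : η '' Icc 0 1 ⊆ Metric.ball (extChartAt I x x) r ∩ range I := by
      simp only [ContinuousAffineMap.coe_lineMap_eq, ← segment_eq_image_lineMap, η]
      exact ((convex_ball _ _).inter I.convex_range).segment_subset hy hz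
    exact fun t ht => this (mem_image_of_mem _ ht)
  have η_smooth : ContMDiffOn 𝓘(ℝ, ℝ) 𝓘(ℝ, E) 1 η (Icc 0 1) := by
    apply ContMDiff.contMDiffOn
    rw [contMDiff_iff_contDiff]
    exact ContinuousAffineMap.contDiff _
  have : riemannianEDist I ((extChartAt I x).symm y) ((extChartAt I x).symm z)
      ≤ pathELength I γ 0 1 := by
    apply riemannianEDist_le_pathELength _ _ _ zero_le_one
    · exact (contMDiffOn_extChartAt_symm x).comp η_smooth fun t ht => (hr (hη t ht)).1
    · simp [γ, η, ContinuousAffineMap.coe_lineMap_eq]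
    · simp [γ, η, ContinuousAffineMap.coe_lineMap_eq]
  apply this.trans
  rw [← lintegral_fderiv_lineMap_eq_edist, pathELength_eq_lintegral_mfderivWithin_Icc,
    ← lintegral_const_mul' _ _ ENNReal.coe_ne_top]
  apply setLIntegral_mono' measurableSet_Icc (fun t ht ↦ ?_)
  have h1 : mfderivWithin 𝓘(ℝ, ℝ) I γ (Icc 0 1) t =
      (mfderivWithin 𝓘(ℝ, E) I (extChartAt I x).symm (range I) (η t)) ∘L
        (mfderivWithin 𝓘(ℝ, ℝ) 𝓘(ℝ, E) η (Icc 0 1) t) := by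
    apply mfderivWithin_comp
    · exact mdifferentiableWithinAt_extChartAt_symm (hr (hη t ht)).1
    · exact η_smooth.mdifferentiableOn one_ne_zero t ht
    · exact fun t ht => (hη t ht).2
    · rw [uniqueMDiffWithinAt_iff_uniqueDiffWithinAt]
      exact uniqueDiffOn_Icc zero_lt_one t ht
  have h2 : mfderivWithin 𝓘(ℝ, ℝ) I γ (Icc 0 1) t 1 =
      (mfderivWithin 𝓘(ℝ, E) I (extChartAt I x).symm (range I) (η t))
        (mfderivWithin 𝓘(ℝ, ℝ) 𝓘(ℝ, E) η (Icc 0 1) t 1) := congr($h1 1)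
  rw [h2]
  refine ((hr (hη t ht)).2 _).trans (le_of_eq ?_)
  rw [mfderivWithin_eq_fderivWithin]
  rfl

/-- The extended chart is locally Lipschitz for the Riemannian distance. -/
theorem exists_edist_extChartAt_le_riemannianEDist [RegularSpace M] (x : M) :
    ∃ C : ℝ≥0, ∃ U ∈ 𝓝 x, ∀ y ∈ U, ∀ z ∈ U,
      edist (extChartAt I x y) (extChartAt I x z) ≤ C * riemannianEDist I y z := by
  obtain ⟨C, hC⟩ := eventually_enorm_mfderiv_extChartAt_apply_le I x
  obtain ⟨c, c_pos, hc⟩ := setOfPred_riemannianEDist_lt_subset_nhds' I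
    (inter_mem hC (chart_source_mem_nhds H x))
  have c4 : (0 : ℝ≥0∞) < c / 2 / 2 :=
    ENNReal.div_pos (ENNReal.div_pos c_pos.ne' (by norm_num)).ne' (by norm_num)
  -- Radius c / 4: two such points are less than c / 2 apart, and a path shorter than c / 2 starting
  -- at one of them stays in the c-ball, where the derivative of the chart is bounded.
  refine ⟨C, _, eventually_riemannianEDist_lt I x c4, fun y hy z hz => ?_⟩
  have hy' : riemannianEDist I x y < c / 2 / 2 := hy
  have hz' : riemannianEDist I x z < c / 2 / 2 := hz
  have hyz : riemannianEDist I y z < c / 2 := by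
    calc riemannianEDist I y z ≤ riemannianEDist I y x + riemannianEDist I x z :=
          riemannianEDist_triangle
      _ < c / 2 / 2 + c / 2 / 2 := by
          rw [riemannianEDist_comm]
          exact ENNReal.add_lt_add hy' hz'
      _ = c / 2 := ENNReal.add_halves _
  -- It suffices to bound the distance in the chart by the length of any short enough path.
  have key : ∀ r, riemannianEDist I y z < r → r ≤ c / 2 →
      edist (extChartAt I x y) (extChartAt I x z) ≤ C * r := by
    intro r hr hrc
    obtain ⟨γ, hγy, hγz, γ_smooth, hγ⟩ := exists_lt_of_riemannianEDist_lt hr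
    have hmem : ∀ t ∈ Icc (0 : ℝ) 1, riemannianEDist I x (γ t) < c := by
      intro t ht
      have h1 : riemannianEDist I y (γ t) < c / 2 := by
        refine lt_of_le_of_lt (riemannianEDist_le_pathELength
          (γ_smooth.mono (Icc_subset_Icc le_rfl ht.2)) hγy rfl ht.1) ?_
        exact (pathELength_mono le_rfl ht.2).trans_lt (hγ.trans_le hrc)
      calc riemannianEDist I x (γ t) ≤ riemannianEDist I x y + riemannianEDist I y (γ t) :=
            riemannianEDist_triangle
        _ < c / 2 + c / 2 := ENNReal.add_lt_add
            (hy'.trans_le (ENNReal.half_le_self)) h1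
        _ = c := ENNReal.add_halves _
    let γ' := extChartAt I x ∘ γ
    have hγ' : ContMDiffOn 𝓘(ℝ, ℝ) 𝓘(ℝ, E) 1 γ' (Icc 0 1) :=
      contMDiffOn_extChartAt.comp (I' := I) (t := (chartAt H x).source)
        γ_smooth (fun t ht ↦ (hc (hmem t ht)).2)
    rw [edist_comm, edist_eq_enorm_sub]
    have e0 : extChartAt I x z - extChartAt I x y = γ' 1 - γ' 0 := by simp [γ', hγy, hγz]
    rw [e0]
    calc
      ‖γ' 1 - γ' 0‖ₑ
    _ ≤ ∫⁻ t in Icc 0 1, ‖derivWithin γ' (Icc 0 1) t‖ₑ := by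
      apply enorm_sub_le_lintegral_derivWithin_Icc_of_contDiffOn_Icc _ zero_le_one
      rwa [← contMDiffOn_iff_contDiffOn]
    _ ≤ ∫⁻ t in Icc 0 1, C * ‖mfderivWithin 𝓘(ℝ, ℝ) I γ (Icc 0 1) t 1‖ₑ := by
      apply setLIntegral_mono' measurableSet_Icc (fun t ht ↦ ?_)
      have h1 : mfderivWithin 𝓘(ℝ, ℝ) 𝓘(ℝ, E) γ' (Icc 0 1) t =
          (mfderiv I 𝓘(ℝ, E) (extChartAt I x) (γ t)) ∘L
            (mfderivWithin 𝓘(ℝ, ℝ) I γ (Icc 0 1) t) := by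
        apply mfderiv_comp_mfderivWithin
        · exact mdifferentiableAt_extChartAt (hc (hmem t ht)).2
        · exact γ_smooth.mdifferentiableOn one_ne_zero t ht
        · rw [uniqueMDiffWithinAt_iff_uniqueDiffWithinAt]
          exact uniqueDiffOn_Icc zero_lt_one t ht
      refine (hc (hmem t ht)).1 _ _ ?_
      rw [← fderivWithin_derivWithin, ← mfderivWithin_eq_fderivWithin]
      exact congr($h1 1)
    _ = C * pathELength I γ 0 1 := by
      rw [lintegral_const_mul' _ _ ENNReal.coe_ne_top,
          pathELength_eq_lintegral_mfderivWithin_Icc]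
    _ ≤ C * r := by gcongr
  -- The distance is an infimum over paths: the bound holds for every slightly larger r and passes
  -- to the limit.
  have hlim : Tendsto (fun r : ℝ≥0∞ => (C : ℝ≥0∞) * r) (𝓝[>] (riemannianEDist I y z))
      (𝓝 (C * riemannianEDist I y z)) :=
    ((ENNReal.continuous_const_mul ENNReal.coe_ne_top).tendsto _).mono_left nhdsWithin_le_nhds
  have hne : (𝓝[>] (riemannianEDist I y z)).NeBot := nhdsGT_neBot_of_exists_gt ⟨_, hyz⟩
  refine ge_of_tendsto hlim ?_
  filter_upwards [Ioo_mem_nhdsGT hyz] with r hr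
  exact key r hr.1 hr.2.le

end ChartDistances

/-- A Lipschitz map sends null sets of two-dimensional Hausdorff measure to null sets, and in the
plane this measure and Lebesgue measure are multiples of each other. -/
theorem LipschitzOnWith.volume_image_eq_zero {K : ℝ≥0} {g : Plane → Plane} {S : Set Plane}
    (hg : LipschitzOnWith K g S) (h0 : volume S = 0) : volume (g '' S) = 0 := by
  have hH : (Measure.hausdorffMeasure 2 : Measure Plane).IsAddHaarMeasure := by
    simpa using isAddHaarMeasure_hausdorffMeasure (E := Plane)
  have h1 := Measure.isAddLeftInvariant_eq_smul (Measure.hausdorffMeasure 2 : Measure Plane) volume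
  have h2 := Measure.isAddLeftInvariant_eq_smul volume (Measure.hausdorffMeasure 2 : Measure Plane)
  have h3 : Measure.hausdorffMeasure 2 S = 0 := by
    rw [h1, Measure.smul_apply, h0, smul_zero]
  have h4 : Measure.hausdorffMeasure 2 (g '' S) = 0 := by
    refine le_antisymm ((hg.hausdorffMeasure_image_le (d := 2) (by norm_num)).trans_eq ?_) zero_le
    rw [h3, mul_zero]
  rw [h2, Measure.smul_apply, h4, smul_zero]

/-! ### Lipschitz bounds for arbitrary smooth charts. -/

section LipschitzCharts

variable {X : Type*} [EMetricSpace X] [ChartedSpace Plane X] [IsManifold (𝓡 2) ∞ X]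
  [RiemannianBundle (fun x : X => TangentSpace (𝓡 2) x)]
  [IsContMDiffRiemannianBundle (𝓡 2) ∞ Plane (fun x : X => TangentSpace (𝓡 2) x)]

theorem isContinuousRiemannianBundle_tangentSpace :
    IsContinuousRiemannianBundle Plane (fun x : X => TangentSpace (𝓡 2) x) := by
  obtain ⟨g, hg, hg'⟩ := IsContMDiffRiemannianBundle.exists_contMDiff (IB := 𝓡 2) (n := ∞)
    (F := Plane) (E := fun x : X => TangentSpace (𝓡 2) x)
  exact ⟨g, hg.continuous, hg'⟩

variable [IsRiemannianManifold (𝓡 2) X]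

theorem exists_lipschitzOnWith_chartAt (p : X) :
    ∃ C, ∃ U ∈ 𝓝 p, LipschitzOnWith C (chartAt Plane p) U := by
  have : IsContinuousRiemannianBundle Plane (fun x : X => TangentSpace (𝓡 2) x) :=
    isContinuousRiemannianBundle_tangentSpace
  obtain ⟨C, U, hU, h⟩ := exists_edist_extChartAt_le_riemannianEDist (𝓡 2) p
  refine ⟨C, U, hU, fun y hy z hz => ?_⟩
  have := h y hy z hz
  rwa [← IsRiemannianManifold.out] at this

theorem exists_lipschitzOnWith_chartAt_symm (p : X) :
    ∃ C, ∃ V ∈ 𝓝 (chartAt Plane p p), LipschitzOnWith C (chartAt Plane p).symm V := by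
  have : IsContinuousRiemannianBundle Plane (fun x : X => TangentSpace (𝓡 2) x) :=
    isContinuousRiemannianBundle_tangentSpace
  obtain ⟨C, r, hr, h⟩ := exists_riemannianEDist_extChartAt_symm_le (𝓡 2) p
  refine ⟨C, _, Metric.ball_mem_nhds _ hr, fun y hy z hz => ?_⟩
  have := h y ⟨hy, by simp⟩ z ⟨hz, by simp⟩
  rwa [← IsRiemannianManifold.out] at this

/-- Compose the preferred chart at p with a C¹ transition map. General charts are needed because
those which flatten the description of the boundary of M are only in the maximal atlas. -/
theorem exists_lipschitzOnWith_of_mem_maximalAtlas {e : OpenPartialHomeomorph X Plane}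
    (he : e ∈ IsManifold.maximalAtlas (𝓡 2) ∞ X) {p : X} (hp : p ∈ e.source) :
    ∃ C, ∃ U ∈ 𝓝 p, LipschitzOnWith C e U := by
  obtain ⟨C, U, hU, h⟩ := exists_lipschitzOnWith_chartAt p
  set c := chartAt Plane p with hc
  have hpc : p ∈ c.source := mem_chart_source Plane p
  have hcm : c ∈ IsManifold.maximalAtlas (𝓡 2) ∞ X := IsManifold.chart_mem_maximalAtlas p
  have hsmooth : ContDiffAt ℝ 1 (e ∘ c.symm) (c p) := by
    have h1 : ContMDiffAt (𝓡 2) (𝓡 2) ∞ c.symm (c p) :=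
      contMDiffAt_symm_of_mem_maximalAtlas hcm (c.map_source hpc)
    have h2 : ContMDiffAt (𝓡 2) (𝓡 2) ∞ e (c.symm (c p)) := by
      rw [c.left_inv hpc]
      exact contMDiffAt_of_mem_maximalAtlas he hp
    exact ((contMDiffAt_iff_contDiffAt.1 (h2.comp (c p) h1))).of_le (by norm_num)
  obtain ⟨K, V, hV, hK⟩ := hsmooth.exists_lipschitzOnWith
  refine ⟨K * C, U ∩ c ⁻¹' V ∩ c.source, inter_mem (inter_mem hU
    ((c.continuousAt hpc).preimage_mem_nhds hV)) (c.open_source.mem_nhds hpc), ?_⟩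
  intro x hx y hy
  have h3 := (hK.comp (h.mono fun x (hx : x ∈ U ∩ c ⁻¹' V ∩ c.source) => hx.1.1)
    fun x hx => hx.1.2) hx hy
  simpa only [Function.comp, c.left_inv hx.2, c.left_inv hy.2] using h3

theorem exists_lipschitzOnWith_symm_of_mem_maximalAtlas {e : OpenPartialHomeomorph X Plane}
    (he : e ∈ IsManifold.maximalAtlas (𝓡 2) ∞ X) {p : X} (hp : p ∈ e.source) :
    ∃ C, ∃ V ∈ 𝓝 (e p), LipschitzOnWith C e.symm V := by
  obtain ⟨C, U, hU, h⟩ := exists_lipschitzOnWith_chartAt_symm p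
  set c := chartAt Plane p with hc
  have hpc : p ∈ c.source := mem_chart_source Plane p
  have hcm : c ∈ IsManifold.maximalAtlas (𝓡 2) ∞ X := IsManifold.chart_mem_maximalAtlas p
  have hsmooth : ContDiffAt ℝ 1 (c ∘ e.symm) (e p) := by
    have h1 : ContMDiffAt (𝓡 2) (𝓡 2) ∞ e.symm (e p) :=
      contMDiffAt_symm_of_mem_maximalAtlas he (e.map_source hp)
    have h2 : ContMDiffAt (𝓡 2) (𝓡 2) ∞ c (e.symm (e p)) := by
      rw [e.left_inv hp]
      exact contMDiffAt_of_mem_maximalAtlas hcm hpc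
    exact ((contMDiffAt_iff_contDiffAt.1 (h2.comp (e p) h1))).of_le (by norm_num)
  obtain ⟨K, V, hV, hK⟩ := hsmooth.exists_lipschitzOnWith
  have hcont : ContinuousAt e.symm (e p) := e.symm.continuousAt (e.map_source hp)
  have hU' : c ∘ e.symm ⁻¹' U ∈ 𝓝 (e p) :=
    hsmooth.continuousAt.preimage_mem_nhds (by simpa [e.left_inv hp] using hU)
  have hs : e.symm ⁻¹' c.source ∈ 𝓝 (e p) := hcont.preimage_mem_nhds (by
    rw [e.left_inv hp]
    exact c.open_source.mem_nhds hpc)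
  refine ⟨C * K, V ∩ (c ∘ e.symm ⁻¹' U) ∩ e.symm ⁻¹' c.source, inter_mem (inter_mem hV hU') hs, ?_⟩
  intro x hx y hy
  have h3 := (h.comp (hK.mono fun x (hx : x ∈ V ∩ (c ∘ e.symm ⁻¹' U) ∩ e.symm ⁻¹' c.source) =>
    hx.1.1) fun x hx => hx.1.2) hx hy
  simpa only [Function.comp, c.left_inv hx.2, c.left_inv hy.2] using h3

end LipschitzCharts

/-! ### Lipschitz maps in coordinates. -/

section LipschitzMaps

variable {X Y : Type*} [EMetricSpace X] [MeasurableSpace X] [BorelSpace X] [ChartedSpace Plane X]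
  [IsManifold (𝓡 2) ∞ X] [RiemannianBundle (fun x : X => TangentSpace (𝓡 2) x)]
  [IsContMDiffRiemannianBundle (𝓡 2) ∞ Plane (fun x : X => TangentSpace (𝓡 2) x)]
  [IsRiemannianManifold (𝓡 2) X]
  [EMetricSpace Y] [MeasurableSpace Y] [BorelSpace Y] [ChartedSpace Plane Y]
  [IsManifold (𝓡 2) ∞ Y] [RiemannianBundle (fun y : Y => TangentSpace (𝓡 2) y)]
  [IsContMDiffRiemannianBundle (𝓡 2) ∞ Plane (fun y : Y => TangentSpace (𝓡 2) y)]
  [IsRiemannianManifold (𝓡 2) Y]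
  {φ : X → Y} {M : Set X}

/-- The open set `U` is so small that the expression of `φ` on `M ∩ U` in the charts at `p` and
`φ p` is Lipschitz. -/
structure IsLipschitzChartDomain (φ : X → Y) (M : Set X) (p : X) (U : Set X) : Prop where
  isOpen : IsOpen U
  subset_source : U ⊆ (chartAt Plane p).source
  mapsTo : MapsTo φ (M ∩ U) (chartAt Plane (φ p)).source
  lipschitz : ∃ K, LipschitzOnWith K (chartAt Plane (φ p) ∘ φ ∘ (chartAt Plane p).symm)
    ((chartAt Plane p).target ∩ (chartAt Plane p).symm ⁻¹' (M ∩ U))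

omit [MeasurableSpace X] [BorelSpace X] [MeasurableSpace Y] [BorelSpace Y] in
theorem LipschitzOnWith.exists_isLipschitzChartDomain {K : ℝ≥0} (hφ : LipschitzOnWith K φ M)
    {p : X} (hp : p ∈ M) : ∃ U, p ∈ U ∧ IsLipschitzChartDomain φ M p U := by
  set c := chartAt Plane p with hc
  set c' := chartAt Plane (φ p) with hc'
  have hpc : p ∈ c.source := mem_chart_source Plane p
  obtain ⟨C, V, hV, hCV⟩ := exists_lipschitzOnWith_chartAt_symm p
  obtain ⟨C', U', hU', hCU'⟩ := exists_lipschitzOnWith_chartAt (φ p)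
  have h1 : U' ∩ c'.source ∈ 𝓝 (φ p) := inter_mem hU' (chart_source_mem_nhds Plane (φ p))
  obtain ⟨W, hWo, hpW, hW⟩ := mem_nhdsWithin.1 (hφ.continuousOn p hp h1)
  refine ⟨W ∩ (c.source ∩ c ⁻¹' interior V), ⟨hpW, hpc, mem_interior_iff_mem_nhds.2 hV⟩,
    hWo.inter (c.isOpen_inter_preimage isOpen_interior), fun x hx => hx.2.1,
    fun x hx => (hW ⟨hx.2.1, hx.1⟩).2, C' * (K * C), ?_⟩
  refine hCU'.comp (hφ.comp (hCV.mono fun y hy => ?_) fun y hy => hy.2.1)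
    fun y hy => (hW ⟨hy.2.2.1, hy.2.1⟩).1
  have h2 := hy.2.2.2.2
  rw [mem_preimage, c.right_inv hy.1] at h2
  exact interior_subset h2

omit [IsRiemannianManifold (𝓡 2) X] [MeasurableSpace Y] [BorelSpace Y]
  [RiemannianBundle (fun y : Y => TangentSpace (𝓡 2) y)]
  [IsContMDiffRiemannianBundle (𝓡 2) ∞ Plane (fun y : Y => TangentSpace (𝓡 2) y)]
  [IsRiemannianManifold (𝓡 2) Y] in
-- Rademacher's theorem for the planar expression of φ, carried back through the charts. As U is
-- open, differentiability within M ∩ U is differentiability within M.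
theorem IsLipschitzChartDomain.ae_hasMFDerivWithinAt {p : X} {U : Set X}
    (hU : IsLipschitzChartDomain φ M p U) (hM : MeasurableSet M) :
    ∀ᵐ x ∂(chartArea (chartAt Plane p)).restrict (M ∩ U),
      HasMFDerivWithinAt (𝓡 2) (𝓡 2) φ M x (mfderivWithin (𝓡 2) (𝓡 2) φ M x) := by
  set c := chartAt Plane p with hc
  set c' := chartAt Plane (φ p) with hc'
  have hcm : c ∈ IsManifold.maximalAtlas (𝓡 2) ∞ X := IsManifold.chart_mem_maximalAtlas p
  have hcm' : c' ∈ IsManifold.maximalAtlas (𝓡 2) ∞ Y := IsManifold.chart_mem_maximalAtlas _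
  have hP : MeasurableSet (M ∩ U) := hM.inter hU.isOpen.measurableSet
  obtain ⟨K, hK⟩ := hU.lipschitz
  rw [ae_restrict_chartArea_iff hcm hP (inter_subset_right.trans hU.subset_source)]
  have hS := measurableSet_target_inter_preimage_symm c hP
  filter_upwards [hK.ae_differentiableWithinAt (μ := volume) hS, ae_restrict_mem hS] with y hy hyS
  refine MDifferentiableWithinAt.hasMFDerivWithinAt ?_
  set x := c.symm y with hx
  have hxc : x ∈ c.source := c.map_target hyS.1
  have hcx : c x = y := c.right_inv hyS.1
  have h1 : MDifferentiableWithinAt (𝓡 2) (𝓡 2) c (M ∩ U) x :=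
    ((mdifferentiable_of_mem_maximalAtlas hcm).mdifferentiableAt hxc).mdifferentiableWithinAt
  have h2 : MDifferentiableWithinAt (𝓡 2) (𝓡 2) (c' ∘ φ ∘ c.symm)
      (c.target ∩ c.symm ⁻¹' (M ∩ U)) (c x) := by
    rw [hcx]
    exact hy.mdifferentiableWithinAt
  have h3 : MDifferentiableAt (𝓡 2) (𝓡 2) c'.symm ((c' ∘ φ ∘ c.symm) (c x)) := by
    rw [hcx]
    exact (mdifferentiable_of_mem_maximalAtlas hcm').mdifferentiableAt_symm
      (c'.map_source (hU.mapsTo hyS.2))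
  have hmaps : MapsTo c (M ∩ U) (c.target ∩ c.symm ⁻¹' (M ∩ U)) := fun z hz =>
    ⟨c.map_source (hU.subset_source hz.2), by
      rwa [mem_preimage, c.left_inv (hU.subset_source hz.2)]⟩
  have h4 : MDifferentiableWithinAt (𝓡 2) (𝓡 2) (c'.symm ∘ (c' ∘ φ ∘ c.symm) ∘ c) (M ∩ U) x :=
    h3.comp_mdifferentiableWithinAt x (h2.comp x h1 hmaps)
  have h5 : MDifferentiableWithinAt (𝓡 2) (𝓡 2) φ (M ∩ U) x := by
    refine h4.congr (fun z hz => ?_) ?_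
    · simp only [Function.comp, c.left_inv (hU.subset_source hz.2)]
      exact (c'.left_inv (hU.mapsTo hz)).symm
    · simp only [Function.comp, c.left_inv hxc]
      exact (c'.left_inv (hU.mapsTo hyS.2)).symm
  exact (mdifferentiableWithinAt_inter (hU.isOpen.mem_nhds hyS.2.2)).1 h5

omit [MeasurableSpace X] [BorelSpace X] [IsManifold (𝓡 2) ∞ X]
  [RiemannianBundle (fun x : X => TangentSpace (𝓡 2) x)]
  [IsContMDiffRiemannianBundle (𝓡 2) ∞ Plane (fun x : X => TangentSpace (𝓡 2) x)]
  [IsRiemannianManifold (𝓡 2) X] [MeasurableSpace Y] [BorelSpace Y] [IsManifold (𝓡 2) ∞ Y]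
  [RiemannianBundle (fun y : Y => TangentSpace (𝓡 2) y)]
  [IsContMDiffRiemannianBundle (𝓡 2) ∞ Plane (fun y : Y => TangentSpace (𝓡 2) y)]
  [IsRiemannianManifold (𝓡 2) Y] in
theorem IsLipschitzChartDomain.volume_image_eq_zero {p : X} {U : Set X}
    (hU : IsLipschitzChartDomain φ M p U) {S : Set Plane}
    (hS : S ⊆ (chartAt Plane p).target ∩ (chartAt Plane p).symm ⁻¹' (M ∩ U)) (h0 : volume S = 0) :
    volume ((chartAt Plane (φ p) ∘ φ ∘ (chartAt Plane p).symm) '' S) = 0 := by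
  obtain ⟨K, hK⟩ := hU.lipschitz
  exact (hK.mono hS).volume_image_eq_zero h0

end LipschitzMaps

theorem ContinuousOn.measurableSet_inter_preimage {Z W : Type*} [TopologicalSpace Z]
    [MeasurableSpace Z] [BorelSpace Z] [TopologicalSpace W] [MeasurableSpace W] [BorelSpace W]
    {g : Z → W} {S : Set Z} (hg : ContinuousOn g S) (hS : MeasurableSet S) {P : Set W}
    (hP : MeasurableSet P) : MeasurableSet (S ∩ g ⁻¹' P) := by
  have h2 := hS.subtype_image (hg.domRestrict.measurable hP)
  convert h2 using 1
  ext y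
  simp [Set.domRestrict, and_comm]

theorem riemannianArea_eq_zero_iff {X : Type*} [TopologicalSpace X] [SecondCountableTopology X]
    [ChartedSpace Plane X] [MeasurableSpace X] [BorelSpace X]
    [RiemannianBundle (fun x : X => TangentSpace (𝓡 2) x)] [IsManifold (𝓡 2) ∞ X]
    [IsContMDiffRiemannianBundle (𝓡 2) ∞ Plane (fun x : X => TangentSpace (𝓡 2) x)]
    {e : OpenPartialHomeomorph X Plane} (he : e ∈ atlas Plane X) {P : Set X}
    (hP : MeasurableSet P) (hPe : P ⊆ e.source) :
    riemannianArea X P = 0 ↔ volume (e.target ∩ e.symm ⁻¹' P) = 0 := by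
  have hem : e ∈ IsManifold.maximalAtlas (𝓡 2) ∞ X := IsManifold.subset_maximalAtlas he
  have h := ae_restrict_chartArea_iff hem hP hPe (Q := fun _ => False)
  rwa [ae_iff, ae_iff, ← restrict_riemannianArea he hP hPe, not_false_eq_true, ofPred_true,
    ofPred_true, Measure.restrict_apply_univ, Measure.restrict_apply_univ] at h

/-! ### The area formula for Lipschitz maps between surfaces. -/

section AreaFormula

variable {X Y : Type*} [EMetricSpace X] [SecondCountableTopology X] [MeasurableSpace X]
  [BorelSpace X] [ChartedSpace Plane X]
  [IsManifold (𝓡 2) ∞ X] [RiemannianBundle (fun x : X => TangentSpace (𝓡 2) x)]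
  [IsContMDiffRiemannianBundle (𝓡 2) ∞ Plane (fun x : X => TangentSpace (𝓡 2) x)]
  [IsRiemannianManifold (𝓡 2) X]
  [EMetricSpace Y] [SecondCountableTopology Y] [MeasurableSpace Y] [BorelSpace Y]
  [ChartedSpace Plane Y]
  [IsManifold (𝓡 2) ∞ Y] [RiemannianBundle (fun y : Y => TangentSpace (𝓡 2) y)]
  [IsContMDiffRiemannianBundle (𝓡 2) ∞ Plane (fun y : Y => TangentSpace (𝓡 2) y)]
  [IsRiemannianManifold (𝓡 2) Y]
  {φ : X → Y} {M : Set X} {K : ℝ≥0}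

omit [SecondCountableTopology Y] [MeasurableSpace X] [BorelSpace X] [MeasurableSpace Y]
  [BorelSpace Y] in
theorem LipschitzOnWith.exists_seq_isLipschitzChartDomain (hφ : LipschitzOnWith K φ M)
    (hM : M.Nonempty) : ∃ (p : ℕ → X) (U : ℕ → Set X),
      (∀ n, IsLipschitzChartDomain φ M (p n) (U n)) ∧ M ⊆ ⋃ n, U n := by
  choose! U hpU hU using fun p (hp : p ∈ M) => hφ.exists_isLipschitzChartDomain hp
  obtain ⟨s, hsM, hs, hcov⟩ := TopologicalSpace.countable_cover_nhdsWithin (f := U) (s := M)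
    fun p hp => mem_nhdsWithin_of_mem_nhds ((hU p hp).isOpen.mem_nhds (hpU p hp))
  have hsne : s.Nonempty := by
    obtain ⟨x, hx⟩ := hM
    obtain ⟨y, hy, -⟩ := mem_iUnion₂.1 (hcov hx)
    exact ⟨y, hy⟩
  obtain ⟨p, rfl⟩ := hs.exists_eq_range hsne
  exact ⟨p, fun n => U (p n), fun n => hU _ (hsM (mem_range_self n)), by simpa using hcov⟩

omit [IsRiemannianManifold (𝓡 2) X] [IsRiemannianManifold (𝓡 2) Y] in
theorem IsLipschitzChartDomain.riemannianArea_image_eq_zero {p : X} {U : Set X}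
    (hU : IsLipschitzChartDomain φ M p U) {S : Set X} (hS : MeasurableSet S) (hSM : S ⊆ M ∩ U)
    (h0 : riemannianArea X S = 0) : riemannianArea Y (φ '' S) = 0 := by
  have hSc : S ⊆ (chartAt Plane p).source := hSM.trans (inter_subset_right.trans hU.subset_source)
  have hSc' : MapsTo φ S (chartAt Plane (φ p)).source := hU.mapsTo.mono_left hSM
  rw [riemannianArea_eq_zero_iff (chart_mem_atlas Plane p) hS hSc] at h0
  have h1 := hU.volume_image_eq_zero (S := (chartAt Plane p).target ∩ (chartAt Plane p).symm ⁻¹' S)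
    (inter_subset_inter_right _ (preimage_mono hSM)) h0
  obtain ⟨T, hT, hTm, hT0⟩ := exists_measurable_superset_of_null h1
  refine measure_mono_null (t := (chartAt Plane (φ p)).source ∩ chartAt Plane (φ p) ⁻¹' T) ?_ ?_
  · rw [image_eq_source_inter_preimage_image hSc hSc']
    exact inter_subset_inter_right _ (preimage_mono hT)
  · rw [riemannianArea_eq_zero_iff (chart_mem_atlas Plane (φ p))
      (measurableSet_source_inter_preimage _ hTm) inter_subset_left]
    refine measure_mono_null (fun z hz => ?_) hT0
    simpa [(chartAt Plane (φ p)).right_inv hz.1] using hz.2.2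

/-- Lusin's property (N), from the planar case on countably many chart domains. -/
theorem LipschitzOnWith.riemannianArea_image_eq_zero (hφ : LipschitzOnWith K φ M)
    (hM : MeasurableSet M) {S : Set X} (hSM : S ⊆ M) (h0 : riemannianArea X S = 0) :
    riemannianArea Y (φ '' S) = 0 := by
  rcases M.eq_empty_or_nonempty with rfl | hne
  · simp [subset_empty_iff.1 hSM]
  obtain ⟨p, U, hU, hcov⟩ := hφ.exists_seq_isLipschitzChartDomain hne
  obtain ⟨T, hT, hTm, hT0⟩ := exists_measurable_superset_of_null h0
  have hsub : φ '' S ⊆ ⋃ n, φ '' (T ∩ (M ∩ U n)) := by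
    rintro _ ⟨x, hx, rfl⟩
    obtain ⟨n, hn⟩ := mem_iUnion.1 (hcov (hSM hx))
    exact mem_iUnion.2 ⟨n, x, ⟨hT hx, hSM hx, hn⟩, rfl⟩
  refine measure_mono_null hsub (measure_iUnion_null fun n => ?_)
  exact (hU n).riemannianArea_image_eq_zero (hTm.inter (hM.inter (hU n).isOpen.measurableSet))
    inter_subset_right (measure_mono_null inter_subset_left hT0)

omit [SecondCountableTopology Y] [MeasurableSpace Y] [BorelSpace Y] in
theorem LipschitzOnWith.ae_hasMFDerivWithinAt (hφ : LipschitzOnWith K φ M)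
    (hM : MeasurableSet M) : ∀ᵐ x ∂(riemannianArea X).restrict M,
      HasMFDerivWithinAt (𝓡 2) (𝓡 2) φ M x (mfderivWithin (𝓡 2) (𝓡 2) φ M x) := by
  rcases M.eq_empty_or_nonempty with rfl | hne
  · simp
  obtain ⟨p, U, hU, hcov⟩ := hφ.exists_seq_isLipschitzChartDomain hne
  have hMU : (riemannianArea X).restrict M = (riemannianArea X).restrict (⋃ n, M ∩ U n) := by
    rw [← inter_iUnion, inter_eq_self_of_subset_left hcov]
  rw [hMU, ae_restrict_iUnion_iff]
  intro n
  rw [restrict_riemannianArea (chart_mem_atlas Plane (p n)) (hM.inter (hU n).isOpen.measurableSet)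
    (inter_subset_right.trans (hU n).subset_source)]
  exact (hU n).ae_hasMFDerivWithinAt hM

omit [SecondCountableTopology Y] [MeasurableSpace Y] [BorelSpace Y] in
theorem LipschitzOnWith.exists_null_forall_hasMFDerivWithinAt (hφ : LipschitzOnWith K φ M)
    (hM : MeasurableSet M) : ∃ Z, MeasurableSet Z ∧ riemannianArea X Z = 0 ∧ ∀ x ∈ M \ Z,
      HasMFDerivWithinAt (𝓡 2) (𝓡 2) φ M x (mfderivWithin (𝓡 2) (𝓡 2) φ M x) := by
  have h := hφ.ae_hasMFDerivWithinAt hM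
  rw [ae_restrict_iff' hM, ae_iff] at h
  obtain ⟨Z, hZ, hZm, hZ0⟩ := exists_measurable_superset_of_null h
  refine ⟨Z, hZm, hZ0, fun x hx => ?_⟩
  by_contra hcon
  exact hx.2 (hZ fun h => hcon (h hx.1))

omit [SecondCountableTopology Y] [MeasurableSpace Y] [BorelSpace Y] in
-- The local statement asks for a derivative at every point, so the null set of
-- non-differentiability is removed first.
theorem LipschitzOnWith.aemeasurable_singularValues (hφ : LipschitzOnWith K φ M)
    (hM : MeasurableSet M) :
    AEMeasurable (fun p => (mfderivWithin (𝓡 2) (𝓡 2) φ M p).toLinearMap.singularValues 0)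
      ((riemannianArea X).restrict M) ∧
    AEMeasurable (fun p => (mfderivWithin (𝓡 2) (𝓡 2) φ M p).toLinearMap.singularValues 1)
      ((riemannianArea X).restrict M) := by
  rcases M.eq_empty_or_nonempty with rfl | hne
  · simp
  obtain ⟨p, U, hU, hcov⟩ := hφ.exists_seq_isLipschitzChartDomain hne
  obtain ⟨Z, hZm, hZ0, hZ⟩ := hφ.exists_null_forall_hasMFDerivWithinAt hM
  have hMU : (riemannianArea X).restrict M = (riemannianArea X).restrict (⋃ n, M ∩ U n) := by
    rw [← inter_iUnion, inter_eq_self_of_subset_left hcov]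
  rw [hMU, aemeasurable_iUnion_iff, aemeasurable_iUnion_iff, ← forall_and]
  intro n
  have hP : MeasurableSet (M ∩ U n) := hM.inter (hU n).isOpen.measurableSet
  have hsub : (M ∩ U n) \ Z ⊆ M ∩ U n := sdiff_subset
  rw [← Measure.restrict_congr_set (sdiff_null_ae_eq_self (s := M ∩ U n) hZ0),
    restrict_riemannianArea (chart_mem_atlas Plane (p n)) (hP.diff hZm)
      (hsub.trans (inter_subset_right.trans (hU n).subset_source))]
  exact _root_.aemeasurable_singularValues (IsManifold.chart_mem_maximalAtlas _)
    (IsManifold.chart_mem_maximalAtlas (φ (p n))) (hP.diff hZm)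
    (hsub.trans (inter_subset_right.trans (hU n).subset_source)) ((hU n).mapsTo.mono_left hsub)
    fun x hx => (hZ x ⟨hx.1.1, hx.2⟩).mono (hsub.trans inter_subset_left)

theorem LipschitzOnWith.ae_absJacobian_eq_zero (hφ : LipschitzOnWith K φ M)
    (hM : MeasurableSet M) {B : Set Y} (hB : MeasurableSet B) (hB0 : riemannianArea Y B = 0) :
    ∀ᵐ x ∂(riemannianArea X).restrict M,
      φ x ∈ B → absJacobian (fun p => mfderivWithin (𝓡 2) (𝓡 2) φ M p) x = 0 := by
  rcases M.eq_empty_or_nonempty with rfl | hne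
  · simp
  obtain ⟨p, U, hU, hcov⟩ := hφ.exists_seq_isLipschitzChartDomain hne
  obtain ⟨Z, hZm, hZ0, hZ⟩ := hφ.exists_null_forall_hasMFDerivWithinAt hM
  have hMU : (riemannianArea X).restrict M = (riemannianArea X).restrict (⋃ n, M ∩ U n) := by
    rw [← inter_iUnion, inter_eq_self_of_subset_left hcov]
  rw [hMU, ae_restrict_iUnion_iff]
  intro n
  set c := chartAt Plane (p n)
  set c' := chartAt Plane (φ (p n))
  have hMUm : MeasurableSet (M ∩ U n) := hM.inter (hU n).isOpen.measurableSet
  have hsub : ((M ∩ U n) ∩ φ ⁻¹' B) \ Z ⊆ M ∩ U n := sdiff_subset.trans inter_subset_left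
  have hP : MeasurableSet (((M ∩ U n) ∩ φ ⁻¹' B) \ Z) :=
    ((hφ.continuousOn.mono inter_subset_left).measurableSet_inter_preimage hMUm hB).diff hZm
  have hPc : ((M ∩ U n) ∩ φ ⁻¹' B) \ Z ⊆ c.source :=
    hsub.trans (inter_subset_right.trans (hU n).subset_source)
  have hPc' : MapsTo φ (((M ∩ U n) ∩ φ ⁻¹' B) \ Z) c'.source := (hU n).mapsTo.mono_left hsub
  have hB' : riemannianArea Y (c'.source ∩ B) = 0 := measure_mono_null inter_subset_right hB0
  rw [riemannianArea_eq_zero_iff (chart_mem_atlas Plane _)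
    (c'.open_source.measurableSet.inter hB) inter_subset_left] at hB'
  have h1 := ae_absJacobian_eq_zero_of_chartArea_image
    (A := fun p => mfderivWithin (𝓡 2) (𝓡 2) φ M p)
    (IsManifold.chart_mem_maximalAtlas (p n)) (IsManifold.chart_mem_maximalAtlas (φ (p n))) hP
    hPc hPc' (fun x hx => (hZ x ⟨hx.1.1.1, hx.2⟩).mono (hsub.trans inter_subset_left))
    (measure_mono_null (by
      rintro _ ⟨y, hy, rfl⟩
      refine ⟨c'.map_source (hPc' hy.2), ?_⟩
      simp only [Function.comp, mem_preimage]
      rw [c'.left_inv (hPc' hy.2)]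
      exact ⟨hPc' hy.2, hy.2.1.2⟩) hB')
  rw [← restrict_riemannianArea (chart_mem_atlas Plane (p n)) hP hPc, ae_restrict_iff' hP] at h1
  rw [ae_restrict_iff' hMUm]
  filter_upwards [h1, measure_eq_zero_iff_ae_notMem.1 hZ0] with x hx hxZ hxM hxB
  exact hx ⟨⟨hxM, hxB⟩, hxZ⟩

/-- The area formula for a Lipschitz map which is injective almost everywhere. -/
theorem LipschitzOnWith.lintegral_absJacobian (hφ : LipschitzOnWith K φ M)
    (hM : MeasurableSet M)
    (hinj : ∀ᵐ q ∂riemannianArea Y, (M ∩ φ ⁻¹' {q}).Subsingleton) :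
    ∫⁻ x in M, ENNReal.ofReal (absJacobian (fun p => mfderivWithin (𝓡 2) (𝓡 2) φ M p) x)
      ∂riemannianArea X = riemannianArea Y (φ '' M) := by
  rcases M.eq_empty_or_nonempty with rfl | hne
  · simp
  obtain ⟨p, U, hU, hcov⟩ := hφ.exists_seq_isLipschitzChartDomain hne
  obtain ⟨Z, hZm, hZ0, hZ⟩ := hφ.exists_null_forall_hasMFDerivWithinAt hM
  -- `B` is null and contains every point with several preimages. After removing φ⁻¹(B) and Z from
  -- M, φ is injective and differentiable at every remaining point.
  obtain ⟨B, hB, hBm, hB0⟩ := exists_measurable_superset_of_null (ae_iff.1 hinj)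
  set J := fun x => ENNReal.ofReal (absJacobian (fun p => mfderivWithin (𝓡 2) (𝓡 2) φ M p) x)
  set G := (M \ (φ ⁻¹' B)) \ Z with hG
  have hGM : G ⊆ M := sdiff_subset.trans sdiff_subset
  have hGm : MeasurableSet G := by
    refine MeasurableSet.diff ?_ hZm
    exact hφ.continuousOn.measurableSet_inter_preimage hM hBm.compl
  have hGinj : InjOn φ G := fun x hx y hy hxy => by
    have h1 : (M ∩ φ ⁻¹' {φ x}).Subsingleton := by
      by_contra hcon
      exact hx.1.2 (hB hcon)
    exact h1 ⟨hx.1.1, rfl⟩ ⟨hy.1.1, hxy.symm⟩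
  set P := fun n => G ∩ disjointed U n with hP
  have hPm : ∀ n, MeasurableSet (P n) := fun n =>
    hGm.inter (MeasurableSet.disjointed (fun n => (hU n).isOpen.measurableSet) n)
  have hPU : ∀ n, P n ⊆ M ∩ U n := fun n => inter_subset_inter hGM (disjointed_subset U n)
  have hPc : ∀ n, P n ⊆ (chartAt Plane (p n)).source := fun n =>
    (hPU n).trans (inter_subset_right.trans (hU n).subset_source)
  have hPd : Pairwise (Function.onFun Disjoint P) := fun i j hij =>
    (disjoint_disjointed U hij).mono inter_subset_right inter_subset_right
  have hPG : ⋃ n, P n = G := by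
    rw [← inter_iUnion, iUnion_disjointed, inter_eq_self_of_subset_left (hGM.trans hcov)]
  have hlocal : ∀ n, MeasurableSet (φ '' P n) ∧
      ∫⁻ x in P n, J x ∂riemannianArea X = riemannianArea Y (φ '' P n) := by
    intro n
    have hd : ∀ x ∈ P n, HasMFDerivWithinAt (𝓡 2) (𝓡 2) φ (P n) x
        (mfderivWithin (𝓡 2) (𝓡 2) φ M x) := fun x hx =>
      (hZ x ⟨hx.1.1.1, hx.1.2⟩).mono (inter_subset_left.trans hGM)
    have hin : InjOn φ (P n) := hGinj.mono inter_subset_left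
    have hmaps : MapsTo φ (P n) (chartAt Plane (φ (p n))).source := (hU n).mapsTo.mono_left (hPU n)
    have hm := measurableSet_image_of_injOn
      (A := fun p => mfderivWithin (𝓡 2) (𝓡 2) φ M p) (IsManifold.chart_mem_maximalAtlas (p n))
      (IsManifold.chart_mem_maximalAtlas (φ (p n))) (hPm n) (hPc n) hmaps hd hin
    refine ⟨hm, ?_⟩
    rw [restrict_riemannianArea (chart_mem_atlas Plane (p n)) (hPm n) (hPc n),
      riemannianArea_apply_of_subset (chart_mem_atlas Plane (φ (p n))) hm hmaps.image_subset]
    exact setLIntegral_absJacobian_chartArea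
      (A := fun p => mfderivWithin (𝓡 2) (𝓡 2) φ M p) (IsManifold.chart_mem_maximalAtlas (p n))
      (IsManifold.chart_mem_maximalAtlas (φ (p n))) (hPm n) (hPc n) hmaps hd hin
  have h1 : ∫⁻ x in G, J x ∂riemannianArea X = riemannianArea Y (φ '' G) := by
    rw [← hPG, image_iUnion, lintegral_iUnion hPm hPd,
      measure_iUnion (fun i j hij => ?_) fun n => (hlocal n).1]
    · exact tsum_congr fun n => (hlocal n).2
    · rw [Function.onFun, disjoint_left]
      rintro _ ⟨x, hx, rfl⟩ ⟨y, hy, hxy⟩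
      rw [hGinj hy.1 hx.1 hxy] at hy
      exact disjoint_left.1 (hPd hij) hx hy
  -- The removed part contributes nothing to the integral: the Jacobian vanishes almost everywhere
  -- on φ⁻¹(B), and Z is null.
  have h2 : ∫⁻ x in M, J x ∂riemannianArea X = ∫⁻ x in G, J x ∂riemannianArea X := by
    rw [← lintegral_indicator hM, ← lintegral_indicator hGm]
    refine lintegral_congr_ae ?_
    have h3 := (ae_restrict_iff' hM).1 (hφ.ae_absJacobian_eq_zero hM hBm hB0)
    filter_upwards [h3, measure_eq_zero_iff_ae_notMem.1 hZ0] with x hx hxZ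
    by_cases hxM : x ∈ M
    · by_cases hxB : φ x ∈ B
      · have : x ∉ G := fun h => h.1.2 hxB
        simp [indicator, hxM, this, J, hx hxM hxB]
      · have : x ∈ G := ⟨⟨hxM, hxB⟩, hxZ⟩
        simp [indicator, hxM, this]
    · have : x ∉ G := fun h => hxM (hGM h)
      simp [indicator, hxM, this]
  rw [h2, h1]
  refine le_antisymm (measure_mono (image_mono hGM)) ?_
  -- Nor does it contribute to the image: B is null, and so is φ(M ∩ Z) by Lusin's property.
  have h3 : φ '' M ⊆ φ '' G ∪ (B ∪ φ '' (M ∩ Z)) := by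
    rintro _ ⟨x, hx, rfl⟩
    by_cases hxB : φ x ∈ B
    · exact Or.inr (Or.inl hxB)
    · by_cases hxZ : x ∈ Z
      · exact Or.inr (Or.inr ⟨x, ⟨hx, hxZ⟩, rfl⟩)
      · exact Or.inl ⟨x, ⟨⟨hx, hxB⟩, hxZ⟩, rfl⟩
  have h4 : riemannianArea Y (B ∪ φ '' (M ∩ Z)) = 0 := measure_union_null hB0
    (hφ.riemannianArea_image_eq_zero hM inter_subset_left
      (measure_mono_null inter_subset_right hZ0))
  calc riemannianArea Y (φ '' M) ≤ riemannianArea Y (φ '' G ∪ (B ∪ φ '' (M ∩ Z))) := measure_mono h3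
    _ ≤ riemannianArea Y (φ '' G) + riemannianArea Y (B ∪ φ '' (M ∩ Z)) := measure_union_le _ _
    _ = riemannianArea Y (φ '' G) := by rw [h4, add_zero]

end AreaFormula

theorem IsCostFunction.measurable_extendedCost {f : ℝ → ℝ} (hf : IsCostFunction f) :
    Measurable (extendedCost f) := by
  classical
  have h : extendedCost f = (Ioi (0 : ℝ)).piecewise (fun x => ENNReal.ofReal (f x))
      (fun _ => ⨆ y ∈ Ioc (0 : ℝ) 1, ENNReal.ofReal (f y)) := by
    ext x
    simp [extendedCost, piecewise]
  rw [h]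
  exact (ENNReal.continuous_ofReal.comp_continuousOn hf.continuousOn).measurable_piecewise
    continuousOn_const measurableSet_Ioi

/-! ### Integration of the support inequality. -/

section StrictSupport

/-- At `(r, r)` the function `f x + f y` is strictly supported from below by a multiple of
`x y`. -/
def IsStrictlySupportedAt (f : ℝ → ℝ) (r c : ℝ) : Prop :=
  ∀ x y, 0 ≤ x → 0 ≤ y → ¬(x = r ∧ y = r) →
    ENNReal.ofReal (2 * f r + c * r ^ 2) <
      extendedCost f x + extendedCost f y + ENNReal.ofReal (c * (x * y))

variable {f : ℝ → ℝ} {r c : ℝ}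

theorem IsStrictlySupportedAt.le (hf : IsCostFunction f) (hr : 0 < r) (hc : 0 ≤ c)
    (h : IsStrictlySupportedAt f r c) {x y : ℝ} (hx : 0 ≤ x) (hy : 0 ≤ y) :
    ENNReal.ofReal (2 * f r + c * r ^ 2) ≤
      extendedCost f x + extendedCost f y + ENNReal.ofReal (c * (x * y)) := by
  by_cases hxy : x = r ∧ y = r
  · have h0 := hf.nonneg r hr
    rw [hxy.1, hxy.2, extendedCost_of_pos f hr, ← ENNReal.ofReal_add h0 h0,
      ← ENNReal.ofReal_add (by positivity) (by positivity)]
    exact ENNReal.ofReal_le_ofReal (by nlinarith)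
  · exact (h x y hx hy hxy).le

/-- For x y = r² the product terms on both sides cancel. -/
theorem IsStrictlySupportedAt.auxF_eq (hf : IsCostFunction f) (hr : 0 < r) (hc : 0 ≤ c)
    (h : IsStrictlySupportedAt f r c) : auxF f (r ^ 2) = 2 * f r := by
  refine IsLeast.csInf_eq ⟨⟨r, r, hr, hr, by ring, by ring⟩, ?_⟩
  rintro _ ⟨x, y, hx, hy, hxy, rfl⟩
  have h1 := h.le hf hr hc hx.le hy.le
  have hfx := hf.nonneg x hx
  have hfy := hf.nonneg y hy
  rw [hxy, extendedCost_of_pos f hx, extendedCost_of_pos f hy, ← ENNReal.ofReal_add hfx hfy,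
    ← ENNReal.ofReal_add (by positivity) (by positivity),
    ENNReal.ofReal_le_ofReal_iff (by positivity)] at h1
  linarith

variable {Ω : Type*} [MeasurableSpace Ω] {ν : Measure Ω} [IsFiniteMeasure ν] {σ τ : Ω → ℝ}

omit [IsFiniteMeasure ν] in
-- The two halves of the calibration: the pointwise inequality, and the bound on the integral of σ τ
-- multiplied by c ≥ 0. They are kept apart because the equality case uses the second by itself.
theorem IsStrictlySupportedAt.mul_measure_add_le (hf : IsCostFunction f) (hr : 0 < r) (hc : 0 ≤ c)
    (h : IsStrictlySupportedAt f r c) (hσ : AEMeasurable σ ν) (hτ : AEMeasurable τ ν)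
    (hσ0 : ∀ x, 0 ≤ σ x) (hτ0 : ∀ x, 0 ≤ τ x)
    (hJ : ∫⁻ x, ENNReal.ofReal (σ x * τ x) ∂ν ≤ ENNReal.ofReal (r ^ 2) * ν univ) :
    ∫⁻ _, ENNReal.ofReal (2 * f r + c * r ^ 2) ∂ν ≤ ∫⁻ x, (extendedCost f (σ x) +
      extendedCost f (τ x) + ENNReal.ofReal (c * (σ x * τ x))) ∂ν ∧
    ∫⁻ x, (extendedCost f (σ x) + extendedCost f (τ x) + ENNReal.ofReal (c * (σ x * τ x))) ∂ν ≤
      ∫⁻ x, (extendedCost f (σ x) + extendedCost f (τ x)) ∂ν +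
        ENNReal.ofReal (c * r ^ 2) * ν univ := by
  refine ⟨lintegral_mono fun x => h.le hf hr hc (hσ0 x) (hτ0 x), ?_⟩
  have hm : AEMeasurable (fun x => extendedCost f (σ x) + extendedCost f (τ x)) ν :=
    (hf.measurable_extendedCost.comp_aemeasurable hσ).add
      (hf.measurable_extendedCost.comp_aemeasurable hτ)
  rw [lintegral_add_left' hm]
  gcongr
  simp_rw [ENNReal.ofReal_mul hc]
  rw [lintegral_const_mul' _ _ ENNReal.ofReal_ne_top, mul_assoc]
  gcongr

/-- The common term c r² ν(Ω) is finite, so it cancels even when the energy is infinite. -/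
theorem IsStrictlySupportedAt.mul_measure_le (hf : IsCostFunction f) (hr : 0 < r) (hc : 0 ≤ c)
    (h : IsStrictlySupportedAt f r c) (hσ : AEMeasurable σ ν) (hτ : AEMeasurable τ ν)
    (hσ0 : ∀ x, 0 ≤ σ x) (hτ0 : ∀ x, 0 ≤ τ x)
    (hJ : ∫⁻ x, ENNReal.ofReal (σ x * τ x) ∂ν ≤ ENNReal.ofReal (r ^ 2) * ν univ) :
    ENNReal.ofReal (2 * f r) * ν univ ≤ ∫⁻ x, (extendedCost f (σ x) + extendedCost f (τ x)) ∂ν := by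
  obtain ⟨h1, h2⟩ := h.mul_measure_add_le hf hr hc hσ hτ hσ0 hτ0 hJ
  have h3 := h1.trans h2
  have hfr := hf.nonneg r hr
  rw [lintegral_const, ENNReal.ofReal_add (by positivity) (by positivity), add_mul] at h3
  exact (ENNReal.add_le_add_iff_right
    (ENNReal.mul_ne_top ENNReal.ofReal_ne_top (measure_ne_top ν univ))).1 h3

/-- Equal integrals make the support inequality an equality almost everywhere, which strictness
allows only at (r, r). -/
theorem IsStrictlySupportedAt.ae_eq (hf : IsCostFunction f) (hr : 0 < r) (hc : 0 ≤ c)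
    (h : IsStrictlySupportedAt f r c) (hσ : AEMeasurable σ ν) (hτ : AEMeasurable τ ν)
    (hσ0 : ∀ x, 0 ≤ σ x) (hτ0 : ∀ x, 0 ≤ τ x)
    (hJ : ∫⁻ x, ENNReal.ofReal (σ x * τ x) ∂ν ≤ ENNReal.ofReal (r ^ 2) * ν univ)
    (heq : ∫⁻ x, (extendedCost f (σ x) + extendedCost f (τ x)) ∂ν =
      ENNReal.ofReal (2 * f r) * ν univ) :
    ∀ᵐ x ∂ν, σ x = r ∧ τ x = r := by
  obtain ⟨-, h2⟩ := h.mul_measure_add_le hf hr hc hσ hτ hσ0 hτ0 hJ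
  have hfr := hf.nonneg r hr
  rw [heq, ← add_mul, ← ENNReal.ofReal_add (by positivity) (by positivity),
    ← lintegral_const] at h2
  have h3 := ae_eq_of_ae_le_of_lintegral_le
    (ae_of_all ν fun x => h.le hf hr hc (hσ0 x) (hτ0 x))
    (by
      rw [lintegral_const]
      exact ENNReal.mul_ne_top ENNReal.ofReal_ne_top (measure_ne_top ν univ))
    (((hf.measurable_extendedCost.comp_aemeasurable hσ).add
      (hf.measurable_extendedCost.comp_aemeasurable hτ)).add
      ((hσ.mul hτ).const_mul c).ennreal_ofReal) h2
  filter_upwards [h3] with x hx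
  by_contra hcon
  exact (h _ _ (hσ0 x) (hτ0 x) hcon).ne hx

end StrictSupport

/-! ### Compact Lipschitz surfaces and the energy bound. -/

section Surfaces

/-- At a boundary point, moving vertically in the chart leads at once into the open region strictly
above the graph. -/
theorem IsCompactLipschitzSurface.subset_closure_interior {X : Type*} [TopologicalSpace X]
    [T2Space X] [ChartedSpace Plane X] {M : Set X} (hM : IsCompactLipschitzSurface M) :
    M ⊆ closure (interior M) := by
  intro p hp
  by_cases hpi : p ∈ interior M
  · exact subset_closure hpi
  obtain ⟨e, -, hpe, γ, K, hγ, hMe⟩ := hM.lipschitz_boundary p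
    ⟨subset_closure hp, hpi⟩
  have hlim : Tendsto (fun t : ℝ => e.symm (e p + t • planeVec 1)) (𝓝[>] 0) (𝓝 p) := by
    have h1 : ContinuousAt e.symm (e p + (0 : ℝ) • planeVec 1) := by
      rw [zero_smul, add_zero]
      exact e.symm.continuousAt (e.map_source hpe)
    have h2 : ContinuousAt (fun t : ℝ => e p + t • planeVec 1) 0 := by fun_prop
    have h3 : ContinuousAt (fun t : ℝ => e.symm (e p + t • planeVec 1)) 0 :=
      ContinuousAt.comp (f := fun t : ℝ => e p + t • planeVec 1) h1 h2
    have h4 := h3.tendsto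
    simp only [zero_smul, add_zero, e.left_inv hpe] at h4
    exact h4.mono_left nhdsWithin_le_nhds
  have htar : ∀ᶠ t : ℝ in 𝓝[>] 0, e p + t • planeVec 1 ∈ e.target := by
    have h2 : ContinuousAt (fun t : ℝ => e p + t • planeVec 1) 0 := by fun_prop
    refine (h2.eventually_mem ?_).filter_mono nhdsWithin_le_nhds
    simpa using e.open_target.mem_nhds (e.map_source hpe)
  have hO : IsOpen (e.source ∩ e ⁻¹' {y | γ (y 0) < y 1}) := by
    refine e.isOpen_inter_preimage (isOpen_lt ?_ ?_)
    · exact hγ.continuous.comp (by fun_prop)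
    · fun_prop
  refine mem_closure_of_tendsto hlim ?_
  filter_upwards [htar, self_mem_nhdsWithin] with t ht ht0
  refine mem_interior.2 ⟨_, fun x hx => (hMe x hx.1).2 (le_of_lt hx.2), hO, e.map_target ht, ?_⟩
  have h1 := (hMe p hpe).1 hp
  have ht0 : 0 < t := ht0
  simp only [mem_preimage, mem_ofPred_eq, e.right_inv ht]
  simp only [planeVec, EuclideanSpace.basisFun_apply, PiLp.add_apply, PiLp.smul_apply,
    PiLp.single_apply]
  simp
  linarith

variable {X Y : Type*} [EMetricSpace X] [SecondCountableTopology X] [MeasurableSpace X]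
  [BorelSpace X] [ChartedSpace Plane X]
  [IsManifold (𝓡 2) ∞ X] [RiemannianBundle (fun x : X => TangentSpace (𝓡 2) x)]
  [IsContMDiffRiemannianBundle (𝓡 2) ∞ Plane (fun x : X => TangentSpace (𝓡 2) x)]
  [EMetricSpace Y] [SecondCountableTopology Y] [MeasurableSpace Y] [BorelSpace Y]
  [ChartedSpace Plane Y]
  [IsManifold (𝓡 2) ∞ Y] [RiemannianBundle (fun y : Y => TangentSpace (𝓡 2) y)]
  [IsContMDiffRiemannianBundle (𝓡 2) ∞ Plane (fun y : Y => TangentSpace (𝓡 2) y)]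
  {φ : X → Y} {M : Set X} {N : Set Y} {oX : SurfaceOrientation X} {oY : SurfaceOrientation Y}
  {f : ℝ → ℝ} {r c : ℝ}

/-- A point of M outside C would yield a non-empty open subset of the interior of M that misses C,
and this has positive area. Applied to images, it turns full area into surjectivity. -/
theorem IsCompactLipschitzSurface.eq_of_subset (hM : IsCompactLipschitzSurface M) {C : Set X}
    (hC : IsClosed C) (hCM : C ⊆ M) (h : riemannianArea X M ≤ riemannianArea X C) : C = M := by
  refine hCM.antisymm fun q hq => ?_
  by_contra hqC
  obtain ⟨x, hxC, hx⟩ := mem_closure_iff.1 (hM.subset_closure_interior hq) Cᶜ hC.isOpen_compl hqC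
  have h0 : riemannianArea X (M \ C) = 0 := by
    rw [measure_sdiff hCM hC.measurableSet.nullMeasurableSet
      ((measure_mono hCM).trans_lt hM.isCompact.measure_lt_top).ne]
    exact tsub_eq_zero_of_le h
  have hsub : Cᶜ ∩ interior M ⊆ M \ C := fun y hy => ⟨interior_subset hy.2, hy.1⟩
  have h1 : riemannianArea X (Cᶜ ∩ interior M) = 0 := measure_mono_null hsub h0
  exact ((hC.isOpen_compl.inter isOpen_interior).measure_pos (riemannianArea X) ⟨x, hxC, hx⟩).ne' h1

omit [SecondCountableTopology X] [IsManifold (𝓡 2) ∞ X]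
  [RiemannianBundle (fun x : X => TangentSpace (𝓡 2) x)]
  [IsContMDiffRiemannianBundle (𝓡 2) ∞ Plane (fun x : X => TangentSpace (𝓡 2) x)] in
theorem IsCompactLipschitzSurface.measurableSet (hM : IsCompactLipschitzSurface M) :
    MeasurableSet M :=
  hM.isCompact.isClosed.measurableSet

omit [SecondCountableTopology X] [MeasurableSpace X] [BorelSpace X] [IsManifold (𝓡 2) ∞ X]
  [IsContMDiffRiemannianBundle (𝓡 2) ∞ Plane (fun x : X => TangentSpace (𝓡 2) x)]
  [SecondCountableTopology Y] [MeasurableSpace Y] [BorelSpace Y] [IsManifold (𝓡 2) ∞ Y]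
  [IsContMDiffRiemannianBundle (𝓡 2) ∞ Plane (fun y : Y => TangentSpace (𝓡 2) y)] in
theorem scalesMetricAt_iff {p : X} (hc : 0 ≤ c) :
    ScalesMetricAt c M φ p ↔ (differential φ M p).singularValues 0 = c ∧
      (differential φ M p).singularValues 1 = c :=
  forall_inner_eq_iff_singularValues Fact.out _ hc

omit [SecondCountableTopology X] [BorelSpace X] [IsManifold (𝓡 2) ∞ X]
  [IsContMDiffRiemannianBundle (𝓡 2) ∞ Plane (fun x : X => TangentSpace (𝓡 2) x)]
  [SecondCountableTopology Y] [MeasurableSpace Y] [BorelSpace Y] [IsManifold (𝓡 2) ∞ Y]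
  [IsContMDiffRiemannianBundle (𝓡 2) ∞ Plane (fun y : Y => TangentSpace (𝓡 2) y)] in
theorem energy_eq_of_ae_scalesMetricAt (hM : riemannianArea X M ≠ 0)
    (hM' : riemannianArea X M ≠ ⊤) (hf : IsCostFunction f) (hc : 0 < c)
    (h : ∀ᵐ p ∂(riemannianArea X).restrict M, ScalesMetricAt c M φ p) :
    energy f M φ = ENNReal.ofReal (2 * f c) := by
  have h1 : ∫⁻ p in M, (extendedCost f ((differential φ M p).singularValues 0) +
      extendedCost f ((differential φ M p).singularValues 1)) ∂(riemannianArea X) =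
      ∫⁻ _ in M, ENNReal.ofReal (2 * f c) ∂(riemannianArea X) := by
    refine lintegral_congr_ae ?_
    filter_upwards [h] with p hp
    rw [((scalesMetricAt_iff hc.le).1 hp).1, ((scalesMetricAt_iff hc.le).1 hp).2,
      extendedCost_of_pos f hc, ← ENNReal.ofReal_add (hf.nonneg c hc) (hf.nonneg c hc), two_mul]
  rw [energy, h1, setLIntegral_const, ENNReal.mul_div_cancel_right hM hM']

variable [IsRiemannianManifold (𝓡 2) X] [IsRiemannianManifold (𝓡 2) Y]

omit [SecondCountableTopology X] [BorelSpace X] [IsManifold (𝓡 2) ∞ X]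
  [IsContMDiffRiemannianBundle (𝓡 2) ∞ Plane (fun x : X => TangentSpace (𝓡 2) x)]
  [SecondCountableTopology Y] [BorelSpace Y] [IsManifold (𝓡 2) ∞ Y]
  [IsContMDiffRiemannianBundle (𝓡 2) ∞ Plane (fun y : Y => TangentSpace (𝓡 2) y)]
  [IsRiemannianManifold (𝓡 2) X] [IsRiemannianManifold (𝓡 2) Y] in
theorem IsLipPlusInj.isCompact_image (hφ : IsLipPlusInj oX oY M N φ) (hM : IsCompact M) :
    IsCompact (φ '' M) :=
  hM.image_of_continuousOn hφ.lipschitz.choose_spec.continuousOn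

/-- The area formula; points outside N have no preimage in M, so injectivity holds almost everywhere
on Y. -/
theorem IsLipPlusInj.lintegral_singularValues_mul (hφ : IsLipPlusInj oX oY M N φ)
    (hM : MeasurableSet M) (hN : MeasurableSet N) :
    ∫⁻ p in M, ENNReal.ofReal ((differential φ M p).singularValues 0 *
      (differential φ M p).singularValues 1) ∂riemannianArea X = riemannianArea Y (φ '' M) := by
  obtain ⟨K, hK⟩ := hφ.lipschitz
  refine hK.lintegral_absJacobian hM ?_
  filter_upwards [(ae_restrict_iff' hN).1 hφ.ae_injective] with q hq
  by_cases hqN : q ∈ N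
  · exact hq hqN
  · rintro x ⟨hx, rfl⟩
    exact absurd (hφ.mapsTo hx) hqN

theorem IsLipPlusInj.riemannianArea_image_eq (hφ : IsLipPlusInj oX oY M N φ)
    (hM : MeasurableSet M) (hN : MeasurableSet N) (hc : 0 ≤ c)
    (h : ∀ᵐ p ∂(riemannianArea X).restrict M, ScalesMetricAt c M φ p) :
    riemannianArea Y (φ '' M) = ENNReal.ofReal (c ^ 2) * riemannianArea X M := by
  rw [← hφ.lintegral_singularValues_mul hM hN, ← setLIntegral_const]
  refine lintegral_congr_ae ?_
  filter_upwards [h] with p hp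
  rw [((scalesMetricAt_iff hc).1 hp).1, ((scalesMetricAt_iff hc).1 hp).2, sq]

/-- The calibration for the area measure on M, with the singular values as σ and τ and the area
formula for the constraint. -/
theorem IsLipPlusInj.le_energy (hφ : IsLipPlusInj oX oY M N φ) (hM : MeasurableSet M)
    (hN : MeasurableSet N) (hM0 : riemannianArea X M ≠ 0) (hM' : riemannianArea X M ≠ ⊤)
    (hf : IsCostFunction f) (hr : 0 < r) (hc : 0 ≤ c) (h : IsStrictlySupportedAt f r c)
    (hle : riemannianArea Y (φ '' M) ≤ ENNReal.ofReal (r ^ 2) * riemannianArea X M) :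
    ENNReal.ofReal (2 * f r) ≤ energy f M φ ∧ (energy f M φ = ENNReal.ofReal (2 * f r) →
      ∀ᵐ p ∂(riemannianArea X).restrict M, ScalesMetricAt r M φ p) := by
  obtain ⟨K, hK⟩ := hφ.lipschitz
  have : IsFiniteMeasure ((riemannianArea X).restrict M) := ⟨by
    rw [Measure.restrict_apply_univ]
    exact hM'.lt_top⟩
  obtain ⟨h0, h1⟩ := hK.aemeasurable_singularValues hM
  have hu : ((riemannianArea X).restrict M) univ = riemannianArea X M :=
    Measure.restrict_apply_univ M
  have hJ : ∫⁻ p in M, ENNReal.ofReal ((differential φ M p).singularValues 0 *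
      (differential φ M p).singularValues 1) ∂riemannianArea X ≤
      ENNReal.ofReal (r ^ 2) * ((riemannianArea X).restrict M) univ := by
    rw [hφ.lintegral_singularValues_mul hM hN, hu]
    exact hle
  have hn0 : ∀ p, 0 ≤ (differential φ M p).singularValues 0 := fun p =>
    (differential φ M p).singularValues_nonneg 0
  have hn1 : ∀ p, 0 ≤ (differential φ M p).singularValues 1 := fun p =>
    (differential φ M p).singularValues_nonneg 1
  constructor
  · rw [energy, ENNReal.le_div_iff_mul_le (Or.inl hM0) (Or.inl hM')]
    have := h.mul_measure_le hf hr hc h0 h1 hn0 hn1 hJ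
    rwa [hu] at this
  · intro heq
    rw [energy, eq_comm, ENNReal.eq_div_iff hM0 hM', mul_comm, eq_comm, ← hu] at heq
    filter_upwards [h.ae_eq hf hr hc h0 h1 hn0 hn1 hJ heq] with p hp
    exact (scalesMetricAt_iff hr.le).2 hp

end Surfaces

/-! ### From locally Lipschitz to Lipschitz. -/

section LocalToGlobal

variable {X Y : Type*} [EMetricSpace X] [EMetricSpace Y] {φ : X → Y} {M : Set X}

/-- The ball of radius ⊤ is both open and closed. -/
theorem IsPreconnected.edist_ne_top (hM : IsPreconnected M) {x y : X} (hx : x ∈ M) (hy : y ∈ M) :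
    edist x y ≠ ⊤ := by
  have h := hM.subset_isClopen (t := Metric.eball y ⊤)
    ⟨Metric.isClosed_eball_top, Metric.isOpen_eball⟩ ⟨y, hy, by simp⟩
  exact (h hx).ne

/-- Connectedness makes all distances in M and φ(M) finite. Both are thus metric spaces, where
compactness globalises the local constants. -/
theorem LocallyLipschitzOn.exists_lipschitzOnWith_of_isPreconnected (hφ : LocallyLipschitzOn M φ)
    (hM : IsCompact M) (hMc : IsPreconnected M) : ∃ K, LipschitzOnWith K φ M := by
  have hX : ∀ x y : M, edist x y ≠ ⊤ := fun x y => hMc.edist_ne_top x.2 y.2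
  have hY : ∀ x y : φ '' M, edist x y ≠ ⊤ := fun x y =>
    (hMc.image φ hφ.continuousOn).edist_ne_top x.2 y.2
  let _ : MetricSpace M := EMetricSpace.toMetricSpace hX
  let _ : MetricSpace (φ '' M) := EMetricSpace.toMetricSpace hY
  have : CompactSpace M := isCompact_iff_compactSpace.1 hM
  have hloc : LocallyLipschitzOn univ (fun x : M => (⟨φ x, mem_image_of_mem φ x.2⟩ : φ '' M)) := by
    intro x _
    obtain ⟨K, t, ht, hK⟩ := hφ x.2
    refine ⟨K, Subtype.val ⁻¹' t, ?_, fun y hy z hz => hK hy hz⟩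
    rw [nhdsWithin_univ]
    exact preimage_coe_mem_nhds_subtype.2 ht
  obtain ⟨K, hK⟩ := hloc.exists_lipschitzOnWith_of_compact isCompact_univ
  exact ⟨K, fun x hx y hy => hK (mem_univ ⟨x, hx⟩) (mem_univ ⟨y, hy⟩)⟩

end LocalToGlobal

theorem add_smul_planeVec_one_zero (y : Plane) (t : ℝ) : (y + t • planeVec 1) 0 = y 0 := by
  simp [planeVec]

theorem add_smul_planeVec_one_one (y : Plane) (t : ℝ) : (y + t • planeVec 1) 1 = y 1 + t := by
  simp [planeVec]

theorem norm_smul_planeVec (t : ℝ) (i : Fin 2) : ‖t • planeVec i‖ = |t| := by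
  simp [planeVec, norm_smul]

/-- A `C¹` map on the region above the graph of a Lipschitz function is locally Lipschitz: points
are joined by a path in the region that goes up, across and down. -/
theorem ContDiffWithinAt.exists_lipschitzOnWith_epigraph {γ : ℝ → ℝ} {K : ℝ≥0}
    (hγ : LipschitzWith K γ) {g : Plane → Plane} {x : Plane} (hx : γ (x 0) ≤ x 1)
    (hg : ContDiffWithinAt ℝ 1 g {y | γ (y 0) ≤ y 1} x) :
    ∃ L, ∃ V ∈ 𝓝[{y | γ (y 0) ≤ y 1}] x, LipschitzOnWith L g V := by
  set S : Set Plane := {y | γ (y 0) ≤ y 1} with hS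
  have hxS : x ∈ S := hx
  have hg' : ContDiffWithinAt ℝ (0 + 1) g S x := by simpa using hg
  obtain ⟨u, hu, -, f', hf', hcont⟩ :=
    (contDiffWithinAt_succ_iff_hasFDerivWithinAt (by simp)).1 hg'
  rw [insert_eq_of_mem hxS] at hu
  have hbd : ∀ᶠ y in 𝓝[S] x, y ∈ u ∧ ‖f' y‖ < ‖f' x‖ + 1 := by
    have h1 : ∀ᶠ y in 𝓝[u] x, ‖f' y‖ < ‖f' x‖ + 1 :=
      hcont.continuousWithinAt.norm.eventually_lt_const (lt_add_one _)
    have h2 : 𝓝[S] x ≤ 𝓝[u] x := nhdsWithin_le_iff.2 hu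
    exact Eventually.and hu (h2 h1)
  obtain ⟨ε, hε, hball⟩ := Metric.mem_nhdsWithin_iff.1 hbd
  set C := ‖f' x‖ + 1 with hC
  have hC0 : 0 ≤ C := by positivity
  have hsegm : ∀ y z : Plane, segment ℝ y z ⊆ S → y ∈ Metric.ball x ε → z ∈ Metric.ball x ε →
      ‖g z - g y‖ ≤ C * ‖z - y‖ := by
    intro y z hyz hy hz
    have hsub : segment ℝ y z ⊆ Metric.ball x ε ∩ S :=
      subset_inter ((convex_ball x ε).segment_subset hy hz) hyz
    exact (convex_segment y z).norm_image_sub_le_of_norm_hasFDerivWithin_le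
      (fun w hw => (hf' w (hball (hsub hw)).1).mono fun v hv => (hball (hsub hv)).1)
      (fun w hw => (hball (hsub hw)).2.le) (left_mem_segment ℝ y z) (right_mem_segment ℝ y z)
  have hup : ∀ y ∈ S, ∀ t : ℝ, 0 ≤ t → segment ℝ y (y + t • planeVec 1) ⊆ S := by
    intro y hy t ht
    rw [segment_eq_image']
    rintro _ ⟨θ, hθ, rfl⟩
    have h1 : y + θ • (y + t • planeVec 1 - y) = y + (θ * t) • planeVec 1 := by
      rw [add_sub_cancel_left, smul_smul]
    have h2 : γ (y 0) ≤ y 1 := hy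
    simp only [hS, mem_ofPred_eq, h1, add_smul_planeVec_one_zero, add_smul_planeVec_one_one]
    nlinarith [mul_nonneg hθ.1 ht]
  -- Two points of the δ-ball are at most 2 δ apart, so going up by (1 + K) times their distance
  -- stays within δ + (1 + K) · 2 δ = ε of x.
  set δ := ε / (3 + 2 * K) with hδ
  have hK0 : (0 : ℝ) ≤ K := K.2
  have hδ0 : 0 < δ := by positivity
  have hδε : (3 + 2 * K) * δ = ε := by
    rw [hδ]
    field_simp
  -- The three legs of the path have lengths at most 1 + K, 3 + 2 K and 1 + K times the distance of
  -- the endpoints.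
  refine ⟨Real.toNNReal (C * (5 + 4 * K)), Metric.ball x δ ∩ S,
    inter_comm S _ ▸ inter_mem_nhdsWithin S (Metric.ball_mem_nhds x hδ0), ?_⟩
  refine LipschitzOnWith.of_dist_le_mul fun y hy z hz => ?_
  rw [Real.coe_toNNReal _ (by positivity), dist_eq_norm, dist_eq_norm]
  have hyS : γ (y 0) ≤ y 1 := hy.2
  have hzS : γ (z 0) ≤ z 1 := hz.2
  have h0 : |y 0 - z 0| ≤ ‖y - z‖ := by simpa using PiLp.norm_apply_le (y - z) 0
  have h1 : |y 1 - z 1| ≤ ‖y - z‖ := by simpa using PiLp.norm_apply_le (y - z) 1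
  -- The height of the horizontal leg: γ rises by at most K |y 0 - z 0| along it, so the leg stays
  -- above the graph.
  set h := max (y 1) (z 1) + K * |y 0 - z 0| with hh
  have hKn : (K : ℝ) * |y 0 - z 0| ≤ K * ‖y - z‖ := by gcongr
  have hKn0 : 0 ≤ (K : ℝ) * |y 0 - z 0| := by positivity
  have hay : 0 ≤ h - y 1 := by linarith [le_max_left (y 1) (z 1)]
  have haz : 0 ≤ h - z 1 := by linarith [le_max_right (y 1) (z 1)]
  have hby : h - y 1 ≤ (1 + K) * ‖y - z‖ := by
    rcases max_cases (y 1) (z 1) with hm | hm <;>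
      nlinarith [neg_abs_le (y 1 - z 1), norm_nonneg (y - z)]
  have hbz : h - z 1 ≤ (1 + K) * ‖y - z‖ := by
    rcases max_cases (y 1) (z 1) with hm | hm <;>
      nlinarith [le_abs_self (y 1 - z 1), norm_nonneg (y - z)]
  set y' := y + (h - y 1) • planeVec 1 with hy'
  set z' := z + (h - z 1) • planeVec 1 with hz'
  have hny : ‖y' - y‖ ≤ (1 + K) * ‖y - z‖ := by
    rw [hy', add_sub_cancel_left, norm_smul_planeVec, abs_of_nonneg hay]
    exact hby
  have hnz : ‖z' - z‖ ≤ (1 + K) * ‖y - z‖ := by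
    rw [hz', add_sub_cancel_left, norm_smul_planeVec, abs_of_nonneg haz]
    exact hbz
  have hyx : ‖y - x‖ < δ := mem_ball_iff_norm.1 hy.1
  have hzx : ‖z - x‖ < δ := mem_ball_iff_norm.1 hz.1
  have hyz : ‖y - z‖ ≤ 2 * δ := by
    have := norm_sub_le_norm_sub_add_norm_sub y x z
    rw [norm_sub_rev x z] at this
    linarith
  have hyzK : (1 + K) * ‖y - z‖ ≤ (1 + K) * (2 * δ) := by gcongr
  have hmem : ∀ w w' : Plane, ‖w - x‖ < δ → ‖w' - w‖ ≤ (1 + K) * ‖y - z‖ →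
      w' ∈ Metric.ball x ε := by
    intro w w' hw hw'
    rw [mem_ball_iff_norm, ← hδε]
    have := norm_sub_le_norm_sub_add_norm_sub w' w x
    nlinarith
  have hyb : y ∈ Metric.ball x ε := hmem y y hyx (by simp; positivity)
  have hzb : z ∈ Metric.ball x ε := hmem z z hzx (by simp; positivity)
  have hyb' : y' ∈ Metric.ball x ε := hmem y y' hyx hny
  have hzb' : z' ∈ Metric.ball x ε := hmem z z' hzx hnz
  have hacross : segment ℝ y' z' ⊆ S := by
    rw [segment_eq_image']
    rintro _ ⟨θ, hθ, rfl⟩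
    have e0 : (y' + θ • (z' - y')) 0 = y 0 + θ * (z 0 - y 0) := by
      simp [hy', hz', planeVec]
    have e1 : (y' + θ • (z' - y')) 1 = h := by
      simp [hy', hz', planeVec]
    simp only [hS, mem_ofPred_eq, e0, e1]
    have h2 := hγ.dist_le_mul (y 0 + θ * (z 0 - y 0)) (y 0)
    rw [Real.dist_eq, Real.dist_eq, add_sub_cancel_left, abs_mul, abs_of_nonneg hθ.1,
      abs_sub_comm (z 0)] at h2
    have h3 : θ * |y 0 - z 0| ≤ |y 0 - z 0| := mul_le_of_le_one_left (abs_nonneg _) hθ.2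
    have h4 : (K : ℝ) * (θ * |y 0 - z 0|) ≤ K * |y 0 - z 0| := by gcongr
    linarith [le_abs_self (γ (y 0 + θ * (z 0 - y 0)) - γ (y 0)), le_max_left (y 1) (z 1)]
  have s1 := hsegm y y' (hup y hyS _ hay) hyb hyb'
  have s2 := hsegm z z' (hup z hzS _ haz) hzb hzb'
  have s3 := hsegm y' z' hacross hyb' hzb'
  have hn3 : ‖z' - y'‖ ≤ (3 + 2 * K) * ‖y - z‖ := by
    have t1 := norm_sub_le_norm_sub_add_norm_sub z' z y'
    have t2 := norm_sub_le_norm_sub_add_norm_sub z y y'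
    rw [norm_sub_rev z y, norm_sub_rev y y'] at t2
    linarith
  calc ‖g y - g z‖ ≤ ‖g y' - g y‖ + ‖g z' - g y'‖ + ‖g z' - g z‖ := by
        have t1 := norm_sub_le_norm_sub_add_norm_sub (g y) (g y') (g z)
        have t2 := norm_sub_le_norm_sub_add_norm_sub (g y') (g z') (g z)
        rw [norm_sub_rev (g y) (g y')] at t1
        rw [norm_sub_rev (g y') (g z')] at t2
        linarith
    _ ≤ C * ((1 + K) * ‖y - z‖) + C * ((3 + 2 * K) * ‖y - z‖) + C * ((1 + K) * ‖y - z‖) := by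
        refine add_le_add (add_le_add (s1.trans ?_) (s3.trans ?_)) (s2.trans ?_) <;> gcongr
    _ = C * (5 + 4 * K) * ‖y - z‖ := by ring

/-! ### Homothetic diffeomorphisms as competitors. -/

section Homothetic

variable {X Y : Type*} [EMetricSpace X] [MeasurableSpace X] [BorelSpace X]
  [ChartedSpace Plane X]
  [IsManifold (𝓡 2) ∞ X] [RiemannianBundle (fun x : X => TangentSpace (𝓡 2) x)]
  [IsContMDiffRiemannianBundle (𝓡 2) ∞ Plane (fun x : X => TangentSpace (𝓡 2) x)]
  [IsRiemannianManifold (𝓡 2) X]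
  [EMetricSpace Y] [MeasurableSpace Y]
  [ChartedSpace Plane Y]
  [IsManifold (𝓡 2) ∞ Y] [RiemannianBundle (fun y : Y => TangentSpace (𝓡 2) y)]
  [IsContMDiffRiemannianBundle (𝓡 2) ∞ Plane (fun y : Y => TangentSpace (𝓡 2) y)]
  [IsRiemannianManifold (𝓡 2) Y]
  {φ : X → Y} {M : Set X} {N : Set Y} {oX : SurfaceOrientation X} {oY : SurfaceOrientation Y}

omit [MeasurableSpace X] [BorelSpace X] [IsManifold (𝓡 2) ∞ X]
  [RiemannianBundle (fun x : X => TangentSpace (𝓡 2) x)]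
  [IsContMDiffRiemannianBundle (𝓡 2) ∞ Plane (fun x : X => TangentSpace (𝓡 2) x)]
  [IsRiemannianManifold (𝓡 2) X] [MeasurableSpace Y] [IsManifold (𝓡 2) ∞ Y]
  [RiemannianBundle (fun y : Y => TangentSpace (𝓡 2) y)]
  [IsContMDiffRiemannianBundle (𝓡 2) ∞ Plane (fun y : Y => TangentSpace (𝓡 2) y)]
  [IsRiemannianManifold (𝓡 2) Y] in
theorem ContMDiffWithinAt.contDiffWithinAt_comp_charts {e : OpenPartialHomeomorph X Plane}
    {e' : OpenPartialHomeomorph Y Plane} (he : e ∈ IsManifold.maximalAtlas (𝓡 2) ∞ X)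
    (he' : e' ∈ IsManifold.maximalAtlas (𝓡 2) ∞ Y) {p : X} (hp : p ∈ e.source)
    (hp' : φ p ∈ e'.source) (hφ : ContMDiffWithinAt (𝓡 2) (𝓡 2) 1 φ M p) :
    ContDiffWithinAt ℝ 1 (e' ∘ φ ∘ e.symm) (e.symm ⁻¹' M) (e p) := by
  have h1 : ContMDiffAt (𝓡 2) (𝓡 2) 1 e.symm (e p) :=
    (contMDiffAt_symm_of_mem_maximalAtlas he (e.map_source hp)).of_le (by norm_num)
  have h2 : ContMDiffAt (𝓡 2) (𝓡 2) 1 e' (φ p) :=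
    (contMDiffAt_of_mem_maximalAtlas he' hp').of_le (by norm_num)
  have h3 : ContMDiffWithinAt (𝓡 2) (𝓡 2) 1 (e' ∘ φ) M (e.symm (e p)) := by
    rw [e.left_inv hp]
    exact h2.comp_contMDiffWithinAt p hφ
  exact contMDiffWithinAt_iff_contDiffWithinAt.1
    (h3.comp (e p) h1.contMDiffWithinAt (mapsTo_preimage _ _))

omit [MeasurableSpace X] [BorelSpace X] [MeasurableSpace Y] in
theorem exists_lipschitzOnWith_of_comp_charts {e : OpenPartialHomeomorph X Plane}
    {e' : OpenPartialHomeomorph Y Plane} (he : e ∈ IsManifold.maximalAtlas (𝓡 2) ∞ X)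
    (he' : e' ∈ IsManifold.maximalAtlas (𝓡 2) ∞ Y) {p : X} (hp : p ∈ e.source)
    (hp' : φ p ∈ e'.source) (hφ : ContinuousWithinAt φ M p) {L : ℝ≥0} {V : Set Plane}
    (hV : V ∈ 𝓝[e.symm ⁻¹' M] (e p)) (hL : LipschitzOnWith L (e' ∘ φ ∘ e.symm) V) :
    ∃ K, ∃ t ∈ 𝓝[M] p, LipschitzOnWith K φ t := by
  obtain ⟨C, U, hU, hCU⟩ := exists_lipschitzOnWith_of_mem_maximalAtlas he hp
  obtain ⟨C', W, hW, hCW⟩ := exists_lipschitzOnWith_symm_of_mem_maximalAtlas he' hp'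
  have hW' : e'.source ∩ e' ⁻¹' W ∈ 𝓝 (φ p) :=
    inter_mem (e'.open_source.mem_nhds hp') ((e'.continuousAt hp').preimage_mem_nhds hW)
  have hV' : e ⁻¹' V ∈ 𝓝[M] p := by
    obtain ⟨O, hO, hOV⟩ := mem_nhdsWithin_iff_exists_mem_nhds_inter.1 hV
    filter_upwards [self_mem_nhdsWithin, mem_nhdsWithin_of_mem_nhds (e.open_source.mem_nhds hp),
      mem_nhdsWithin_of_mem_nhds ((e.continuousAt hp).preimage_mem_nhds hO)] with x hxM hxe hxO
    refine hOV ⟨hxO, ?_⟩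
    rwa [mem_preimage, e.left_inv hxe]
  have hU' : U ∩ e.source ∈ 𝓝[M] p :=
    mem_nhdsWithin_of_mem_nhds (inter_mem hU (e.open_source.mem_nhds hp))
  refine ⟨C' * (L * C), _, inter_mem (inter_mem hU' hV') (hφ hW'), ?_⟩
  intro x hx y hy
  have hsymm : ∀ z ∈ U ∩ e.source ∩ e ⁻¹' V ∩ φ ⁻¹' (e'.source ∩ e' ⁻¹' W),
      (e' ∘ φ ∘ e.symm) (e z) = e' (φ z) := fun z hz => by
    simp only [Function.comp, e.left_inv hz.1.1.2]
  have h1 := hCU hx.1.1.1 hy.1.1.1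
  have h2 := hL hx.1.2 hy.1.2
  have h3 := hCW hx.2.2 hy.2.2
  rw [hsymm x hx, hsymm y hy] at h2
  rw [e'.left_inv hx.2.1, e'.left_inv hy.2.1] at h3
  calc edist (φ x) (φ y) ≤ C' * edist (e' (φ x)) (e' (φ y)) := h3
    _ ≤ C' * (L * edist (e x) (e y)) := by gcongr
    _ ≤ C' * (L * (C * edist x y)) := by gcongr
    _ = ↑(C' * (L * C)) * edist x y := by
      push_cast
      ring

omit [MeasurableSpace X] [BorelSpace X] [MeasurableSpace Y] in
-- At interior points a C¹ map is locally Lipschitz in charts. At boundary points M need not be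
-- convex in any chart, and the paths of `ContDiffWithinAt.exists_lipschitzOnWith_epigraph` replace
-- segments.
theorem ContMDiffOn.exists_lipschitzOnWith (hφ : ContMDiffOn (𝓡 2) (𝓡 2) 1 φ M)
    (hM : IsCompactLipschitzSurface M) : ∃ K, LipschitzOnWith K φ M := by
  refine LocallyLipschitzOn.exists_lipschitzOnWith_of_isPreconnected (fun p hp => ?_)
    hM.isCompact hM.isConnected.isPreconnected
  have hc' := IsManifold.chart_mem_maximalAtlas (I := 𝓡 2) (n := ∞) (φ p)
  have hpc' := mem_chart_source Plane (φ p)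
  by_cases hpi : p ∈ interior M
  · have hc := IsManifold.chart_mem_maximalAtlas (I := 𝓡 2) (n := ∞) p
    have hpc := mem_chart_source Plane p
    have hs := (hφ p hp).contDiffWithinAt_comp_charts hc hc' hpc hpc'
    have hn : (chartAt Plane p).symm ⁻¹' M ∈ 𝓝 (chartAt Plane p p) :=
      ((chartAt Plane p).symm.continuousAt ((chartAt Plane p).map_source hpc)).preimage_mem_nhds (by
        rw [(chartAt Plane p).left_inv hpc]
        exact mem_interior_iff_mem_nhds.1 hpi)
    obtain ⟨L, V, hV, hL⟩ := (hs.contDiffAt hn).exists_lipschitzOnWith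
    exact exists_lipschitzOnWith_of_comp_charts hc hc' hpc hpc' (hφ p hp).continuousWithinAt
      (mem_nhdsWithin_of_mem_nhds hV) hL
  · obtain ⟨e, he, hpe, γ, K, hγ, hMe⟩ := hM.lipschitz_boundary p ⟨subset_closure hp, hpi⟩
    have hs := (hφ p hp).contDiffWithinAt_comp_charts he hc' hpe hpc'
    have hnhds : 𝓝[e.symm ⁻¹' M] (e p) = 𝓝[{y | γ (y 0) ≤ y 1}] (e p) := by
      refine nhdsWithin_eq_nhdsWithin (e.map_source hpe) e.open_target ?_
      ext y
      simp only [mem_inter_iff, mem_preimage, mem_ofPred_eq]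
      refine and_congr_left fun hy => ?_
      rw [hMe _ (e.map_target hy), e.right_inv hy]
    obtain ⟨L, V, hV, hL⟩ := ContDiffWithinAt.exists_lipschitzOnWith_epigraph hγ
      ((hMe p hpe).1 hp) (hs.congr_set (nhdsWithin_eq_iff_eventuallyEq.1 hnhds))
    exact exists_lipschitzOnWith_of_comp_charts he hc' hpe hpc' (hφ p hp).continuousWithinAt
      (hnhds ▸ hV) hL

/-- Supplies a map that attains the lower bound, so that minimizing means having equality. -/
theorem AreHomothetic.exists_isLipPlusInj (h : AreHomothetic oX oY M N)
    (hM : IsCompactLipschitzSurface M) :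
    ∃ ψ : X → Y, IsLipPlusInj oX oY M N ψ ∧ IsHomothety M ψ ∧ ψ '' M = N := by
  obtain ⟨ψ, χ, hψ, hχ, hinv, hψs, -, hJ, c, hc, hs⟩ := h
  have hm : MeasurableSet M := hM.isCompact.isClosed.measurableSet
  refine ⟨ψ, ⟨hψ, (hψs.of_le (by norm_num)).exists_lipschitzOnWith hM,
    ae_restrict_of_forall_mem hm fun p hp => (hJ p hp).le,
    ae_of_all _ fun q x hx y hy => hinv.1.injOn hx.1 hy.1 (hx.2.trans hy.2.symm)⟩,
    ⟨c, hc, ae_restrict_of_forall_mem hm hs⟩, (hinv.2.surjOn hχ).image_eq_of_mapsTo hψ⟩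

end Homothetic

/-! ### Conclusion. -/

theorem IsCostFunction.exists_isStrictlySupportedAt {f : ℝ → ℝ} (hf : IsCostFunction f)
    (hC : ContDiffAt ℝ 2 f 1) (hn : NotFlatAt f 1) : ∃ α ∈ Ioo (0 : ℝ) 1, ∀ s ∈ Icc α 1,
      ∃ r c, 0 < r ∧ s = r ^ 2 ∧ 0 ≤ c ∧ IsStrictlySupportedAt f r c ∧ auxF f s = 2 * f r := by
  obtain ⟨r₀, hr₀, h⟩ := hf.exists_strict_support hC hn
  -- The area ratio is s = r², so the threshold r₀ for the stretch becomes r₀² for the ratio.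
  refine ⟨r₀ ^ 2, ⟨by have := hr₀.1; positivity, pow_lt_one₀ hr₀.1.le hr₀.2 two_ne_zero⟩,
    fun s hs => ?_⟩
  have hs0 : 0 ≤ s := (sq_nonneg r₀).trans hs.1
  have hr : √s ∈ Icc r₀ 1 := ⟨Real.le_sqrt_of_sq_le hs.1, Real.sqrt_le_one.2 hs.2⟩
  have hpos : 0 < √s := hr₀.1.trans_le hr.1
  obtain ⟨c, hc, hsupp⟩ := h _ hr
  have hsupp' : IsStrictlySupportedAt f (√s) c := hsupp
  refine ⟨√s, c, hpos, (Real.sq_sqrt hs0).symm, hc, hsupp', ?_⟩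
  rw [← hsupp'.auxF_eq hf hpos hc, Real.sq_sqrt hs0]

section Area

variable {X : Type*} [EMetricSpace X] [SecondCountableTopology X] [MeasurableSpace X]
  [BorelSpace X] [ChartedSpace Plane X]
  [IsManifold (𝓡 2) ∞ X] [RiemannianBundle (fun x : X => TangentSpace (𝓡 2) x)]
  [IsContMDiffRiemannianBundle (𝓡 2) ∞ Plane (fun x : X => TangentSpace (𝓡 2) x)] {M : Set X}

theorem IsCompact.ofReal_area (hM : IsCompact M) :
    ENNReal.ofReal (area M) = riemannianArea X M :=
  ENNReal.ofReal_toReal hM.measure_lt_top.ne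

omit [SecondCountableTopology X] [BorelSpace X] [IsManifold (𝓡 2) ∞ X]
  [IsContMDiffRiemannianBundle (𝓡 2) ∞ Plane (fun x : X => TangentSpace (𝓡 2) x)] in
theorem riemannianArea_ne_zero_of_area_pos (hM : 0 < area M) : riemannianArea X M ≠ 0 := by
  intro h
  simp [area, Measure.real, h] at hM

end Area

end

theorem theorem1p9 (f : ℝ → ℝ) (hf : IsCostFunction f) (hf_C2 : ContDiffAt ℝ 2 f 1)
    (hf_not_flat : NotFlatAt f 1) :
    ∃ α ∈ Ioo (0 : ℝ) 1,
      ∀ (X : Type*) (Y : Type*)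
        [EMetricSpace X] [SecondCountableTopology X] [MeasurableSpace X] [BorelSpace X]
        [ChartedSpace Plane X] [IsManifold (𝓡 2) ∞ X]
        [RiemannianBundle (fun x : X => TangentSpace (𝓡 2) x)]
        [IsContMDiffRiemannianBundle (𝓡 2) ∞ Plane (fun x : X => TangentSpace (𝓡 2) x)]
        [IsRiemannianManifold (𝓡 2) X]
        [EMetricSpace Y] [SecondCountableTopology Y] [MeasurableSpace Y] [BorelSpace Y]
        [ChartedSpace Plane Y] [IsManifold (𝓡 2) ∞ Y]
        [RiemannianBundle (fun y : Y => TangentSpace (𝓡 2) y)]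
        [IsContMDiffRiemannianBundle (𝓡 2) ∞ Plane (fun y : Y => TangentSpace (𝓡 2) y)]
        [IsRiemannianManifold (𝓡 2) Y]
        (oX : SurfaceOrientation X) (oY : SurfaceOrientation Y) (M : Set X) (N : Set Y),
        IsCompactLipschitzSurface M → IsCompactLipschitzSurface N →
        (α ≤ area N / area M → area N / area M ≤ 1 →
          (∀ φ : X → Y, IsLipPlusInj oX oY M N φ →
            ENNReal.ofReal (auxF f (area N / area M)) ≤ energy f M φ ∧
            (energy f M φ = ENNReal.ofReal (auxF f (area N / area M)) ↔
              IsHomothety M φ ∧ φ '' M = N)) ∧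
          (AreHomothetic oX oY M N →
            ∀ φ : X → Y, IsLipPlusInj oX oY M N φ →
              ((∀ φ' : X → Y, IsLipPlusInj oX oY M N φ' → energy f M φ ≤ energy f M φ') ↔
                IsHomothety M φ ∧ φ '' M = N))) ∧
        (area N ≤ area M →
          ∀ φ : X → Y, IsLipPlusInj oX oY M N φ → α ≤ area (φ '' M) / area M →
            ENNReal.ofReal (auxF f (area (φ '' M) / area M)) ≤ energy f M φ ∧
            (energy f M φ = ENNReal.ofReal (auxF f (area (φ '' M) / area M)) ↔
              IsHomothety M φ)) := by
  obtain ⟨α, hα, hsupp⟩ := hf.exists_isStrictlySupportedAt hf_C2 hf_not_flat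
  refine ⟨α, hα, ?_⟩
  intro X Y _ _ _ _ _ _ _ _ _ _ _ _ _ _ _ _ _ _ oX oY M N hM hN
  have hMm := hM.measurableSet
  have hNm := hN.measurableSet
  have hMt : riemannianArea X M ≠ ⊤ := hM.isCompact.measure_lt_top.ne
  -- A quotient by 0 is 0 < α, so a ratio of at least α forces M to have positive area.
  have hpos : ∀ t : ℝ, α ≤ t / area M → 0 < area M := fun t ht =>
    measureReal_nonneg.lt_of_ne fun h0 => by
      rw [area, ← h0, div_zero] at ht
      exact ht.not_gt hα.1
  -- A homothety with constant `c` has area ratio `c ^ 2` and energy `2 * f c`.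
  have hhom : ∀ φ : X → Y, IsLipPlusInj oX oY M N φ → IsHomothety M φ → 0 < area M →
      ∀ r, 0 < r → area (φ '' M) / area M = r ^ 2 →
      energy f M φ = ENNReal.ofReal (2 * f r) := by
    rintro φ hφ ⟨c, hc, hs⟩ hA r hr h
    have h1 := hφ.riemannianArea_image_eq hMm hNm hc.le hs
    rw [← hM.isCompact.ofReal_area, ← (hφ.isCompact_image hM.isCompact).ofReal_area,
      ← ENNReal.ofReal_mul (sq_nonneg c)] at h1
    have h2 : area (φ '' M) = c ^ 2 * area M :=
      (ENNReal.ofReal_eq_ofReal_iff measureReal_nonneg (by positivity)).1 h1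
    rw [h2, mul_div_cancel_right₀ _ hA.ne'] at h
    have hcr : c = r := (pow_left_inj₀ hc.le hr.le two_ne_zero).1 h
    rw [← hcr]
    exact energy_eq_of_ae_scalesMetricAt (riemannianArea_ne_zero_of_area_pos hA) hMt hf hc hs
  refine ⟨fun hα1 hα2 => ?_, fun hNM φ hφ hα1 => ?_⟩
  · have hA := hpos _ hα1
    obtain ⟨r, c, hr, hsr, hc, hrc, haux⟩ := hsupp _ ⟨hα1, hα2⟩
    have key : ∀ φ : X → Y, IsLipPlusInj oX oY M N φ →
        ENNReal.ofReal (auxF f (area N / area M)) ≤ energy f M φ ∧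
        (energy f M φ = ENNReal.ofReal (auxF f (area N / area M)) ↔
          IsHomothety M φ ∧ φ '' M = N) := by
      intro φ hφ
      rw [haux]
      have hNr : riemannianArea Y N = ENNReal.ofReal (r ^ 2) * riemannianArea X M := by
        rw [← hM.isCompact.ofReal_area, ← hN.isCompact.ofReal_area,
          ← ENNReal.ofReal_mul (sq_nonneg r), ← hsr, div_mul_cancel₀ _ hA.ne']
      obtain ⟨h1, h2⟩ := hφ.le_energy hMm hNm (riemannianArea_ne_zero_of_area_pos hA) hMt hf hr hc
        hrc ((measure_mono hφ.mapsTo.image_subset).trans_eq hNr)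
      refine ⟨h1, fun heq => ⟨⟨r, hr, h2 heq⟩, ?_⟩, fun ⟨h3, h4⟩ =>
        hhom φ hφ h3 hA r hr (by rw [h4, hsr])⟩
      -- The image is compact in N, and by the homothety property its area is r² V_M = V_N.
      refine hN.eq_of_subset (hφ.isCompact_image hM.isCompact).isClosed hφ.mapsTo.image_subset ?_
      rw [hNr, hφ.riemannianArea_image_eq hMm hNm hr.le (h2 heq)]
    refine ⟨key, fun hMN φ hφ => ⟨fun hmin => ?_, fun h φ' hφ' => ?_⟩⟩
    · obtain ⟨ψ, hψ, hψ'⟩ := hMN.exists_isLipPlusInj hM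
      -- `ψ` attains the lower bound; hence so does the minimizer, and the equality case applies to
      -- it.
      exact ((key φ hφ).2).1 (le_antisymm ((hmin ψ hψ).trans_eq (((key ψ hψ).2).2 hψ'))
        (key φ hφ).1)
    · rw [((key φ hφ).2).2 h]
      exact (key φ' hφ').1
  · have hA := hpos _ hα1
    -- Keeps the ratio at most 1, where the support inequality is available.
    have hle : area (φ '' M) ≤ area M :=
      (measureReal_mono hφ.mapsTo.image_subset hN.isCompact.measure_lt_top.ne).trans hNM
    obtain ⟨r, c, hr, hsr, hc, hrc, haux⟩ := hsupp _ ⟨hα1, (div_le_one hA).2 hle⟩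
    rw [haux]
    have hNr : riemannianArea Y (φ '' M) = ENNReal.ofReal (r ^ 2) * riemannianArea X M := by
      rw [← hM.isCompact.ofReal_area, ← (hφ.isCompact_image hM.isCompact).ofReal_area,
        ← ENNReal.ofReal_mul (sq_nonneg r), ← hsr, div_mul_cancel₀ _ hA.ne']
    obtain ⟨h1, h2⟩ := hφ.le_energy hMm hNm (riemannianArea_ne_zero_of_area_pos hA) hMt hf hr hc
      hrc hNr.le
    exact ⟨h1, fun heq => ⟨r, hr, h2 heq⟩, fun h3 => hhom φ hφ h3 hA r hr hsr⟩
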